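/- **Setting.** Let $M,P\in\mathbb N$ (possibly $0$). Elements of $\mathbf M=\{1,\dots,M\}$ are called nodes, elements of $\mathbf P=\{-P,\dots,-1\}$ chains. Each chain $p$ has a frequency $n_p\in\mathbb N^*$ and a phase $\theta_p\in[0,1/n_p)$; put $\mathcal D_p=\theta_p+\frac1{n_p}\mathbb Z$ and $\mathcal Q=\{(p,k):p\in\mathbf P,\ k\in\mathcal D_p\}$. *Parameters* $\mathfrak M$ consist of: base rates $\mu_m\in\mathbb R$ ($m\in\mathbf M$); measurable interaction functions $h^\alpha_\beta:(0,\infty)\to\mathbb R$ ($\alpha,\beta\in\mathbf M\cup\mathbf P$), weighing the past of $\beta$ in the equation of $\alpha$ and extended by $0$ to $\mathbb R$; Lipschitz masks $\kappa^\alpha_p:\mathbb R\to\mathbb R$ ($\alpha\in\mathbf M\cup\mathbf P$, $p\in\mathbf P$); nondecreasing Lipschitz link functions $\Phi^m:\mathbb R\to[0,\infty)$ ($m\in\mathbf M$); Lipschitz link functions $\Phi^p:\mathbb R\to\mathbb R$ with $\Phi^p(0)=0$ ($p\in\mathbf P$). *Noise.* On a probability space $(\Omega,\mathcal F,\mathbb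 P)$ let $\pi^m$, $m\in\mathbf M$, be Poisson random measures on $\mathbb R\times[0,\infty)$ with Lebesgue intensity (locally finite random sets of points), whose atoms, over all $m$ together, always have distinct time coordinates, and let $\xi^p_k$, $(p,k)\in\mathcal Q$, be real random variables (random drifts) such that $\xi^p_k$ and $\xi^p_{k+n}$ have the same law for all $n\in\mathbb Z$. All $\pi^m$ and all $\xi^p_k$ are jointly independent. Let $\mathcal F_t$ be the $\sigma$-algebra generated by the restrictions of the $\pi^m$ to $(-\infty,t]\times[0,\infty)$ and the $\xi^p_k$ with $k\le t$. The predictable $\sigma$-algebra on $\mathbb R\times\Omega$ is generated by the sets $(s,t]\times A$, $s<t$, $A\in\mathcal F_s$. *HAR process.* A HAR process with parameters $\mathfrak M$ started at $-\infty$ is a triple $X=((\lambda^m)_{m\in\mathbf M},(S^m)_{m\in\mathbf M},(W^p)_{p\in\mathbf P})$, where $\lambda^m=(\lambda^m_t)_{t\in\mathbb R}$ is a real predictable process, $S^m\subset\mathbb R$ is a random set of points, $W^p=(W^p_k)_{k\in\mathcal D_p}$ is real valued, $S$ and $W$ are adapted to $(\mathcal F_t)_t$, and $$\lambda^m_t=\Phi^m\Big(\mu_m+\sum_{m'\in\mathbf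 M}\int_{(-\infty,t)}h^m_{m'}(t-s)\,dS^{m'}_s+\sum_{p\in\mathbf P}\ \sum_{k\in\mathcal D_p,\,k<t}h^m_p(t-k)\,\kappa^m_p(W^p_k)\Big)$$ for every $m$ and $\mathbb P(d\omega)\otimes dt$-almost everywhere; almost surely, for all $m$ and $C\subset\mathbb R$, $\operatorname{card}(S^m\cap C)$ is the number of atoms $(s,x)$ of $\pi^m$ with $s\in C$ and $x\le\lambda^m_s$; and almost surely, for all $(p,k)\in\mathcal Q$, $$W^p_k=\xi^p_k+\Phi^p\Big(\sum_{m\in\mathbf M}\int_{(-\infty,k)}h^p_m(k-s)\,dS^m_s+\sum_{p'\in\mathbf P}\ \sum_{k'\in\mathcal D_{p'},\,k'<k}h^p_{p'}(k-k')\,\kappa^p_{p'}(W^{p'}_{k'})\Big),$$ all integrals and series being absolutely convergent wherever the equations are required to hold. Two such triples are *modifications* of each other if their intensities $\lambda^m$ agree $\mathbb P(d\omega)\otimes dt$-almost everywhere for every $m$, and if almost surely their point sets $S^m$ agree for all $m$ and their chains $W^p_k$ agree for all $(p,k)\in\mathcal Q$. The process $X$ is *1-stationary* if it has the same joint law as $$\big((\lambda^m_{t+1})_{t\in\mathbb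 R,\,m\in\mathbf M},\ (S^m-1)_{m\in\mathbf M},\ (W^p_{k+1})_{(p,k)\in\mathcal Q}\big)$$ (product $\sigma$-algebra for $\lambda$ and $W$; for the point sets, the $\sigma$-algebra generated by the numbers of points in Borel sets). *The matrix $H_{\mathfrak M}$.* Write $\|f\|_1=\int_{\mathbb R}|f|$, $\|f\|_{1,n}^\infty=\sup_{x\in\mathbb R}\sum_{k\in\mathbb Z}|f(x+k/n)|$, and $\operatorname{Lip}(f)$ for the best Lipschitz constant of $f$. The matrix $H_{\mathfrak M}$, indexed by $\mathbf M\cup\mathbf P$, has entries in $[0,\infty]$ $$(H_{\mathfrak M})_{\alpha,m}=\operatorname{Lip}(\Phi^\alpha)\,\|h^\alpha_m\|_1\quad(m\in\mathbf M),\qquad (H_{\mathfrak M})_{\alpha,p}=\operatorname{Lip}(\Phi^\alpha)\operatorname{Lip}(\kappa^\alpha_p)\,\|h^\alpha_p\|_{1,n_p}^\infty\quad(p\in\mathbf P),$$ with the convention $0\times\infty=\infty\times0=\infty$. **Theorem 3.9 (Stationary HAR processes).** Assume that all entries of $H_{\mathfrak M}$ are finite and that its spectral radius is smaller than $1$, and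 assume $\sup_{(p,k)\in\mathcal Q}\mathbb E|\xi^p_k|<\infty$. Then there exists a HAR process $X=((\lambda^m)_m,(S^m)_m,(W^p)_p)$ with parameters $\mathfrak M$ started at $-\infty$ such that $$\sup_{m\in\mathbf M,\ t\in\mathbb R}\mathbb E|\lambda^m_t|<\infty\qquad\text{and}\qquad\sup_{(p,k)\in\mathcal Q}\mathbb E|W^p_k|<\infty ,$$ and such that $X$ is 1-stationary. It is unique up to modification: every HAR process with parameters $\mathfrak M$ started at $-\infty$ that satisfies these two bounds is a modification of $X$. -/

import Mathlib

open MeasureTheory ProbabilityTheory Set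
open scoped ENNReal NNReal

namespace HAR

noncomputable section

/-! ### Point configurations and Poisson random measures -/

/-- The counting measure `dA` of a set of points `A`. For a measurable set `C`, its value at `C` is
the number of points of `A` lying in `C`. -/
def cnt {α : Type*} [MeasurableSpace α] (A : Set α) : Measure α :=
  Measure.count.restrict A

/-- A random set of points `N` (identified with its counting measure) is a Poisson random measure
with intensity measure `ν`: it is locally finite, the number of points in a measurable set `B` of
finite intensity is Poisson distributed with mean `ν B`, and the numbers of points in pairwise
disjoint measurable sets are independent. -/
structure IsPoissonRandomMeasure {α Ω : Type*} [TopologicalSpace α] [MeasurableSpace α]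
    [MeasurableSpace Ω] (N : Ω → Set α) (ν : Measure α) (μ : Measure Ω) : Prop where
  locallyFinite : ∀ ω, ∀ K : Set α, IsCompact K → (N ω ∩ K).Finite
  measurable : Measurable fun ω => cnt (N ω)
  law : ∀ B : Set α, MeasurableSet B → ν B ≠ ∞ →
    HasLaw (fun ω => cnt (N ω) B)
      ((poissonMeasure (ν B).toNNReal).map (fun n : ℕ => (n : ℝ≥0∞))) μ
  indep : ∀ (n : ℕ) (B : Fin n → Set α), (∀ i, MeasurableSet (B i)) →
    (Pairwise fun i j => Disjoint (B i) (B j)) →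
    iIndepFun (fun i ω => cnt (N ω) (B i)) μ

/-! ### Norms and Lipschitz constants -/

/-- The best Lipschitz constant of a (Lipschitz) function. -/
def lip (f : ℝ → ℝ) : ℝ≥0 := sInf {K : ℝ≥0 | LipschitzWith K f}

/-- The `L¹` norm, with values in `[0, ∞]`. -/
def normL1 (f : ℝ → ℝ) : ℝ≥0∞ := ∫⁻ t, ‖f t‖ₑ

/-- The norm `sup_x ∑_{k ∈ ℤ} |f (x + k / a)|`, with values in `[0, ∞]`. -/
def normDisc (a : ℕ) (f : ℝ → ℝ) : ℝ≥0∞ :=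
  ⨆ x : ℝ, ∑' k : ℤ, ‖f (x + (k : ℝ) / (a : ℝ))‖ₑ

/-- Multiplication on `[0, ∞]` with the convention `∞ * 0 = 0 * ∞ = ∞`. -/
def mulTop (x y : ℝ≥0∞) : ℝ≥0∞ := open Classical in if x = ∞ ∨ y = ∞ then ∞ else x * y

/-! ### Time grids, parameters, processes -/

/-- The frequencies `n_p` and phases `θ_p` of the chains. -/
structure TimeGrid (P : ℕ) where
  freq : Fin P → ℕ
  phase : Fin P → ℝ
  freq_pos : ∀ p, 0 < freq p
  phase_nonneg : ∀ p, 0 ≤ phase p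
  phase_lt : ∀ p, phase p < 1 / (freq p : ℝ)

/-- The `j`-th point `θ_p + j / n_p` of the time domain `D_p = θ_p + (1 / n_p) ℤ` of chain `p`.
Functions on `D_p` are written as functions of `j : ℤ`; shifting time by `1` shifts `j` by `n_p`. -/
def TimeGrid.time {P : ℕ} (T : TimeGrid P) (p : Fin P) (j : ℤ) : ℝ :=
  T.phase p + (j : ℝ) / (T.freq p : ℝ)

/-- The parameters of a HAR process with `M` nodes and `P` chains. `Sum.inl m` stands for the node
`m` and `Sum.inr p` for the chain `p`. The function `h α β` weighs the past of `β` in the equation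
of `α`; it is a function on `(0, ∞)`, extended by zero to the real line. -/
structure Params (M P : ℕ) where
  base : Fin M → ℝ
  h : Fin M ⊕ Fin P → Fin M ⊕ Fin P → ℝ → ℝ
  link : Fin M ⊕ Fin P → ℝ → ℝ
  mask : Fin M ⊕ Fin P → Fin P → ℝ → ℝ
  h_measurable : ∀ α β, Measurable (h α β)
  h_eq_zero : ∀ α β t, t ≤ 0 → h α β t = 0
  link_lipschitz : ∀ α, ∃ K : ℝ≥0, LipschitzWith K (link α)
  link_node_nonneg : ∀ m x, 0 ≤ link (Sum.inl m) x
  link_node_mono : ∀ m, Monotone (link (Sum.inl m))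
  link_chain_zero : ∀ p, link (Sum.inr p) 0 = 0
  mask_lipschitz : ∀ α p, ∃ K : ℝ≥0, LipschitzWith K (mask α p)

/-- The matrix `H` of the norms of the interactions, with entries in `[0, ∞]`. -/
def Params.H {M P : ℕ} (𝔐 : Params M P) (T : TimeGrid P) :
    Matrix (Fin M ⊕ Fin P) (Fin M ⊕ Fin P) ℝ≥0∞ :=
  Matrix.of fun α β =>
    match β with
    | Sum.inl m => mulTop (lip (𝔐.link α)) (normL1 (𝔐.h α (Sum.inl m)))
    | Sum.inr p => mulTop (mulTop (lip (𝔐.link α)) (lip (𝔐.mask α p)))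
        (normDisc (T.freq p) (𝔐.h α (Sum.inr p)))

/-- The spectral radius of `H` is smaller than one. With the convention `0 * ∞ = ∞`, one infinite
entry makes all entries of `H ^ 3` infinite, so this includes that all entries are finite. -/
def Params.Spec {M P : ℕ} (𝔐 : Params M P) (T : TimeGrid P) : Prop :=
  (∀ α β, 𝔐.H T α β ≠ ∞) ∧
    spectralRadius ℂ ((𝔐.H T).map fun x => ((x.toReal : ℝ) : ℂ)) < 1

/-- The random drifts have uniformly bounded first absolute moments. -/
def FiMe {P : ℕ} {Ω : Type*} [MeasurableSpace Ω] (ξ : Fin P → ℤ → Ω → ℝ) (μ : Measure Ω) : Prop :=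
  (⨆ p, ⨆ j, ∫⁻ ω, ‖ξ p j ω‖ₑ ∂μ) < ∞

/-- A triple of intensities `λ^m_t`, random sets of points `S^m ⊆ ℝ` and chains `W^p_k`, where
`W p j` is the value at the time `k = T.time p j`. -/
structure HARTriple (M P : ℕ) (Ω : Type*) where
  lam : Fin M → ℝ → Ω → ℝ
  S : Fin M → Ω → Set ℝ
  W : Fin P → ℤ → Ω → ℝ

/-! ### The driving noise and its filtration -/

/-- The driving noise: independent Poisson random measures `N m` on `ℝ × [0, ∞)` with Lebesgue
intensity, whose atoms always have distinct time coordinates, and independent random drifts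
`ξ p j`, independent of the Poisson random measures and with `1`-periodic laws. -/
structure IsDrivingNoise {M P : ℕ} (T : TimeGrid P) {Ω : Type*} [MeasurableSpace Ω]
    (N : Fin M → Ω → Set (ℝ × ℝ)) (ξ : Fin P → ℤ → Ω → ℝ) (μ : Measure Ω) : Prop where
  mark_nonneg : ∀ m ω, ∀ z ∈ N m ω, 0 ≤ z.2
  poisson : ∀ m, IsPoissonRandomMeasure (N m) (volume.restrict {z : ℝ × ℝ | 0 ≤ z.2}) μ
  distinct : ∀ ω m m', ∀ z ∈ N m ω, ∀ z' ∈ N m' ω, z.1 = z'.1 → m = m' ∧ z = z'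
  drift_measurable : ∀ p j, Measurable (ξ p j)
  drift_periodic : ∀ p j (n : ℤ), IdentDistrib (ξ p j) (ξ p (j + n * (T.freq p : ℤ))) μ μ
  indep : iIndep (Sum.elim
    (fun m : Fin M => MeasurableSpace.comap (fun ω => cnt (N m ω)) inferInstance)
    (fun q : Fin P × ℤ => MeasurableSpace.comap (ξ q.1 q.2) inferInstance)) μ

/-- The σ-algebra `F_t` generated by the Poisson random measures on `(-∞, t] × [0, ∞)` and the
random drifts up to time `t`. -/
@[reducible] def filt {M P : ℕ} (T : TimeGrid P) {Ω : Type*}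
    (N : Fin M → Ω → Set (ℝ × ℝ)) (ξ : Fin P → ℤ → Ω → ℝ) (t : ℝ) : MeasurableSpace Ω :=
  (⨆ m, MeasurableSpace.comap (fun ω => cnt (N m ω ∩ {z | z.1 ≤ t})) inferInstance) ⊔
    ⨆ p, ⨆ j, ⨆ (_ : T.time p j ≤ t), MeasurableSpace.comap (ξ p j) inferInstance

/-- The predictable σ-algebra on `ℝ × Ω` of a family of σ-algebras indexed by `ℝ`. -/
@[reducible] def predictable {Ω : Type*} (F : ℝ → MeasurableSpace Ω) : MeasurableSpace (ℝ × Ω) :=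
  MeasurableSpace.generateFrom
    {B | ∃ s t : ℝ, s < t ∧ ∃ A : Set Ω, MeasurableSet[F s] A ∧ B = Ioc s t ×ˢ A}

/-! ### The HAR equations -/

/-- The argument of the link function of `α` at time `t`, without base rate:
`∑_m ∫_{(-∞, t)} h^α_m (t - s) dS^m_s + ∑_p ∑_{k ∈ D_p, k < t} h^α_p (t - k) κ^α_p (W^p_k)`. -/
def drive {M P : ℕ} (T : TimeGrid P) (𝔐 : Params M P) {Ω : Type*} (X : HARTriple M P Ω)
    (α : Fin M ⊕ Fin P) (t : ℝ) (ω : Ω) : ℝ :=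
  (∑ m, ∫ s in Iio t, 𝔐.h α (Sum.inl m) (t - s) ∂(cnt (X.S m ω))) +
    ∑ p, ∑' j : {j : ℤ // T.time p j < t},
      𝔐.h α (Sum.inr p) (t - T.time p j) * 𝔐.mask α p (X.W p j ω)

/-- All the integrals and series in `drive` converge absolutely. -/
def DriveConverges {M P : ℕ} (T : TimeGrid P) (𝔐 : Params M P) {Ω : Type*} (X : HARTriple M P Ω)
    (α : Fin M ⊕ Fin P) (t : ℝ) (ω : Ω) : Prop :=
  (∀ m, IntegrableOn (fun s => 𝔐.h α (Sum.inl m) (t - s)) (Iio t) (cnt (X.S m ω))) ∧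
    ∀ p, Summable fun j : {j : ℤ // T.time p j < t} =>
      𝔐.h α (Sum.inr p) (t - T.time p j) * 𝔐.mask α p (X.W p j ω)

/-- `X` is a HAR process with parameters `𝔐` started at `-∞`. -/
structure IsHAR {M P : ℕ} (T : TimeGrid P) (𝔐 : Params M P) {Ω : Type*} [MeasurableSpace Ω]
    (μ : Measure Ω) (N : Fin M → Ω → Set (ℝ × ℝ)) (ξ : Fin P → ℤ → Ω → ℝ)
    (X : HARTriple M P Ω) : Prop where
  lam_predictable : ∀ m,
    Measurable[predictable (filt T N ξ)] fun z : ℝ × Ω => X.lam m z.1 z.2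
  S_adapted : ∀ m t, Measurable[filt T N ξ t] fun ω => cnt (X.S m ω ∩ Iic t)
  W_adapted : ∀ p j, Measurable[filt T N ξ (T.time p j)] (X.W p j)
  lam_eq : ∀ m, ∀ᵐ z : Ω × ℝ ∂(μ.prod volume),
    DriveConverges T 𝔐 X (Sum.inl m) z.2 z.1 ∧
      X.lam m z.2 z.1 = 𝔐.link (Sum.inl m) (𝔐.base m + drive T 𝔐 X (Sum.inl m) z.2 z.1)
  S_eq : ∀ᵐ ω ∂μ, ∀ m, ∀ C : Set ℝ,
    (X.S m ω ∩ C).encard = {z ∈ N m ω | z.1 ∈ C ∧ z.2 ≤ X.lam m z.1 ω}.encard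
  W_eq : ∀ᵐ ω ∂μ, ∀ p j,
    DriveConverges T 𝔐 X (Sum.inr p) (T.time p j) ω ∧
      X.W p j ω = ξ p j ω + 𝔐.link (Sum.inr p) (drive T 𝔐 X (Sum.inr p) (T.time p j) ω)

/-- `sup_{m, t} 𝔼|λ^m_t| < ∞` and `sup_{p, k} 𝔼|W^p_k| < ∞`. -/
def L1Bounded {M P : ℕ} {Ω : Type*} [MeasurableSpace Ω] (μ : Measure Ω)
    (X : HARTriple M P Ω) : Prop :=
  (⨆ m, ⨆ t, ∫⁻ ω, ‖X.lam m t ω‖ₑ ∂μ) < ∞ ∧ (⨆ p, ⨆ j, ∫⁻ ω, ‖X.W p j ω‖ₑ ∂μ) < ∞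

/-- Two processes are modifications of each other. -/
structure IsModification {M P : ℕ} {Ω : Type*} [MeasurableSpace Ω] (μ : Measure Ω)
    (X Y : HARTriple M P Ω) : Prop where
  lam_eq : ∀ m, ∀ᵐ z : Ω × ℝ ∂(μ.prod volume), X.lam m z.2 z.1 = Y.lam m z.2 z.1
  S_eq : ∀ᵐ ω ∂μ, ∀ m, X.S m ω = Y.S m ω
  W_eq : ∀ᵐ ω ∂μ, ∀ p j, X.W p j ω = Y.W p j ω

/-! ### 1-stationarity -/

/-- The process seen as a random element of the space of trajectories (real functions with the
product σ-algebra, point configurations with the σ-algebra generated by the counts). -/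
def HARTriple.path {M P : ℕ} {Ω : Type*} (X : HARTriple M P Ω) (ω : Ω) :
    (Fin M → ℝ → ℝ) × (Fin M → Measure ℝ) × (Fin P → ℤ → ℝ) :=
  (fun m t => X.lam m t ω, fun m => cnt (X.S m ω), fun p j => X.W p j ω)

/-- The process seen from time `1`: intensities `λ^m_{t+1}`, points `s` such that `s + 1 ∈ S^m`,
chains `W^p_{k+1}`. -/
def HARTriple.shift {M P : ℕ} (T : TimeGrid P) {Ω : Type*} (X : HARTriple M P Ω) :
    HARTriple M P Ω where
  lam := fun m t => X.lam m (t + 1)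
  S := fun m ω => {s | s + 1 ∈ X.S m ω}
  W := fun p j => X.W p (j + (T.freq p : ℤ))

/-- The joint law of the process is invariant under the time shift by `1`. -/
def IsOneStationary {M P : ℕ} (T : TimeGrid P) {Ω : Type*} [MeasurableSpace Ω] (μ : Measure Ω)
    (X : HARTriple M P Ω) : Prop :=
  IdentDistrib X.path (X.shift T).path μ μ

end

end HAR

/-! For a fixed realization of the noise the equations form a fixed point problem `u = step u` for
the trajectories `u = (λ, W)`; the points of the nodes are recovered from `λ` by thinning, that is,
by keeping the Poisson atoms below the graph. Two adapted trajectories are compared through a vector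
indexed by nodes and chains, whose entries bound the L¹(ℙ) distances of the components uniformly in
time.

The key estimate is that `step` turns a distance vector `D` into one bounded by `H D`
(`lintegral_link_sub_le`). Chain terms are controlled by the Lipschitz constants of the masks and
the periodized norm of `h`. For node terms, two thinnings of the same Poisson measure differ only at
the atoms between the two graphs (`enorm_integral_thin_sub_le`). The strip between predictable
graphs is predictable, so Campbell's formula (`IsDrivingNoise.lintegral_predictable`) replaces the
atoms by Lebesgue measure, and the expected error is at most `‖h‖₁` times the distance of the
intensities.

Spectral radius below one makes `∑ H^k d` finite for every finite vector `d`
(`tsum_iterate_mulVec_ne_top`). Hence the Picard iterates started at zero have summable increments,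
and their limit is a solution bounded in L¹. Two bounded solutions are at distance at most `H^k D`
for every `k`, hence at distance zero; their point sets then agree because the strip between the
graphs almost surely contains no atom.

Stationarity comes from the form of the solution: iterates and limit are defined realization by
realization, are measurable in the noise and commute with the time shift (`iterLim_shift`), while
the law of the noise is invariant under the shift by one (`identDistrib_noiseOf`). -/

namespace HAR

/-! ### Neumann series of a matrix with spectral radius below one -/

section SpectralRadius

open Filter Topology

/-- By Gelfand's formula `‖a ^ n‖ ^ (1 / n)` tends to the spectral radius, so `‖a ^ n‖` is
eventually dominated by `r ^ n` for some `r < 1`. -/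
theorem summable_norm_pow_of_spectralRadius_lt_one {A : Type*} [NormedRing A] [NormedAlgebra ℂ A]
    [CompleteSpace A] (a : A) (ha : spectralRadius ℂ a < 1) : Summable fun n : ℕ => ‖a ^ n‖ := by
  obtain ⟨r, har, hr⟩ := ENNReal.lt_iff_exists_nnreal_btwn.1 ha
  have hr1 : r < 1 := by exact_mod_cast hr
  have h := (spectrum.pow_nnnorm_pow_one_div_tendsto_nhds_spectralRadius a).eventually_lt_const har
  refine Summable.of_norm_bounded_eventually_nat (g := fun n => (r : ℝ) ^ n)
    (summable_geometric_of_lt_one r.2 (by exact_mod_cast hr1)) ?_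
  filter_upwards [h, eventually_gt_atTop 0] with n hn hn0
  have h1 : (‖a ^ n‖₊ : ℝ≥0∞) ≤ (r : ℝ≥0∞) ^ n := by
    have h2 := ENNReal.rpow_le_rpow hn.le (z := n) (by positivity)
    rwa [← ENNReal.rpow_mul, one_div_mul_cancel (by positivity), ENNReal.rpow_one,
      ENNReal.rpow_natCast] at h2
  rw [norm_norm]
  exact_mod_cast h1

attribute [local instance] Matrix.linftyOpNormedRing Matrix.linftyOpNormedAlgebra

/-- Since all entries are finite, the iterates are powers of the complex matrix applied to `d`, and
the previous lemma bounds them. The row-sum operator norm serves only as a Banach algebra norm; the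
spectral radius does not depend on it. -/
theorem tsum_iterate_mulVec_ne_top {ι : Type*} [Fintype ι] [DecidableEq ι]
    (A : Matrix ι ι ℝ≥0∞) (hA : ∀ i j, A i j ≠ ∞)
    (hs : spectralRadius ℂ (A.map fun x => ((x.toReal : ℝ) : ℂ)) < 1)
    (d : ι → ℝ≥0∞) (hd : ∀ i, d i ≠ ∞) (i : ι) : ∑' k : ℕ, (A.mulVec^[k] d) i ≠ ∞ := by
  set B : Matrix ι ι ℂ := A.map fun x => ((x.toReal : ℝ) : ℂ) with hB
  have hfin : ∀ k i, (A.mulVec^[k] d) i ≠ ∞ := by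
    intro k
    induction k with
    | zero => exact hd
    | succ k ih =>
      intro i
      rw [Function.iterate_succ_apply']
      exact ENNReal.sum_ne_top.2 fun j _ => ENNReal.mul_ne_top (hA i j) (ih j)
  have hpow : ∀ k, (fun i => (((A.mulVec^[k] d) i).toReal : ℂ)) =
      (B ^ k).mulVec fun i => ((d i).toReal : ℂ) := by
    intro k
    induction k with
    | zero => simp
    | succ k ih =>
      rw [pow_succ', ← Matrix.mulVec_mulVec, ← ih]
      ext i
      rw [Function.iterate_succ_apply']
      simp only [Matrix.mulVec, dotProduct, hB, Matrix.map_apply]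
      rw [ENNReal.toReal_sum fun j _ => ENNReal.mul_ne_top (hA i j) (hfin k j)]
      push_cast [ENNReal.toReal_mul]
      rfl
  have hsum := summable_norm_pow_of_spectralRadius_lt_one B hs
  have hbound : ∀ k, ((A.mulVec^[k] d) i).toReal ≤
      ‖B ^ k‖ * ‖fun i => ((d i).toReal : ℂ)‖ := by
    intro k
    refine le_trans ?_ (Matrix.linfty_opNorm_mulVec (B ^ k) fun i => ((d i).toReal : ℂ))
    rw [← hpow k]
    refine le_trans ?_ (norm_le_pi_norm _ i)
    simp
  have hs' : Summable fun k => ((A.mulVec^[k] d) i).toReal :=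
    Summable.of_nonneg_of_le (fun _ => ENNReal.toReal_nonneg) hbound (hsum.mul_right _)
  have : ∑' k : ℕ, (A.mulVec^[k] d) i = ∑' k : ℕ, ENNReal.ofReal ((A.mulVec^[k] d) i).toReal := by
    congr 1 with k
    rw [ENNReal.ofReal_toReal (hfin k i)]
  rw [this]
  exact hs'.tsum_ofReal_ne_top

end SpectralRadius

/-! ### Integrals with respect to random measures -/

section RandomMeasure

variable {A B : Type*} [MeasurableSpace A] [MeasurableSpace B]

/-- Cutting the source space according to the integer part of the total mass gives pieces bounded by
`n + 1`. -/
theorem isSFiniteKernel_of_forall_ne_top (κ : Kernel A B) (h : ∀ a, κ a univ ≠ ∞) :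
    IsSFiniteKernel κ := by
  classical
  let s : ℕ → Set A := fun n => {a | ⌊(κ a univ).toNNReal⌋₊ = n}
  have hs : ∀ n, MeasurableSet (s n) := fun n =>
    (Nat.measurable_floor.comp (κ.measurable_coe MeasurableSet.univ).ennreal_toNNReal)
      (measurableSet_singleton n)
  have hκ : κ = Kernel.sum fun n => Kernel.piecewise (hs n) κ 0 := by
    ext a t ht
    rw [Kernel.sum_apply' _ _ ht, tsum_eq_single ⌊(κ a univ).toNNReal⌋₊]
    · simp [Kernel.piecewise_apply, s]
    · intro n hn
      simp [Kernel.piecewise_apply, s, hn.symm]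
  have : ∀ n, IsFiniteKernel (Kernel.piecewise (hs n) κ 0) := by
    intro n
    refine ⟨⟨n + 1, by finiteness, fun a => ?_⟩⟩
    rw [Kernel.piecewise_apply]
    split_ifs with ha
    · rw [← ENNReal.coe_toNNReal (h a)]
      have := (Nat.lt_floor_add_one (κ a univ).toNNReal).le
      rw [show ⌊(κ a univ).toNNReal⌋₊ = n from ha] at this
      exact_mod_cast this
    · simp
  rw [hκ]
  infer_instance

/-- The counting measure of a Poisson configuration has infinite mass but is finite on boxes.
Restricting to the disjointed cover gives s-finiteness, on which measurability of random integrals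
and Fubini rely. -/
theorem isSFiniteKernel_of_cover (κ : Kernel A B) (D : ℕ → Set B) (hD : ∀ n, MeasurableSet (D n))
    (hU : ⋃ n, D n = univ) (h : ∀ a n, κ a (D n) ≠ ∞) : IsSFiniteKernel κ := by
  have hd : ∀ n, MeasurableSet (disjointed D n) := MeasurableSet.disjointed hD
  have hκ : κ = Kernel.sum fun n => κ.restrict (hd n) := by
    ext a t ht
    rw [Kernel.sum_apply' _ _ ht]
    simp_rw [Kernel.restrict_apply, Measure.restrict_apply ht]
    have hdisj : Pairwise fun i j => Disjoint (t ∩ disjointed D i) (t ∩ disjointed D j) :=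
      fun i j hij => (disjoint_disjointed D hij).mono inter_subset_right inter_subset_right
    rw [← measure_iUnion hdisj fun n => ht.inter (hd n), ← inter_iUnion, iUnion_disjointed, hU,
      inter_univ]
  have : ∀ n, IsSFiniteKernel (κ.restrict (hd n)) := by
    intro n
    refine isSFiniteKernel_of_forall_ne_top _ fun a => ?_
    rw [Kernel.restrict_apply, Measure.restrict_apply_univ]
    exact ne_top_of_le_ne_top (h a n) (measure_mono (disjointed_subset D n))
  rw [hκ]
  infer_instance

end RandomMeasure

/-- The square with side length `2 n` centred at the origin. -/
def box (n : ℕ) : Set (ℝ × ℝ) := Icc (-(n : ℝ)) n ×ˢ Icc (-(n : ℝ)) n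

theorem measurableSet_box (n : ℕ) : MeasurableSet (box n) :=
  measurableSet_Icc.prod measurableSet_Icc

theorem isCompact_box (n : ℕ) : IsCompact (box n) := isCompact_Icc.prod isCompact_Icc

theorem box_mono : Monotone box := by
  intro a b hab
  have : (a : ℝ) ≤ b := by exact_mod_cast hab
  exact prod_mono (Icc_subset_Icc (by linarith) this) (Icc_subset_Icc (by linarith) this)

theorem iUnion_box : ⋃ n, box n = univ := by
  refine eq_univ_of_forall fun z => mem_iUnion.2 ?_
  obtain ⟨n, hn⟩ := exists_nat_ge (max |z.1| |z.2|)
  have h1 := abs_le.1 ((le_max_left _ _).trans hn)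
  have h2 := abs_le.1 ((le_max_right _ _).trans hn)
  exact ⟨n, h1, h2⟩

/-- A measure on the plane that is finite on bounded sets. -/
def BoxFinite (ρ : Measure (ℝ × ℝ)) : Prop := ∀ n, ρ (box n) ≠ ∞

theorem BoxFinite.restrict {ρ : Measure (ℝ × ℝ)} (h : BoxFinite ρ) (s : Set (ℝ × ℝ)) :
    BoxFinite (ρ.restrict s) := fun n =>
  ne_top_of_le_ne_top (h n) (Measure.restrict_apply_le _ _)

theorem isSFiniteKernel_of_boxFinite {A : Type*} [MeasurableSpace A] (κ : Kernel A (ℝ × ℝ))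
    (h : ∀ a, BoxFinite (κ a)) : IsSFiniteKernel κ :=
  isSFiniteKernel_of_cover κ box measurableSet_box iUnion_box h

theorem measurable_lintegral_of_boxFinite {A : Type*} [MeasurableSpace A]
    {ρ : A → Measure (ℝ × ℝ)} (hρ : Measurable ρ) (h : ∀ a, BoxFinite (ρ a))
    {f : A × (ℝ × ℝ) → ℝ≥0∞} (hf : Measurable f) : Measurable fun a => ∫⁻ z, f (a, z) ∂ρ a := by
  let κ : Kernel A (ℝ × ℝ) := ⟨ρ, hρ⟩
  have : IsSFiniteKernel κ := isSFiniteKernel_of_boxFinite κ h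
  exact hf.lintegral_kernel_prod_right' (κ := κ)

theorem measurable_integral_of_boxFinite {A : Type*} [MeasurableSpace A]
    {ρ : A → Measure (ℝ × ℝ)} (hρ : Measurable ρ) (h : ∀ a, BoxFinite (ρ a))
    {f : A × (ℝ × ℝ) → ℝ} (hf : Measurable f) : Measurable fun a => ∫ z, f (a, z) ∂ρ a := by
  let κ : Kernel A (ℝ × ℝ) := ⟨ρ, hρ⟩
  have : IsSFiniteKernel κ := isSFiniteKernel_of_boxFinite κ h
  exact (hf.stronglyMeasurable.integral_kernel_prod_right' (κ := κ)).measurable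

/-! ### The predictable σ-algebra -/

section Predictable

variable {Ω : Type*} {F : ℝ → MeasurableSpace Ω}

theorem measurableSet_predictable_Ioi (a : ℝ) {A : Set Ω} (hA : MeasurableSet[F a] A) :
    MeasurableSet[predictable F] (Ioi a ×ˢ A) := by
  have : Ioi a ×ˢ A = ⋃ n : ℕ, Ioc a (a + (n + 1)) ×ˢ A := by
    rw [← iUnion_prod_const]
    congr 1
    ext t
    simp only [mem_Ioi, mem_iUnion, mem_Ioc]
    refine ⟨fun h => ?_, fun ⟨_, h, _⟩ => h⟩
    obtain ⟨n, hn⟩ := exists_nat_ge (t - a)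
    exact ⟨n, h, by linarith⟩
  rw [this]
  refine @MeasurableSet.iUnion _ _ (predictable F) _ _ fun n => ?_
  exact MeasurableSpace.measurableSet_generateFrom ⟨a, _, by linarith [(n.cast_nonneg : (0 : ℝ) ≤ n)],
    A, hA, rfl⟩

/-- This is how chain values enter the intensities: `W^p_k` is known at time `k` and is used only at
times strictly after `k`. -/
theorem measurable_predictable_ite {β : Type*} [MeasurableSpace β] (a : ℝ) {f : Ω → β}
    (hf : Measurable[F a] f) (c : β) :
    Measurable[predictable F] fun z : ℝ × Ω => if a < z.1 then f z.2 else c := by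
  classical
  intro s hs
  have h1 := measurableSet_predictable_Ioi a (hf hs)
  have h2 := measurableSet_predictable_Ioi (F := F) a (@MeasurableSet.univ _ (F a))
  by_cases hc : c ∈ s
  · convert @MeasurableSet.union _ (predictable F) _ _ h1 (@MeasurableSet.compl _ _ (predictable F) h2)
      using 1
    ext ⟨t, ω⟩
    by_cases h : a < t <;> simp [h, hc]
  · convert h1 using 1
    ext ⟨t, ω⟩
    by_cases h : a < t <;> simp [h, hc]

theorem measurable_predictable_fst : Measurable[predictable F] (Prod.fst : ℝ × Ω → ℝ) := by
  let _ := predictable F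
  refine measurable_of_Ioi fun a => ?_
  convert measurableSet_predictable_Ioi (F := F) a (@MeasurableSet.univ _ (F a)) using 1
  ext ⟨t, ω⟩; simp

theorem predictable_le [mΩ : MeasurableSpace Ω] (hF : ∀ t, F t ≤ mΩ) :
    predictable F ≤ (inferInstance : MeasurableSpace (ℝ × Ω)) := by
  refine MeasurableSpace.generateFrom_le ?_
  rintro _ ⟨s, t, -, A, hA, rfl⟩
  exact measurableSet_Ioc.prod (hF s _ hA)

/-- Predictable processes are adapted: if `a < t ≤ b`, the section at `t` of `(a, b] × A` is `A`,
which lies in `F a ≤ F t`. -/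
theorem measurable_prodMk_predictable (hF : Monotone F) (t : ℝ) :
    Measurable[F t, predictable F] fun ω => (t, ω) := by
  refine @measurable_generateFrom _ _ (F t) _ _ ?_
  rintro _ ⟨a, b, -, A, hA, rfl⟩
  by_cases h : t ∈ Ioc a b
  · convert hF h.1.le _ hA using 1
    ext ω; simp [h.1, h.2]
  · convert @MeasurableSet.empty _ (F t) using 1
    ext ω
    simp only [mem_preimage, mem_prod, h, false_and, mem_empty_iff_false]

/-- A property of sets that holds for the generating rectangles and passes to complements and
countable unions relatively to the preimages under a map `φ`. -/
theorem measurable_ite_of_generator {γ β : Type*} [MeasurableSpace γ] [MeasurableSpace β]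
    (φ : γ → ℝ × Ω) {D : Set γ} [DecidablePred (· ∈ D)] (hD : MeasurableSet D)
    (h : ∀ a b : ℝ, ∀ A, MeasurableSet[F a] A → MeasurableSet (D ∩ φ ⁻¹' (Ioc a b ×ˢ A)))
    {l : ℝ × Ω → β} (hl : Measurable[predictable F] l) (c : β) :
    Measurable fun x => if x ∈ D then l (φ x) else c := by
  have key : ∀ B, MeasurableSet[predictable F] B → MeasurableSet (D ∩ φ ⁻¹' B) := by
    refine MeasurableSpace.generateFrom_induction _ _ ?_ ?_ ?_ ?_
    · rintro _ ⟨a, b, -, A, hA, rfl⟩ -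
      exact h a b A hA
    · simp
    · intro B _ hB
      convert hD.diff hB using 1
      ext x; simp only [mem_inter_iff, mem_preimage, mem_compl_iff, mem_sdiff]; tauto
    · intro B _ hB
      rw [preimage_iUnion, inter_iUnion]
      exact MeasurableSet.iUnion hB
  intro s hs
  by_cases hc : c ∈ s
  · convert (key _ (hl hs)).union hD.compl using 1
    ext x
    by_cases h : x ∈ D <;> simp [h, hc]
  · convert key _ (hl hs) using 1
    ext x
    by_cases h : x ∈ D <;> simp [h, hc]

/-- A rectangle `(a, b] × A` meets the times up to `t` only if `a < t`, and then `A` belongs to `F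
t`. -/
theorem measurable_progressive {β : Type*} [MeasurableSpace β] (hF : Monotone F) (t : ℝ)
    {l : ℝ × Ω → β} (hl : Measurable[predictable F] l) (c : β) :
    Measurable[(F t).prod inferInstance]
      fun x : Ω × ℝ => if x.2 ≤ t then l (x.2, x.1) else c := by
  let := F t
  refine measurable_ite_of_generator (D := {x : Ω × ℝ | x.2 ≤ t})
    (fun x : Ω × ℝ => (x.2, x.1)) (measurableSet_le measurable_snd measurable_const) ?_ hl c
  intro a b A hA
  rcases lt_or_ge a t with h | h
  · have hA' : MeasurableSet A := hF h.le _ hA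
    convert hA'.prod (measurableSet_Ioc.inter measurableSet_Iic : MeasurableSet (Ioc a b ∩ Iic t))
      using 1
    ext ⟨ω, s⟩; simp; tauto
  · convert MeasurableSet.empty (α := Ω × ℝ) using 1
    ext ⟨ω, s⟩; simp; intros; linarith

/-- On `s < t`, membership of `(s, ω)` in `(a, b] × A` forces `a < t`, so it can be rewritten with
the predictable set `(a, ∞) × A` for `(t, ω)` and the interval `(a, b]` for `s`. -/
theorem measurable_predictable_past {β : Type*} [MeasurableSpace β]
    {l : ℝ × Ω → β} (hl : Measurable[predictable F] l) (c : β) :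
    Measurable[(predictable F).prod inferInstance]
      fun x : (ℝ × Ω) × ℝ => if x.2 < x.1.1 then l (x.2, x.1.2) else c := by
  let : MeasurableSpace (ℝ × Ω) := predictable F
  have hfst : Measurable fun x : (ℝ × Ω) × ℝ => x.1.1 :=
    (measurable_predictable_fst (F := F)).comp measurable_fst
  refine measurable_ite_of_generator (D := {x : (ℝ × Ω) × ℝ | x.2 < x.1.1})
    (fun x : (ℝ × Ω) × ℝ => (x.2, x.1.2)) (measurableSet_lt measurable_snd hfst) ?_ hl c
  intro a b A hA
  have hA' : MeasurableSet (Ioi a ×ˢ A) := measurableSet_predictable_Ioi a hA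
  convert (measurableSet_lt measurable_snd hfst).inter
    (hA'.prod (measurableSet_Ioc : MeasurableSet (Ioc a b))) using 1
  ext ⟨⟨t, ω⟩, s⟩
  simp only [mem_inter_iff, mem_ofPred_eq, mem_preimage, mem_prod, mem_Ioc, mem_Ioi]
  constructor
  · rintro ⟨h1, h2, h3⟩; exact ⟨h1, ⟨h2.1.trans h1, h3⟩, h2⟩
  · rintro ⟨h1, ⟨_, h3⟩, h2⟩; exact ⟨h1, h2, h3⟩

/-- The open past of `t` is the union of the closed pasts of the rationals `q < t`. The mass of each
is known at time `q` and used only after it. Putting `∅` for `q ≥ t` keeps the index set independent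
of `t` and the union directed. -/
theorem measurable_predictable_restrict {ρ : Ω → Measure (ℝ × ℝ)}
    (hρ : ∀ t, Measurable[F t] fun ω => (ρ ω).restrict {z | z.1 ≤ t}) :
    Measurable[predictable F] fun x : ℝ × Ω => (ρ x.2).restrict {z | z.1 < x.1} := by
  refine @Measure.measurable_of_measurable_coe _ _ _ (predictable F) _ fun C hC => ?_
  have h : (fun x : ℝ × Ω => (ρ x.2).restrict {z | z.1 < x.1} C) = fun x =>
      ⨆ q : ℚ, if (q : ℝ) < x.1 then (ρ x.2).restrict {z | z.1 ≤ (q : ℝ)} C else 0 := by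
    ext ⟨t, ω⟩
    have hU : C ∩ {z : ℝ × ℝ | z.1 < t} =
        ⋃ q : ℚ, if (q : ℝ) < t then C ∩ {z : ℝ × ℝ | z.1 ≤ q} else ∅ := by
      ext z
      simp only [mem_inter_iff, mem_ofPred_eq, mem_iUnion]
      constructor
      · rintro ⟨h1, h2⟩
        obtain ⟨q, hq1, hq2⟩ := exists_rat_btwn h2
        exact ⟨q, by rw [if_pos hq2]; exact ⟨h1, hq1.le⟩⟩
      · rintro ⟨q, hq⟩
        split_ifs at hq with h3
        · exact ⟨hq.1, lt_of_le_of_lt hq.2 h3⟩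
        · exact hq.elim
    rw [Measure.restrict_apply hC, hU, Directed.measure_iUnion]
    · congr 1 with q
      split_ifs
      · rw [Measure.restrict_apply hC]
      · simp
    · have hsub : ∀ p q : ℚ, (q : ℝ) < t → p ≤ q →
          (if (p : ℝ) < t then C ∩ {z : ℝ × ℝ | z.1 ≤ p} else ∅) ⊆
            if (q : ℝ) < t then C ∩ {z : ℝ × ℝ | z.1 ≤ q} else ∅ := by
        intro p q hq hpq
        have hpq' : (p : ℝ) ≤ q := by exact_mod_cast hpq
        rw [if_pos hq, if_pos (hpq'.trans_lt hq)]
        exact fun z hz => ⟨hz.1, le_trans hz.2 hpq'⟩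
      intro p q
      by_cases hp : (p : ℝ) < t
      · by_cases hq : (q : ℝ) < t
        · rcases le_total p q with hpq | hpq
          · exact ⟨q, hsub p q hq hpq, subset_rfl⟩
          · exact ⟨p, subset_rfl, hsub q p hp hpq⟩
        · exact ⟨p, subset_rfl, by simp [hq]⟩
      · exact ⟨q, by simp [hp], subset_rfl⟩
  rw [h]
  let _ := predictable F
  refine Measurable.iSup fun q => ?_
  exact measurable_predictable_ite _ ((Measure.measurable_coe hC).comp (hρ q)) 0

end Predictable

/-! ### Thinning -/

/-- The projection to the time axis of the points of a measure on the plane that lie below the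
graph of `l`. -/
noncomputable def thin (ρ : Measure (ℝ × ℝ)) (l : ℝ → ℝ) : Measure ℝ :=
  (ρ.restrict {z | z.2 ≤ l z.1}).map Prod.fst

theorem measurableSet_subgraph {l : ℝ → ℝ} (hl : Measurable l) :
    MeasurableSet {z : ℝ × ℝ | z.2 ≤ l z.1} :=
  measurableSet_le measurable_snd (hl.comp measurable_fst)

theorem lintegral_thin (ρ : Measure (ℝ × ℝ)) {l : ℝ → ℝ} (hl : Measurable l) {f : ℝ → ℝ≥0∞}
    (hf : Measurable f) :
    ∫⁻ s, f s ∂thin ρ l = ∫⁻ z, (if z.2 ≤ l z.1 then f z.1 else 0) ∂ρ := by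
  rw [thin, lintegral_map hf measurable_fst, ← lintegral_indicator (measurableSet_subgraph hl)]
  rfl

theorem integral_thin (ρ : Measure (ℝ × ℝ)) {l : ℝ → ℝ} (hl : Measurable l) {f : ℝ → ℝ}
    (hf : Measurable f) :
    ∫ s, f s ∂thin ρ l = ∫ z, (if z.2 ≤ l z.1 then f z.1 else 0) ∂ρ := by
  rw [thin, integral_map measurable_fst.aemeasurable hf.aestronglyMeasurable,
    ← integral_indicator (measurableSet_subgraph hl)]
  rfl

theorem thin_apply (ρ : Measure (ℝ × ℝ)) (l : ℝ → ℝ) {C : Set ℝ}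
    (hC : MeasurableSet C) : thin ρ l C = ρ {z | z.1 ∈ C ∧ z.2 ≤ l z.1} := by
  rw [thin, Measure.map_apply measurable_fst hC, Measure.restrict_apply (measurable_fst hC)]
  rfl

/-- The points with times in `D` depend on `l` only through its values on `D`. Overwriting `l`
elsewhere by a constant leaves a function that is measurable with respect to the past alone. -/
theorem thin_restrict (ρ : Measure (ℝ × ℝ)) {l : ℝ → ℝ} (hl : Measurable l) {D : Set ℝ}
    [DecidablePred (· ∈ D)] (hD : MeasurableSet D) (c : ℝ) :
    (thin ρ l).restrict D =
      thin (ρ.restrict {z | z.1 ∈ D}) (fun s => if s ∈ D then l s else c) := by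
  ext C hC
  have hl' : Measurable fun s => if s ∈ D then l s else c := Measurable.ite hD hl measurable_const
  rw [Measure.restrict_apply hC, thin_apply ρ l (hC.inter hD), thin_apply _ _ hC]
  refine Eq.trans ?_ (Measure.restrict_apply ((measurable_fst hC).inter (measurableSet_subgraph hl'))).symm
  congr 1
  ext z
  simp only [mem_inter_iff, mem_ofPred_eq]
  constructor
  · rintro ⟨⟨h1, h2⟩, h3⟩; exact ⟨⟨h1, by rwa [if_pos h2]⟩, h2⟩
  · rintro ⟨⟨h1, h3⟩, h2⟩; exact ⟨⟨h1, h2⟩, by rwa [if_pos h2] at h3⟩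

section

variable {A : Type*} [MeasurableSpace A] {ρ : A → Measure (ℝ × ℝ)} {l : A × ℝ → ℝ}

theorem measurable_subgraph_ite (hl : Measurable l) {β : Type*} [MeasurableSpace β] [Zero β]
    {f : A × ℝ → β} (hf : Measurable f) :
    Measurable fun x : A × (ℝ × ℝ) => if x.2.2 ≤ l (x.1, x.2.1) then f (x.1, x.2.1) else 0 :=
  Measurable.ite (measurableSet_le (by fun_prop) (by fun_prop)) (by fun_prop) measurable_const

theorem measurable_lintegral_thin (hρ : Measurable ρ) (hb : ∀ a, BoxFinite (ρ a))
    (hl : Measurable l) {f : A × ℝ → ℝ≥0∞} (hf : Measurable f) :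
    Measurable fun a => ∫⁻ s, f (a, s) ∂thin (ρ a) (fun s => l (a, s)) := by
  have : ∀ a, ∫⁻ s, f (a, s) ∂thin (ρ a) (fun s => l (a, s)) = _ := fun a =>
    lintegral_thin (ρ a) (hl.comp measurable_prodMk_left) (hf.comp measurable_prodMk_left)
  simp_rw [this]
  exact measurable_lintegral_of_boxFinite hρ hb (measurable_subgraph_ite hl hf)

theorem measurable_integral_thin (hρ : Measurable ρ) (hb : ∀ a, BoxFinite (ρ a))
    (hl : Measurable l) {f : A × ℝ → ℝ} (hf : Measurable f) :
    Measurable fun a => ∫ s, f (a, s) ∂thin (ρ a) (fun s => l (a, s)) := by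
  have : ∀ a, ∫ s, f (a, s) ∂thin (ρ a) (fun s => l (a, s)) = _ := fun a =>
    integral_thin (ρ a) (hl.comp measurable_prodMk_left) (hf.comp measurable_prodMk_left)
  simp_rw [this]
  exact measurable_integral_of_boxFinite hρ hb (measurable_subgraph_ite hl hf)

theorem measurable_thin (hρ : Measurable ρ) (hb : ∀ a, BoxFinite (ρ a)) (hl : Measurable l) :
    Measurable fun a => thin (ρ a) (fun s => l (a, s)) := by
  refine Measure.measurable_of_measurable_coe _ fun C hC => ?_
  simp_rw [← lintegral_indicator_one hC]
  exact measurable_lintegral_thin hρ hb hl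
    (f := fun x => C.indicator 1 x.2) ((measurable_one.indicator hC).comp measurable_snd)

end

/-! ### Thinnings below a predictable intensity -/

section PredictableThinning

variable {Ω : Type*} {F : ℝ → MeasurableSpace Ω} {ρ : Ω → Measure (ℝ × ℝ)} {l : ℝ × Ω → ℝ}

theorem measurable_section_of_predictable {β : Type*} [MeasurableSpace β] {l : ℝ × Ω → β}
    (hl : Measurable[predictable F] l) (ω : Ω) : Measurable fun s => l (s, ω) := by
  refine hl.comp ?_
  refine @measurable_generateFrom _ _ _ _ _ ?_
  rintro _ ⟨a, b, -, A, -, rfl⟩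
  by_cases h : ω ∈ A
  · convert (measurableSet_Ioc : MeasurableSet (Ioc a b)) using 1
    ext s; simp [h]
  · convert (MeasurableSet.empty : MeasurableSet (∅ : Set ℝ)) using 1
    ext s; simp [h]

theorem measurable_thin_restrict_Iic (hF : Monotone F)
    (hρ : ∀ t, Measurable[F t] fun ω => (ρ ω).restrict {z | z.1 ≤ t})
    (hb : ∀ ω, BoxFinite (ρ ω)) (hl : Measurable[predictable F] l) (t : ℝ) :
    Measurable[F t] fun ω => (thin (ρ ω) fun s => l (s, ω)).restrict (Iic t) := by
  simp_rw [fun ω => thin_restrict (ρ ω) (measurable_section_of_predictable hl ω)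
    (measurableSet_Iic : MeasurableSet (Iic t)) 0]
  let _ := F t
  exact measurable_thin (hρ t) (fun ω => (hb ω).restrict _) (measurable_progressive hF t hl 0)

/-- The integral over the open past involves only the atoms and the intensity strictly before `t`,
and both are predictable in `(t, ω)`; a closed endpoint would destroy this. -/
theorem measurable_predictable_integral_thin
    (hρ : ∀ t, Measurable[F t] fun ω => (ρ ω).restrict {z | z.1 ≤ t})
    (hb : ∀ ω, BoxFinite (ρ ω)) (hl : Measurable[predictable F] l) {g : ℝ → ℝ}
    (hg : Measurable g) :
    Measurable[predictable F] fun x : ℝ × Ω =>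
      ∫ s in Iio x.1, g (x.1 - s) ∂thin (ρ x.2) (fun s => l (s, x.2)) := by
  simp_rw [fun x : ℝ × Ω => thin_restrict (ρ x.2) (measurable_section_of_predictable hl x.2)
    (measurableSet_Iio : MeasurableSet (Iio x.1)) 0]
  have h1 := measurable_predictable_restrict hρ
  have h2 := measurable_predictable_past hl 0
  have h3 := measurable_predictable_fst (F := F)
  let _ := predictable F
  exact measurable_integral_thin h1 (fun x => (hb x.2).restrict _) h2
    (f := fun y => g (y.1.1 - y.2))
    (hg.comp ((h3.comp measurable_fst).sub measurable_snd))

theorem measurable_predictable_lintegral_thin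
    (hρ : ∀ t, Measurable[F t] fun ω => (ρ ω).restrict {z | z.1 ≤ t})
    (hb : ∀ ω, BoxFinite (ρ ω)) (hl : Measurable[predictable F] l) {g : ℝ → ℝ≥0∞}
    (hg : Measurable g) :
    Measurable[predictable F] fun x : ℝ × Ω =>
      ∫⁻ s in Iio x.1, g (x.1 - s) ∂thin (ρ x.2) (fun s => l (s, x.2)) := by
  simp_rw [fun x : ℝ × Ω => thin_restrict (ρ x.2) (measurable_section_of_predictable hl x.2)
    (measurableSet_Iio : MeasurableSet (Iio x.1)) 0]
  have h1 := measurable_predictable_restrict hρ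
  have h2 := measurable_predictable_past hl 0
  have h3 := measurable_predictable_fst (F := F)
  let _ := predictable F
  exact measurable_lintegral_thin h1 (fun x => (hb x.2).restrict _) h2
    (f := fun y => g (y.1.1 - y.2))
    (hg.comp ((h3.comp measurable_fst).sub measurable_snd))

end PredictableThinning

/-! ### The HAR map on trajectories -/

section HARMap

variable {M P : ℕ}

/-- The drive of `α` at time `t` when the points of the nodes are given by the measures `ρ` and the
chains by `w`. -/
noncomputable def driveOf (T : TimeGrid P) (𝔐 : Params M P) (ρ : Fin M → Measure ℝ)
    (w : Fin P → ℤ → ℝ) (α : Fin M ⊕ Fin P) (t : ℝ) : ℝ :=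
  (∑ m, ∫ s in Iio t, 𝔐.h α (Sum.inl m) (t - s) ∂ρ m) +
    ∑ p, ∑' j : {j : ℤ // T.time p j < t},
      𝔐.h α (Sum.inr p) (t - T.time p j) * 𝔐.mask α p (w p j)

/-- Trajectories of intensities and chains. -/
abbrev Traj (M P : ℕ) : Type := (Fin M → ℝ → ℝ) × (Fin P → ℤ → ℝ)

/-- Realizations of the noise. -/
abbrev NoiseSpace (M P : ℕ) : Type := (Fin M → Measure (ℝ × ℝ)) × (Fin P → ℤ → ℝ)

/-- One Picard iteration for the HAR equations driven by the noise `η`. -/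
noncomputable def step (T : TimeGrid P) (𝔐 : Params M P) (η : NoiseSpace M P) (u : Traj M P) :
    Traj M P :=
  (fun m t => 𝔐.link (Sum.inl m)
      (𝔐.base m + driveOf T 𝔐 (fun m => thin (η.1 m) (u.1 m)) u.2 (Sum.inl m) t),
    fun p j => η.2 p j + 𝔐.link (Sum.inr p)
      (driveOf T 𝔐 (fun m => thin (η.1 m) (u.1 m)) u.2 (Sum.inr p) (T.time p j)))

/-- The Picard iterates of the HAR equations, started at zero. -/
noncomputable def iter (T : TimeGrid P) (𝔐 : Params M P) (η : NoiseSpace M P) (n : ℕ) :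
    Traj M P :=
  (step T 𝔐 η)^[n] (0, 0)

theorem iter_succ (T : TimeGrid P) (𝔐 : Params M P) (η : NoiseSpace M P) (n : ℕ) :
    iter T 𝔐 η (n + 1) = step T 𝔐 η (iter T 𝔐 η n) :=
  Function.iterate_succ_apply' _ _ _

/-- The pointwise limit of the Picard iterates. -/
noncomputable def iterLim (T : TimeGrid P) (𝔐 : Params M P) (η : NoiseSpace M P) : Traj M P :=
  (fun m t => Filter.limUnder Filter.atTop fun n => (iter T 𝔐 η n).1 m t,
    fun p j => Filter.limUnder Filter.atTop fun n => (iter T 𝔐 η n).2 p j)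

/-! ### Measurability of the iterates -/

theorem Params.measurable_mask (𝔐 : Params M P) (α : Fin M ⊕ Fin P) (p : Fin P) :
    Measurable (𝔐.mask α p) :=
  (𝔐.mask_lipschitz α p).choose_spec.continuous.measurable

theorem Params.measurable_link (𝔐 : Params M P) (α : Fin M ⊕ Fin P) : Measurable (𝔐.link α) :=
  (𝔐.link_lipschitz α).choose_spec.continuous.measurable

variable {Ω : Type*}

/-- The noise `η` is adapted to the family of σ-algebras `F`. -/
structure AdaptedNoise (T : TimeGrid P) (F : ℝ → MeasurableSpace Ω)
    (η : Ω → NoiseSpace M P) : Prop where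
  mono : Monotone F
  boxFinite : ∀ m ω, BoxFinite ((η ω).1 m)
  measurable_restrict : ∀ m t, Measurable[F t] fun ω => ((η ω).1 m).restrict {z | z.1 ≤ t}
  measurable_drift : ∀ p j, Measurable[F (T.time p j)] fun ω => (η ω).2 p j

/-- The random trajectory `u` has predictable intensities and adapted chains. -/
structure AdaptedTraj (T : TimeGrid P) (F : ℝ → MeasurableSpace Ω) (u : Ω → Traj M P) : Prop where
  lam : ∀ m, Measurable[predictable F] fun z : ℝ × Ω => (u z.2).1 m z.1
  W : ∀ p j, Measurable[F (T.time p j)] fun ω => (u ω).2 p j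

variable {T : TimeGrid P} {F : ℝ → MeasurableSpace Ω} {η : Ω → NoiseSpace M P} {u : Ω → Traj M P}

theorem AdaptedTraj.measurable_drive (𝔐 : Params M P) (hη : AdaptedNoise T F η)
    (hu : AdaptedTraj T F u) (α : Fin M ⊕ Fin P) :
    Measurable[predictable F] fun z : ℝ × Ω =>
      driveOf T 𝔐 (fun m => thin ((η z.2).1 m) ((u z.2).1 m)) (u z.2).2 α z.1 := by
  have h1 : ∀ m, Measurable[predictable F] fun z : ℝ × Ω =>
      ∫ s in Iio z.1, 𝔐.h α (Sum.inl m) (z.1 - s) ∂thin ((η z.2).1 m) ((u z.2).1 m) := fun m =>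
    measurable_predictable_integral_thin (hη.measurable_restrict m) (hη.boxFinite m) (hu.lam m)
      (𝔐.h_measurable α (Sum.inl m))
  have h2 : ∀ p, Measurable[predictable F] fun z : ℝ × Ω =>
      ∑' j : {j : ℤ // T.time p j < z.1},
        𝔐.h α (Sum.inr p) (z.1 - T.time p j) * 𝔐.mask α p ((u z.2).2 p j) := by
    intro p
    -- The index set varies with time; an indicator turns the series into one over a fixed countable
    -- set.
    have e : ∀ z : ℝ × Ω, ∑' j : {j : ℤ // T.time p j < z.1},
        𝔐.h α (Sum.inr p) (z.1 - T.time p j) * 𝔐.mask α p ((u z.2).2 p j) =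
        ∑' j : ℤ, 𝔐.h α (Sum.inr p) (z.1 - T.time p j) *
          (if T.time p j < z.1 then 𝔐.mask α p ((u z.2).2 p j) else 0) := by
      intro z
      refine (tsum_subtype {j : ℤ | T.time p j < z.1} fun j =>
        𝔐.h α (Sum.inr p) (z.1 - T.time p j) * 𝔐.mask α p ((u z.2).2 p j)).trans ?_
      congr 1 with j
      by_cases h : T.time p j < z.1 <;> simp [indicator, h]
    simp_rw [e]
    have h3 : ∀ j, Measurable[predictable F] fun z : ℝ × Ω =>
        if T.time p j < z.1 then 𝔐.mask α p ((u z.2).2 p j) else 0 := fun j =>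
      measurable_predictable_ite _ ((𝔐.measurable_mask α p).comp (hu.W p j)) 0
    have h4 := measurable_predictable_fst (F := F)
    let _ := predictable F
    refine (StronglyMeasurable.tsum fun j => (Measurable.mul ?_ (h3 j)).stronglyMeasurable).measurable
    exact (𝔐.h_measurable α (Sum.inr p)).comp (h4.sub_const _)
  let _ := predictable F
  exact (Finset.measurable_sum _ fun m _ => h1 m).add (Finset.measurable_sum _ fun p _ => h2 p)

theorem AdaptedTraj.step (𝔐 : Params M P) (hη : AdaptedNoise T F η) (hu : AdaptedTraj T F u) :
    AdaptedTraj T F fun ω => step T 𝔐 (η ω) (u ω) where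
  lam m := (𝔐.measurable_link _).comp ((hu.measurable_drive 𝔐 hη (Sum.inl m)).const_add _)
  W p j := by
    have h1 := (hu.measurable_drive 𝔐 hη (Sum.inr p)).comp
      (measurable_prodMk_predictable hη.mono (T.time p j))
    exact (hη.measurable_drift p j).add ((𝔐.measurable_link _).comp h1)

theorem AdaptedNoise.iter (𝔐 : Params M P) (hη : AdaptedNoise T F η) (n : ℕ) :
    AdaptedTraj T F fun ω => iter T 𝔐 (η ω) n := by
  induction n with
  | zero => exact ⟨fun m => measurable_const, fun p j => measurable_const⟩
  | succ n ih =>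
    simp_rw [iter_succ]
    exact ih.step 𝔐 hη

/-- A `limUnder` of measurable functions is measurable even where the sequence diverges. No null set
has to be removed, so the limit remains a function of the noise defined everywhere. -/
theorem AdaptedNoise.iterLim (𝔐 : Params M P) (hη : AdaptedNoise T F η) :
    AdaptedTraj T F fun ω => iterLim T 𝔐 (η ω) where
  lam m := by
    have h := fun n => (hη.iter 𝔐 n).lam m
    let _ := predictable F
    exact (StronglyMeasurable.limUnder fun n => (h n).stronglyMeasurable).measurable
  W p j := by
    have h := fun n => (hη.iter 𝔐 n).W p j
    let _ := F (T.time p j)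
    exact (StronglyMeasurable.limUnder fun n => (h n).stronglyMeasurable).measurable

/-! ### Equivariance under the time shift -/

/-- The noise seen from time `1`. -/
noncomputable def shiftNoise (T : TimeGrid P) (η : NoiseSpace M P) : NoiseSpace M P :=
  (fun m => (η.1 m).map fun z => (z.1 - 1, z.2), fun p j => η.2 p (j + (T.freq p : ℤ)))

/-- The trajectory seen from time `1`. -/
def shiftTraj (T : TimeGrid P) (u : Traj M P) : Traj M P :=
  (fun m t => u.1 m (t + 1), fun p j => u.2 p (j + (T.freq p : ℤ)))

theorem TimeGrid.time_add_freq (T : TimeGrid P) (p : Fin P) (j : ℤ) :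
    T.time p (j + (T.freq p : ℤ)) = T.time p j + 1 := by
  have : (T.freq p : ℝ) ≠ 0 := by exact_mod_cast (T.freq_pos p).ne'
  simp only [TimeGrid.time]
  push_cast
  field_simp
  ring

/-- The time shift by one on the plane. -/
def shiftPlane : ℝ × ℝ ≃ᵐ ℝ × ℝ :=
  (MeasurableEquiv.subRight (1 : ℝ)).prodCongr (MeasurableEquiv.refl ℝ)

theorem shiftPlane_apply (z : ℝ × ℝ) : shiftPlane z = (z.1 - 1, z.2) := rfl

theorem thin_shift (ρ : Measure (ℝ × ℝ)) (l : ℝ → ℝ) :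
    thin (ρ.map fun z => (z.1 - 1, z.2)) (fun t => l (t + 1)) = (thin ρ l).map fun s => s - 1 := by
  change ((ρ.map shiftPlane).restrict _).map Prod.fst = _
  rw [MeasurableEquiv.restrict_map, Measure.map_map measurable_fst shiftPlane.measurable, thin,
    Measure.map_map (by fun_prop) measurable_fst]
  have : shiftPlane ⁻¹' {z | z.2 ≤ l (z.1 + 1)} = {z | z.2 ≤ l z.1} := by
    ext z
    simp [shiftPlane_apply]
  rw [this]
  rfl

theorem driveOf_shift (T : TimeGrid P) (𝔐 : Params M P) (ρ : Fin M → Measure ℝ)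
    (w : Fin P → ℤ → ℝ) (α : Fin M ⊕ Fin P) (t : ℝ) :
    driveOf T 𝔐 (fun m => (ρ m).map fun s => s - 1) (fun p j => w p (j + (T.freq p : ℤ))) α t =
      driveOf T 𝔐 ρ w α (t + 1) := by
  unfold driveOf
  congr 1
  · refine Finset.sum_congr rfl fun m _ => ?_
    refine (setIntegral_map_equiv (MeasurableEquiv.subRight (1 : ℝ)) _ _).trans ?_
    have : (MeasurableEquiv.subRight (1 : ℝ)) ⁻¹' Iio t = Iio (t + 1) := by
      ext s
      change s - 1 < t ↔ s < t + 1
      exact sub_lt_iff_lt_add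
    rw [this]
    congr 1 with s
    congr 1
    exact (sub_sub_eq_add_sub t s 1)
  · refine Finset.sum_congr rfl fun p _ => ?_
    let e : {j : ℤ // T.time p j < t} ≃ {j : ℤ // T.time p j < t + 1} :=
      (Equiv.addRight (T.freq p : ℤ)).subtypeEquiv fun j => by
        simp [T.time_add_freq]
    rw [← e.tsum_eq]
    congr 1 with j
    have : T.time p (e j) = T.time p j + 1 := T.time_add_freq p j
    rw [this]
    congr 2
    ring

/-- The parameters do not depend on time, the equations involve only time differences, and moving
`n_p` indices along the grid of chain `p` is moving by time one. -/
theorem step_shift (T : TimeGrid P) (𝔐 : Params M P) (η : NoiseSpace M P) (u : Traj M P) :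
    step T 𝔐 (shiftNoise T η) (shiftTraj T u) = shiftTraj T (step T 𝔐 η u) := by
  have h : ∀ α t, driveOf T 𝔐 (fun m => thin ((shiftNoise T η).1 m) ((shiftTraj T u).1 m))
      (shiftTraj T u).2 α t = driveOf T 𝔐 (fun m => thin (η.1 m) (u.1 m)) u.2 α (t + 1) := by
    intro α t
    rw [← driveOf_shift]
    congr 1
    ext1 m
    exact thin_shift _ _
  unfold step
  simp_rw [h, ← T.time_add_freq]
  rfl

theorem iter_shift (T : TimeGrid P) (𝔐 : Params M P) (η : NoiseSpace M P) (n : ℕ) :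
    iter T 𝔐 (shiftNoise T η) n = shiftTraj T (iter T 𝔐 η n) := by
  induction n with
  | zero => rfl
  | succ n ih => rw [iter_succ, iter_succ, ih, step_shift]

/-- Both sides are `limUnder` of the same sequences, so the identity holds for every noise,
convergent or not. -/
theorem iterLim_shift (T : TimeGrid P) (𝔐 : Params M P) (η : NoiseSpace M P) :
    iterLim T 𝔐 (shiftNoise T η) = shiftTraj T (iterLim T 𝔐 η) := by
  unfold iterLim
  simp_rw [iter_shift]
  rfl

end HARMap

/-! ### Atoms of finite families of sets -/

section Atoms

variable {ι α : Type*}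

/-- The points that belong to `C i` exactly for the indices `i ∈ J`. -/
def atom (C : ι → Set α) (J : Finset ι) : Set α := {x | ∀ i, x ∈ C i ↔ i ∈ J}

theorem disjoint_atom (C : ι → Set α) : Pairwise fun J K => Disjoint (atom C J) (atom C K) := by
  intro J K hJK
  refine disjoint_left.2 fun x hJ hK => hJK ?_
  ext i
  rw [← hJ i, hK i]

theorem measurableSet_atom [MeasurableSpace α] [Countable ι] {C : ι → Set α}
    (hC : ∀ i, MeasurableSet (C i)) (J : Finset ι) : MeasurableSet (atom C J) := by
  have : atom C J = ⋂ i, {x | x ∈ C i ↔ i ∈ J} := by ext; simp [atom]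
  rw [this]
  refine MeasurableSet.iInter fun i => ?_
  by_cases h : i ∈ J
  · simpa [h] using hC i
  · simp only [h, iff_false]
    exact (hC i).compl

/-- This expresses counts in overlapping sets through counts in disjoint ones, for which the Poisson
property provides independence. -/
theorem measure_eq_sum_atom [MeasurableSpace α] [Fintype ι] [DecidableEq ι] {C : ι → Set α}
    (hC : ∀ i, MeasurableSet (C i)) (ρ : Measure α) (i : ι) :
    ρ (C i) = ∑ J : Finset ι, if i ∈ J then ρ (atom C J) else 0 := by
  classical
  have h : C i = ⋃ J ∈ Finset.univ.filter fun J : Finset ι => i ∈ J, atom C J := by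
    ext x
    simp only [mem_iUnion, Finset.mem_filter, Finset.mem_univ, true_and, exists_prop]
    constructor
    · intro hx
      exact ⟨Finset.univ.filter fun k => x ∈ C k, by simpa, fun k => by simp⟩
    · rintro ⟨J, hJ, hx⟩
      exact (hx i).2 hJ
  conv_lhs => rw [h]
  rw [measure_biUnion_finset (fun J _ K _ hJK => disjoint_atom C hJK)
    fun J _ => measurableSet_atom hC J, Finset.sum_filter]

end Atoms

/-! ### Consequences of the definition of Poisson random measures -/

theorem cnt_inter {α : Type*} [MeasurableSpace α] (A : Set α) {D : Set α} (hD : MeasurableSet D) :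
    cnt (A ∩ D) = (cnt A).restrict D := by
  rw [cnt, cnt, Measure.restrict_restrict hD, inter_comm]

theorem measurable_restrict_measure {α : Type*} [MeasurableSpace α] {D : Set α}
    (hD : MeasurableSet D) : Measurable fun ρ : Measure α => ρ.restrict D := by
  refine Measure.measurable_of_measurable_coe _ fun C hC => ?_
  simp_rw [Measure.restrict_apply hC]
  exact Measure.measurable_coe (hC.inter hD)

theorem lintegral_cast_poissonMeasure (r : ℝ≥0) :
    ∫⁻ n : ℕ, (n : ℝ≥0∞) ∂poissonMeasure r = r := by
  rw [poissonMeasure, lintegral_sum_measure]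
  simp_rw [lintegral_smul_measure, lintegral_dirac, smul_eq_mul]
  -- The term `n = 0` vanishes; in the others the factor `n + 1` cancels in the factorial and leaves
  -- `r` times the Poisson weight of `n`.
  rw [tsum_eq_zero_add' ENNReal.summable]
  have h : ∀ n : ℕ, ENNReal.ofReal (Real.exp (-r) * r ^ (n + 1) / (n + 1).factorial) *
      ((n + 1 : ℕ) : ℝ≥0∞) = r * ENNReal.ofReal (Real.exp (-r) * r ^ n / n.factorial) := by
    intro n
    rw [← ENNReal.ofReal_natCast, ← ENNReal.ofReal_mul (by positivity), ← ENNReal.ofReal_coe_nnreal,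
      ← ENNReal.ofReal_mul (by positivity), Nat.factorial_succ]
    congr 1
    push_cast
    field_simp
    ring
  simp_rw [h]
  rw [ENNReal.tsum_mul_left, ← ENNReal.ofReal_tsum_of_nonneg (fun n => by positivity)
    (hasSum_one_poissonMeasure r).summable, (hasSum_one_poissonMeasure r).tsum_eq]
  simp

namespace IsPoissonRandomMeasure

variable {α Ω : Type*} [TopologicalSpace α] [MeasurableSpace α] [MeasurableSpace Ω]
  {N : Ω → Set α} {ν : Measure α} {μ : Measure Ω}

theorem lintegral_cnt (hN : IsPoissonRandomMeasure N ν μ) {B : Set α} (hB : MeasurableSet B)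
    (hν : ν B ≠ ∞) : ∫⁻ ω, cnt (N ω) B ∂μ = ν B := by
  rw [(hN.law B hB hν).lintegral_comp (f := fun x => x) aemeasurable_id',
    lintegral_map measurable_id' (measurable_of_countable _), lintegral_cast_poissonMeasure,
    ENNReal.coe_toNNReal hν]

theorem measurable_cnt (hN : IsPoissonRandomMeasure N ν μ) {B : Set α} (hB : MeasurableSet B) :
    Measurable fun ω => cnt (N ω) B :=
  (Measure.measurable_coe hB).comp hN.measurable

theorem iIndepFun_of_fintype (hN : IsPoissonRandomMeasure N ν μ) {ι : Type*} [Fintype ι]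
    (B : ι → Set α) (hB : ∀ i, MeasurableSet (B i)) (hd : Pairwise fun i j => Disjoint (B i) (B j)) :
    iIndepFun (fun i ω => cnt (N ω) (B i)) μ := by
  let e := Fintype.equivFin ι
  have h := hN.indep (Fintype.card ι) (B ∘ e.symm) (fun i => hB _)
    fun i j hij => hd (e.symm.injective.ne hij)
  have h2 := h.precomp e.injective
  simpa using h2

/-- The definition gives independence only for finitely many disjoint sets. The σ-algebra of the
configuration on `D` is contained in a directed supremum of σ-algebras generated by finitely many
counts, and such counts are sums of counts over atoms inside `D`, which are disjoint from each other
and from `B`. -/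
theorem indep_restrict (hN : IsPoissonRandomMeasure N ν μ) [IsProbabilityMeasure μ] {B D : Set α}
    (hB : MeasurableSet B) (hD : MeasurableSet D) (hBD : Disjoint B D) :
    Indep (MeasurableSpace.comap (fun ω => cnt (N ω) B) inferInstance)
      (MeasurableSpace.comap (fun ω => cnt (N ω ∩ D)) inferInstance) μ := by
  classical
  refine Indep.symm ?_
  -- The directed family: counts in `C ∩ D` for `C` in a finite collection `I`.
  let m : Finset {C : Set α // MeasurableSet C} → MeasurableSpace Ω := fun I =>
    ⨆ C : I, MeasurableSpace.comap (fun ω => cnt (N ω) (C.1.1 ∩ D)) inferInstance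
  have hmeas : ∀ C, MeasurableSet C → Measurable fun ω => cnt (N ω) (C ∩ D) := fun C hC =>
    hN.measurable_cnt (hC.inter hD)
  have hle : MeasurableSpace.comap (fun ω => cnt (N ω ∩ D)) inferInstance ≤ ⨆ I, m I := by
    rw [← measurable_iff_comap_le]
    refine @Measure.measurable_of_measurable_coe _ _ _ (⨆ I, m I) _ fun C hC => ?_
    simp_rw [cnt_inter _ hD, Measure.restrict_apply hC]
    rw [measurable_iff_comap_le]
    refine le_trans ?_ (le_iSup m {⟨C, hC⟩})
    exact le_iSup (fun C' : ({⟨C, hC⟩} : Finset {C : Set α // MeasurableSet C}) =>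
      MeasurableSpace.comap (fun ω => cnt (N ω) (C'.1.1 ∩ D)) inferInstance)
      ⟨⟨C, hC⟩, Finset.mem_singleton_self _⟩
  refine indep_of_indep_of_le_left ?_ hle
  refine indep_iSup_of_directed_le (fun I => ?_)
    (fun I => iSup_le fun C => (hmeas _ C.1.2).comap_le) (hN.measurable_cnt hB).comap_le ?_
  · let C : I → Set α := fun C => C.1.1
    have hC : ∀ i, MeasurableSet (C i) := fun i => i.1.2
    -- One disjoint family containing `B` (index `none`) and all atoms cut with `D`.
    let A : Option (Finset I) → Set α := fun o => o.elim B fun J => atom C J ∩ D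
    have hA : ∀ o, MeasurableSet (A o) := by
      rintro (_ | J)
      · exact hB
      · exact (measurableSet_atom hC J).inter hD
    have hAd : Pairwise fun i j => Disjoint (A i) (A j) := by
      rintro (_ | J) (_ | K) hJK
      · exact absurd rfl hJK
      · exact hBD.mono_right inter_subset_right
      · exact (hBD.mono_right inter_subset_right).symm
      · exact (disjoint_atom C fun h => hJK (by rw [h])).mono inter_subset_left inter_subset_left
    have hind := hN.iIndepFun_of_fintype A hA hAd
    have hdisj : Disjoint (range (some : Finset I → Option (Finset I))) {none} := by
      simp
    have h := indep_iSup_of_disjoint (fun o => (hN.measurable_cnt (hA o)).comap_le) hind hdisj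
    refine indep_of_indep_of_le_left (indep_of_indep_of_le_right h ?_) ?_
    · exact le_iSup₂_of_le none rfl le_rfl
    · refine iSup_le fun i => ?_
      rw [← measurable_iff_comap_le]
      have e : ∀ ω, cnt (N ω) (i.1.1 ∩ D) =
          ∑ J : Finset I, if i ∈ J then cnt (N ω) (A (some J)) else 0 := by
        intro ω
        have := measure_eq_sum_atom hC ((cnt (N ω)).restrict D) i
        rw [Measure.restrict_apply (hC i)] at this
        refine this.trans (Finset.sum_congr rfl fun J _ => ?_)
        rw [Measure.restrict_apply (measurableSet_atom hC J)]
        rfl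
      simp_rw [e]
      refine Finset.measurable_sum _ fun J _ => ?_
      split_ifs
      · rw [measurable_iff_comap_le]
        exact le_iSup₂_of_le (some J) ⟨J, rfl⟩ le_rfl
      · exact measurable_const
  · intro I J
    refine ⟨I ∪ J, iSup_le fun C => ?_, iSup_le fun C => ?_⟩
    · exact le_iSup (fun C' : (I ∪ J : Finset _) =>
        MeasurableSpace.comap (fun ω => cnt (N ω) (C'.1.1 ∩ D)) inferInstance)
        ⟨C.1, Finset.mem_union_left _ C.2⟩
    · exact le_iSup (fun C' : (I ∪ J : Finset _) =>
        MeasurableSpace.comap (fun ω => cnt (N ω) (C'.1.1 ∩ D)) inferInstance)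
        ⟨C.1, Finset.mem_union_right _ C.2⟩

end IsPoissonRandomMeasure

/-- The sets `A ∩ B` with `A` in `m₁` and `B` in `m₂` form a π-system generating `m₁ ⊔ m₂`, and on
it `ℙ(C ∩ A ∩ B) = ℙ(C ∩ A) ℙ(B) = ℙ(C) ℙ(A) ℙ(B)`. -/
theorem indep_sup_right_of_indep {Ω : Type*} {m₀ m₁ m₂ m m' : MeasurableSpace Ω}
    [mΩ : MeasurableSpace Ω] {μ : Measure Ω} [IsProbabilityMeasure μ] (hm' : m' ≤ mΩ)
    (h₀ : m₀ ≤ m) (h₁ : m₁ ≤ m) (hm : m ≤ mΩ) (h₂ : m₂ ≤ m') (h01 : Indep m₀ m₁ μ)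
    (h2 : Indep m m' μ) : Indep m₀ (m₁ ⊔ m₂) μ := by
  let p : Set (Set Ω) := {s | ∃ A B, MeasurableSet[m₁] A ∧ MeasurableSet[m₂] B ∧ A ∩ B = s}
  have hp : IsPiSystem p := by
    rintro _ ⟨A, B, hA, hB, rfl⟩ _ ⟨A', B', hA', hB', rfl⟩ -
    exact ⟨A ∩ A', B ∩ B', @MeasurableSet.inter _ m₁ _ _ hA hA', @MeasurableSet.inter _ m₂ _ _ hB hB',
      inter_inter_inter_comm _ _ _ _⟩
  have hgen : m₁ ⊔ m₂ = MeasurableSpace.generateFrom p := by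
    refine le_antisymm (sup_le (fun A hA => ?_) fun B hB => ?_) (MeasurableSpace.generateFrom_le ?_)
    · exact MeasurableSpace.measurableSet_generateFrom
        ⟨A, univ, hA, @MeasurableSet.univ _ m₂, inter_univ A⟩
    · exact MeasurableSpace.measurableSet_generateFrom
        ⟨univ, B, @MeasurableSet.univ _ m₁, hB, univ_inter B⟩
    · rintro _ ⟨A, B, hA, hB, rfl⟩
      exact @MeasurableSet.inter _ (m₁ ⊔ m₂) _ _ (le_sup_left (b := m₂) A hA)
        (le_sup_right (a := m₁) B hB)
  refine IndepSets.indep (h₀.trans hm) (sup_le (h₁.trans hm) (h₂.trans hm'))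
    (@MeasurableSpace.isPiSystem_measurableSet Ω m₀) hp
    (@MeasurableSpace.generateFrom_measurableSet Ω m₀).symm hgen ?_
  rw [IndepSets_iff]
  rw [Indep_iff] at h01 h2
  rintro C _ hC ⟨A, B, hA, hB, rfl⟩
  rw [← inter_assoc, h2 _ _ (@MeasurableSet.inter _ m _ _ (h₀ _ hC) (h₁ _ hA)) (h₂ _ hB),
    h2 _ _ (h₁ _ hA) (h₂ _ hB), h01 _ _ hC hA, mul_assoc]

/-! ### The filtration of the noise -/

section Filtration

variable {M P : ℕ} {T : TimeGrid P} {Ω : Type*} {N : Fin M → Ω → Set (ℝ × ℝ)}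
  {ξ : Fin P → ℤ → Ω → ℝ}

theorem measurableSet_past (t : ℝ) : MeasurableSet {z : ℝ × ℝ | z.1 ≤ t} :=
  measurableSet_le measurable_fst measurable_const

theorem comap_past_le (N : Fin M → Ω → Set (ℝ × ℝ)) (m : Fin M) (t : ℝ) :
    MeasurableSpace.comap (fun ω => cnt (N m ω ∩ {z | z.1 ≤ t})) inferInstance ≤
      MeasurableSpace.comap (fun ω => cnt (N m ω)) inferInstance := by
  simp_rw [cnt_inter _ (measurableSet_past t)]
  rw [← measurable_iff_comap_le]
  exact (measurable_restrict_measure (measurableSet_past t)).comp (comap_measurable _)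

theorem filt_mono : Monotone (filt T N ξ) := by
  intro s t hst
  refine sup_le_sup (iSup_mono fun m => ?_) (iSup_mono fun p => iSup_mono fun j =>
    iSup_mono' fun hj => ⟨hj.trans hst, le_rfl⟩)
  rw [← measurable_iff_comap_le]
  have : ∀ ω, cnt (N m ω ∩ {z | z.1 ≤ s}) =
      (cnt (N m ω ∩ {z | z.1 ≤ t})).restrict {z | z.1 ≤ s} := by
    intro ω
    rw [← cnt_inter _ (measurableSet_past s), inter_assoc]
    congr 2
    ext z
    exact ⟨fun hz => ⟨le_trans hz hst, hz⟩, fun hz => hz.2⟩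
  simp_rw [this]
  exact (measurable_restrict_measure (measurableSet_past s)).comp (comap_measurable _)

end Filtration

namespace IsDrivingNoise

variable {M P : ℕ} {T : TimeGrid P} {Ω : Type*} [mΩ : MeasurableSpace Ω] {μ : Measure Ω}
  {N : Fin M → Ω → Set (ℝ × ℝ)} {ξ : Fin P → ℤ → Ω → ℝ}

theorem family_le (h : IsDrivingNoise T N ξ μ) (i : Fin M ⊕ Fin P × ℤ) :
    (Sum.elim
    (fun m : Fin M => MeasurableSpace.comap (fun ω => cnt (N m ω)) inferInstance)
    (fun q : Fin P × ℤ => MeasurableSpace.comap (ξ q.1 q.2) inferInstance)) i ≤ mΩ := by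
  rcases i with m | q
  · exact (h.poisson m).measurable.comap_le
  · exact (h.drift_measurable q.1 q.2).comap_le

theorem filt_le (h : IsDrivingNoise T N ξ μ) (t : ℝ) : filt T N ξ t ≤ mΩ :=
  sup_le (iSup_le fun m => (comap_past_le N m t).trans (h.family_le (Sum.inl m)))
    (iSup_le fun p => iSup_le fun j => iSup_le fun _ => h.family_le (Sum.inr (p, j)))

/-- The past of `N m` is independent of its atoms in `B` because the regions are disjoint; all other
sources of noise are independent of `N m` altogether, and `indep_sup_right_of_indep` joins the two
facts. -/
theorem indep_filt [IsProbabilityMeasure μ] (h : IsDrivingNoise T N ξ μ) (m : Fin M) (t : ℝ)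
    {B : Set (ℝ × ℝ)} (hB : MeasurableSet B) (hBt : ∀ z ∈ B, t < z.1) :
    Indep (MeasurableSpace.comap (fun ω => cnt (N m ω) B) inferInstance) (filt T N ξ t) μ := by
  have hd : Disjoint B {z | z.1 ≤ t} :=
    disjoint_left.2 fun z hz hz' => (hBt z hz).not_ge hz'
  have h01 := (h.poisson m).indep_restrict hB (measurableSet_past t) hd
  have h2 := indep_iSup_of_disjoint h.family_le h.indep
    (disjoint_compl_right (a := {(Sum.inl m : Fin M ⊕ Fin P × ℤ)}))
  have hle : ∀ i : Fin M ⊕ Fin P × ℤ, i ≠ Sum.inl m → _ ≤ _ := fun i hi =>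
    le_iSup₂_of_le (f := fun i (_ : i ∈ ({(Sum.inl m : Fin M ⊕ Fin P × ℤ)}ᶜ : Set _)) => Sum.elim
      (fun m : Fin M => MeasurableSpace.comap (fun ω => cnt (N m ω)) inferInstance)
      (fun q : Fin P × ℤ => MeasurableSpace.comap (ξ q.1 q.2) inferInstance) i) i hi le_rfl
  refine indep_of_indep_of_le_right
    (indep_sup_right_of_indep (iSup₂_le fun i _ => h.family_le i) ?_ ?_
      (iSup₂_le fun i _ => h.family_le i) le_rfl h01 h2) ?_
  · refine le_trans ?_ (le_iSup₂_of_le (Sum.inl m) rfl le_rfl)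
    rw [← measurable_iff_comap_le]
    exact (Measure.measurable_coe hB).comp (comap_measurable _)
  · exact (comap_past_le N m t).trans (le_iSup₂_of_le (Sum.inl m) rfl le_rfl)
  · refine sup_le (iSup_le fun m' => ?_) (iSup_le fun p => iSup_le fun j => iSup_le fun _ => ?_)
    · by_cases hm : m' = m
      · rw [hm]; exact le_sup_left
      · exact ((comap_past_le N m' t).trans (hle (Sum.inl m') (by simpa using hm))).trans le_sup_right
    · exact le_trans (hle (Sum.inr (p, j)) (by simp)) le_sup_right

end IsDrivingNoise

/-! ### The Campbell formula -/

/-- The integrands are measurable for `mZ`, so it suffices that the two pushforwards agree on a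
π-system generating it, with finite mass on a countable cover. -/
theorem lintegral_comp_eq_of_piSystem {X Z : Type*} [MeasurableSpace X] [mZ : MeasurableSpace Z]
    {ρ₁ ρ₂ : Measure X} {φ : X → Z} (hφ : Measurable φ) {C : Set (Set Z)}
    (hgen : mZ = MeasurableSpace.generateFrom C) (hC : IsPiSystem C) (B : ℕ → Set Z)
    (hB : ⋃ n, B n = univ) (hBC : ∀ n, B n ∈ C) (hfin : ∀ n, ρ₁ (φ ⁻¹' B n) ≠ ∞)
    (heq : ∀ s ∈ C, ρ₁ (φ ⁻¹' s) = ρ₂ (φ ⁻¹' s)) {f : Z → ℝ≥0∞} (hf : Measurable f) :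
    ∫⁻ x, f (φ x) ∂ρ₁ = ∫⁻ x, f (φ x) ∂ρ₂ := by
  have hm : ∀ s ∈ C, MeasurableSet s := fun s hs => by
    rw [hgen]; exact MeasurableSpace.measurableSet_generateFrom hs
  rw [← lintegral_map hf hφ, ← lintegral_map hf hφ]
  congr 1
  refine Measure.ext_of_generateFrom_of_iUnion C B hgen hC hB hBC (fun n => ?_) fun s hs => ?_
  · rw [Measure.map_apply hφ (hm _ (hBC n))]; exact hfin n
  · rw [Measure.map_apply hφ (hm _ hs), Measure.map_apply hφ (hm _ hs)]; exact heq s hs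

/-- The intersected interval starts at the larger left endpoint, where both events are known. -/
theorem isPiSystem_predictable {Ω : Type*} {F : ℝ → MeasurableSpace Ω} (hF : Monotone F) :
    IsPiSystem {B | ∃ s t : ℝ, s < t ∧ ∃ A : Set Ω, MeasurableSet[F s] A ∧ B = Ioc s t ×ˢ A} := by
  rintro _ ⟨s, t, -, A, hA, rfl⟩ _ ⟨s', t', -, A', hA', rfl⟩ hne
  rw [prod_inter_prod, Ioc_inter_Ioc] at hne ⊢
  refine ⟨_, _, ?_, A ∩ A', @MeasurableSet.inter _ (F _) _ _ (hF le_sup_left _ hA)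
    (hF le_sup_right _ hA'), rfl⟩
  exact nonempty_Ioc.1 hne.fst

theorem iUnion_Ioc_neg_natCast : ⋃ n : ℕ, Ioc (-((n : ℝ) + 1)) (n + 1) = univ := by
  refine eq_univ_of_forall fun x => mem_iUnion.2 ?_
  obtain ⟨n, hn⟩ := exists_nat_ge |x|
  have := abs_le.1 hn
  exact ⟨n, by linarith, by linarith⟩

theorem Ioc_neg_natCast_mono : Monotone fun n : ℕ => Ioc (-((n : ℝ) + 1)) (n + 1) := by
  intro m n hmn
  have : (m : ℝ) ≤ n := by exact_mod_cast hmn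
  exact Ioc_subset_Ioc (by linarith) (by linarith)

namespace IsDrivingNoise

variable {M P : ℕ} {T : TimeGrid P} {Ω : Type*} [mΩ : MeasurableSpace Ω] {μ : Measure Ω}
  {N : Fin M → Ω → Set (ℝ × ℝ)} {ξ : Fin P → ℤ → Ω → ℝ}

theorem boxFinite (h : IsDrivingNoise T N ξ μ) (m : Fin M) (ω : Ω) : BoxFinite (cnt (N m ω)) := by
  intro n
  have := (h.poisson m).locallyFinite ω (box n) (isCompact_box n)
  rw [cnt, Measure.restrict_apply (measurableSet_box n), inter_comm]
  exact (Measure.count_apply_lt_top.2 this).ne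

theorem adaptedNoise (h : IsDrivingNoise T N ξ μ) :
    AdaptedNoise T (filt T N ξ) fun ω => (fun m => cnt (N m ω), fun p j => ξ p j ω) where
  mono := filt_mono
  boxFinite := h.boxFinite
  measurable_restrict m t := by
    simp_rw [← cnt_inter _ (measurableSet_past t)]
    rw [measurable_iff_comap_le]
    exact le_trans (le_iSup (fun m => MeasurableSpace.comap
      (fun ω => cnt (N m ω ∩ {z | z.1 ≤ t})) inferInstance) m) le_sup_left
  measurable_drift p j := by
    rw [measurable_iff_comap_le]
    exact le_trans (le_iSup_of_le p (le_iSup_of_le j (le_iSup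
      (fun _ : T.time p j ≤ T.time p j => MeasurableSpace.comap (ξ p j) inferInstance) le_rfl))) le_sup_right

/-- For the generator `(a, b] × A × (c, d]` with `A ∈ F_a`, the event `A` is independent of the
number of atoms in `(a, b] × (c, d]`, whose mean is the intensity of that box. Both sides therefore
agree on a π-system generating the σ-algebra of predictable integrands with a mark. -/
theorem lintegral_predictable [IsProbabilityMeasure μ] (h : IsDrivingNoise T N ξ μ) (m : Fin M)
    {f : (ℝ × Ω) × ℝ → ℝ≥0∞}
    (hf : Measurable[(predictable (filt T N ξ)).prod inferInstance] f) :
    ∫⁻ ω, ∫⁻ z, f ((z.1, ω), z.2) ∂cnt (N m ω) ∂μ =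
      ∫⁻ ω, ∫⁻ z in {z : ℝ × ℝ | 0 ≤ z.2}, f ((z.1, ω), z.2) ∂volume ∂μ := by
  let κ : Kernel Ω (ℝ × ℝ) := ⟨fun ω => cnt (N m ω), (h.poisson m).measurable⟩
  have : IsSFiniteKernel κ := isSFiniteKernel_of_boxFinite κ (h.boxFinite m)
  let ν : Measure (ℝ × ℝ) := volume.restrict {z : ℝ × ℝ | 0 ≤ z.2}
  let φ : Ω × (ℝ × ℝ) → (ℝ × Ω) × ℝ := fun x => ((x.2.1, x.1), x.2.2)
  have hφ : Measurable φ := by fun_prop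
  have hle := predictable_le h.filt_le
  have hle' : (predictable (filt T N ξ)).prod (inferInstance : MeasurableSpace ℝ) ≤
      (inferInstance : MeasurableSpace ((ℝ × Ω) × ℝ)) := sup_le_sup (MeasurableSpace.comap_mono hle)
        le_rfl
  have hf' : Measurable f := hf.mono hle' le_rfl
  have e1 : ∫⁻ ω, ∫⁻ z, f ((z.1, ω), z.2) ∂cnt (N m ω) ∂μ = ∫⁻ x, f (φ x) ∂(μ ⊗ₘ κ) :=
    (Measure.lintegral_compProd (μ := μ) (κ := κ) (hf'.comp hφ)).symm
  have e2 : ∫⁻ ω, ∫⁻ z in {z : ℝ × ℝ | 0 ≤ z.2}, f ((z.1, ω), z.2) ∂volume ∂μ =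
      ∫⁻ x, f (φ x) ∂(μ.prod ν) := (lintegral_prod _ (hf'.comp hφ).aemeasurable).symm
  rw [e1, e2]
  let C₁ : Set (Set (ℝ × Ω)) := {B | ∃ s t : ℝ, s < t ∧
    ∃ A : Set Ω, MeasurableSet[filt T N ξ s] A ∧ B = Ioc s t ×ˢ A}
  let C₂ : Set (Set ℝ) := {S | ∃ l u, l < u ∧ Ioc l u = S}
  -- With `n + 1` in place of `n` the interval is nondegenerate also for `n = 0`, as the generators
  -- require.
  have hpos : ∀ n : ℕ, -((n : ℝ) + 1) < n + 1 := fun n => by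
    have : (0 : ℝ) ≤ n := n.cast_nonneg
    linarith
  have hC₁ : ∀ n : ℕ, Ioc (-((n : ℝ) + 1)) (n + 1) ×ˢ (univ : Set Ω) ∈ C₁ := fun n =>
    ⟨_, _, hpos n, univ, @MeasurableSet.univ _ (filt T N ξ _), rfl⟩
  have hC₂ : ∀ n : ℕ, Ioc (-((n : ℝ) + 1)) (n + 1) ∈ C₂ := fun n => ⟨_, _, hpos n, rfl⟩
  have hsp₁ : IsCountablySpanning C₁ := ⟨_, hC₁, by
    rw [← iUnion_prod_const, iUnion_Ioc_neg_natCast, univ_prod_univ]⟩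
  have hsp₂ : IsCountablySpanning C₂ := ⟨_, hC₂, iUnion_Ioc_neg_natCast⟩
  have hgen : (predictable (filt T N ξ)).prod (inferInstance : MeasurableSpace ℝ) =
      MeasurableSpace.generateFrom (image2 (· ×ˢ ·) C₁ C₂) := by
    rw [← generateFrom_prod_eq hsp₁ hsp₂, ← borel_eq_generateFrom_Ioc ℝ,
      ← BorelSpace.measurable_eq (α := ℝ)]
    rfl
  have hU : ⋃ n : ℕ, (Ioc (-((n : ℝ) + 1)) (n + 1) ×ˢ (univ : Set Ω)) ×ˢ
      Ioc (-((n : ℝ) + 1)) (n + 1) = univ := by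
    rw [iUnion_prod_of_monotone (fun a b hab => prod_mono (Ioc_neg_natCast_mono hab) le_rfl)
      Ioc_neg_natCast_mono, ← iUnion_prod_const, iUnion_Ioc_neg_natCast]
    simp
  have hvol : ∀ a b c d : ℝ, ν (Ioc a b ×ˢ Ioc c d) ≠ ∞ := by
    intro a b c d
    refine ne_top_of_le_ne_top ?_ (Measure.restrict_apply_le _ _)
    rw [Measure.volume_eq_prod, Measure.prod_prod]
    simp [ENNReal.mul_ne_top]
  have hpre : ∀ a b c d : ℝ, ∀ A : Set Ω,
      φ ⁻¹' ((Ioc a b ×ˢ A) ×ˢ Ioc c d) = A ×ˢ (Ioc a b ×ˢ Ioc c d) := by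
    intro a b c d A
    ext ⟨ω, s, x⟩
    simp [φ]
    tauto
  have heq : ∀ s ∈ image2 (· ×ˢ ·) C₁ C₂, (μ ⊗ₘ κ) (φ ⁻¹' s) = (μ.prod ν) (φ ⁻¹' s) := by
    rintro _ ⟨_, ⟨a, b, -, A, hA, rfl⟩, _, ⟨c, d, -, rfl⟩, rfl⟩
    have hbox : MeasurableSet (Ioc a b ×ˢ Ioc c d) := measurableSet_Ioc.prod measurableSet_Ioc
    have hA' : MeasurableSet A := h.filt_le a _ hA
    rw [hpre, Measure.prod_prod, Measure.compProd_apply_prod hA' hbox]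
    have hind := h.indep_filt m a hbox (fun z hz => hz.1.1)
    have hAm : Measurable[filt T N ξ a] (A.indicator fun _ => (1 : ℝ≥0∞)) :=
      measurable_const.indicator hA
    have hi := lintegral_mul_eq_lintegral_mul_lintegral_of_independent_measurableSpace
      ((h.poisson m).measurable_cnt hbox).comap_le (h.filt_le a) hind
      (comap_measurable fun ω => cnt (N m ω) (Ioc a b ×ˢ Ioc c d))
      hAm
    rw [(h.poisson m).lintegral_cnt hbox (hvol a b c d)] at hi
    rw [mul_comm, ← lintegral_indicator_one hA', ← lintegral_indicator hA']
    refine Eq.trans (lintegral_congr fun ω => ?_) hi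
    by_cases hω : ω ∈ A <;> simp [hω, κ]
  refine @lintegral_comp_eq_of_piSystem _ _ _ ((predictable (filt T N ξ)).prod inferInstance)
    _ _ φ (hφ.mono le_rfl hle') _ hgen
    (IsPiSystem.prod (isPiSystem_predictable filt_mono) (isPiSystem_Ioc id id)) _ hU
    (fun n => ⟨_, hC₁ n, _, hC₂ n, rfl⟩) (fun n => ?_) heq f hf
  rw [heq _ ⟨_, hC₁ n, _, hC₂ n, rfl⟩, hpre, Measure.prod_prod]
  exact ENNReal.mul_ne_top (measure_ne_top _ _) (hvol _ _ _ _)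

end IsDrivingNoise

/-! ### Uniqueness of the law of Poisson random measures -/

/-- A random measure is encoded by its values on the sets satisfying `p`. These determine its values
on all measurable sets by exhaustion with `D`, and the law of the encoding is determined by its
finite marginals. -/
theorem identDistrib_of_finite_marginals {α Ω Ω' : Type*} [MeasurableSpace α]
    [mΩ : MeasurableSpace Ω] [MeasurableSpace Ω'] {μ : Measure Ω} {μ' : Measure Ω'}
    [IsProbabilityMeasure μ] [IsProbabilityMeasure μ'] {X : Ω → Measure α} {Y : Ω' → Measure α}
    (hX : Measurable X) (hY : Measurable Y) (p : Set α → Prop)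
    (hp : ∀ C, p C → MeasurableSet C) (D : ℕ → Set α) (hD : Monotone D) (hU : ⋃ n, D n = univ)
    (hpD : ∀ C, MeasurableSet C → ∀ n, p (C ∩ D n))
    (h : ∀ I : Finset {C // p C}, IdentDistrib (fun ω => fun C : I => X ω C.1.1)
      (fun ω => fun C : I => Y ω C.1.1) μ μ') : IdentDistrib X Y μ μ' := by
  refine ⟨hX.aemeasurable, hY.aemeasurable, ?_⟩
  let e : Measure α → {C // p C} → ℝ≥0∞ := fun ρ C => ρ C.1
  have he : Measurable e := measurable_pi_lambda _ fun C => Measure.measurable_coe (hp _ C.2)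
  have hcomap : (inferInstance : MeasurableSpace (Measure α)) ≤
      MeasurableSpace.comap e inferInstance := by
    have : @Measurable _ _ (MeasurableSpace.comap e inferInstance) _ (fun ρ : Measure α => ρ) := by
      let _ : MeasurableSpace (Measure α) := MeasurableSpace.comap e inferInstance
      refine Measure.measurable_of_measurable_coe _ fun C hC => ?_
      have hsup : ∀ ρ : Measure α, ρ C = ⨆ n, e ρ ⟨C ∩ D n, hpD C hC n⟩ := by
        intro ρ
        have hmono : Monotone fun n => C ∩ D n := fun a b hab => inter_subset_inter_right _ (hD hab)
        rw [← hmono.measure_iUnion, ← inter_iUnion, hU, inter_univ]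
      simp_rw [hsup]
      have he' : Measurable e := comap_measurable e
      exact Measurable.iSup fun n => measurable_pi_iff.1 he' ⟨C ∩ D n, hpD C hC n⟩
    intro s hs
    exact this hs
  have hmap : (μ.map X).map e = (μ'.map Y).map e := by
    rw [Measure.map_map he hX, Measure.map_map he hY]
    have hXe := Measure.isProbabilityMeasure_map (μ := μ) (he.comp hX).aemeasurable
    have hYe := Measure.isProbabilityMeasure_map (μ := μ') (he.comp hY).aemeasurable
    refine IsProjectiveLimit.unique
      (P := fun I : Finset {C // p C} => (μ.map (e ∘ X)).map I.restrict) (fun I => rfl) fun I => ?_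
    change _ = (μ.map (e ∘ X)).map I.restrict
    rw [Measure.map_map (Finset.measurable_restrict I) (he.comp hX),
      Measure.map_map (Finset.measurable_restrict I) (he.comp hY)]
    exact (h I).map_eq.symm
  ext s hs
  obtain ⟨t, ht, rfl⟩ := hcomap s hs
  rw [← Measure.map_apply he ht, ← Measure.map_apply he ht, hmap]

/-- Counts over atoms are independent with prescribed Poisson laws, so their joint law is
determined; counts in arbitrary sets of finite intensity are sums of these. -/
theorem IsPoissonRandomMeasure.identDistrib {α Ω : Type*} [TopologicalSpace α] [MeasurableSpace α]
    [MeasurableSpace Ω] {N N' : Ω → Set α} {ν : Measure α} {μ : Measure Ω} [IsProbabilityMeasure μ]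
    (hN : IsPoissonRandomMeasure N ν μ) (hN' : IsPoissonRandomMeasure N' ν μ) (D : ℕ → Set α)
    (hDm : ∀ n, MeasurableSet (D n)) (hD : Monotone D) (hU : ⋃ n, D n = univ)
    (hfin : ∀ n, ν (D n) ≠ ∞) :
    IdentDistrib (fun ω => cnt (N ω)) (fun ω => cnt (N' ω)) μ μ := by
  classical
  refine identDistrib_of_finite_marginals hN.measurable hN'.measurable
    (fun C => MeasurableSet C ∧ ν C ≠ ∞) (fun C hC => hC.1) D hD hU
    (fun C hC n => ⟨hC.inter (hDm n), ne_top_of_le_ne_top (hfin n) (measure_mono inter_subset_right)⟩)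
    fun I => ?_
  let C : I → Set α := fun C => C.1.1
  have hC : ∀ i, MeasurableSet (C i) := fun i => i.1.2.1
  -- The atom of the empty index set lies outside every `C i`: it is not needed, and its intensity
  -- may be infinite.
  let ι := {J : Finset I // J.Nonempty}
  let A : ι → Set α := fun J => atom C J.1
  have hA : ∀ J, MeasurableSet (A J) := fun J => measurableSet_atom hC J.1
  have hAd : Pairwise fun J K => Disjoint (A J) (A K) := fun J K hJK =>
    disjoint_atom C fun h => hJK (Subtype.ext h)
  have hAν : ∀ J, ν (A J) ≠ ∞ := by
    rintro ⟨J, i, hi⟩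
    exact ne_top_of_le_ne_top i.1.2.2 (measure_mono fun x hx => (hx i).2 hi)
  have hid := IdentDistrib.pi (fun J => (⟨(hN.measurable_cnt (hA J)).aemeasurable,
    (hN'.measurable_cnt (hA J)).aemeasurable, by
      rw [(hN.law _ (hA J) (hAν J)).map_eq, (hN'.law _ (hA J) (hAν J)).map_eq]⟩ :
      IdentDistrib (fun ω => cnt (N ω) (A J)) (fun ω => cnt (N' ω) (A J)) μ μ))
    (hN.iIndepFun_of_fintype A hA hAd) (hN'.iIndepFun_of_fintype A hA hAd)
  let g : (ι → ℝ≥0∞) → I → ℝ≥0∞ := fun a i =>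
    ∑ J : Finset I, if h : i ∈ J then a ⟨J, ⟨i, h⟩⟩ else 0
  have hg : Measurable g := by
    refine measurable_pi_lambda _ fun i => Finset.measurable_sum _ fun J _ => ?_
    split_ifs
    · exact measurable_pi_apply _
    · exact measurable_const
  have hgρ : ∀ ρ : Measure α, g (fun J => ρ (A J)) = fun i : I => ρ i.1.1 := by
    intro ρ
    ext i
    refine Eq.trans (Finset.sum_congr rfl fun J _ => ?_) (measure_eq_sum_atom hC ρ i).symm
    by_cases hi : i ∈ J <;> simp [hi, A]
  have h := hid.comp hg
  simp only [Function.comp_def, hgρ] at h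
  exact h

/-! ### Lipschitz constants and norms -/

/-- The infimum is attained: dividing by the distance turns the Lipschitz inequality into a lower
bound for all admissible constants. Distance zero is handled separately. -/
theorem lipschitzWith_lip {f : ℝ → ℝ} (hf : ∃ K : ℝ≥0, LipschitzWith K f) :
    LipschitzWith (lip f) f := by
  obtain ⟨K₀, hK₀⟩ := hf
  intro x y
  have hne : {K : ℝ≥0 | LipschitzWith K f}.Nonempty := ⟨K₀, hK₀⟩
  by_cases hxy : edist x y = 0
  · have := hK₀ x y
    rw [hxy, mul_zero] at this
    exact this.trans zero_le
  · have hdiv : edist (f x) (f y) / edist x y ≤ (lip f : ℝ≥0∞) := by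
      rw [lip, ENNReal.coe_sInf hne]
      exact le_iInf₂ fun K hK => ENNReal.div_le_of_le_mul (hK x y)
    exact (ENNReal.div_le_iff_le_mul (Or.inl hxy) (Or.inl (edist_ne_top x y))).1 hdiv

theorem Params.lipschitzWith_link {M P : ℕ} (𝔐 : Params M P) (α : Fin M ⊕ Fin P) :
    LipschitzWith (lip (𝔐.link α)) (𝔐.link α) := lipschitzWith_lip (𝔐.link_lipschitz α)

theorem Params.lipschitzWith_mask {M P : ℕ} (𝔐 : Params M P) (α : Fin M ⊕ Fin P) (p : Fin P) :
    LipschitzWith (lip (𝔐.mask α p)) (𝔐.mask α p) := lipschitzWith_lip (𝔐.mask_lipschitz α p)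

theorem LipschitzWith.enorm_sub_le_real {K : ℝ≥0} {f : ℝ → ℝ} (hf : LipschitzWith K f) (x y : ℝ) :
    ‖f x - f y‖ₑ ≤ K * ‖x - y‖ₑ := by
  rw [← edist_eq_enorm_sub, ← edist_eq_enorm_sub]
  exact hf x y

theorem mulTop_ne_top {x y : ℝ≥0∞} (h : mulTop x y ≠ ∞) : x ≠ ∞ ∧ y ≠ ∞ ∧ mulTop x y = x * y := by
  classical
  unfold mulTop at h ⊢
  by_cases hxy : x = ∞ ∨ y = ∞
  · simp [hxy] at h
  · rw [if_neg hxy]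
    exact ⟨fun hx => hxy (Or.inl hx), fun hy => hxy (Or.inr hy), rfl⟩

theorem Params.H_inl {M P : ℕ} {𝔐 : Params M P} {T : TimeGrid P} {α : Fin M ⊕ Fin P} {m : Fin M}
    (h : 𝔐.H T α (Sum.inl m) ≠ ∞) : normL1 (𝔐.h α (Sum.inl m)) ≠ ∞ ∧
      𝔐.H T α (Sum.inl m) = lip (𝔐.link α) * normL1 (𝔐.h α (Sum.inl m)) := by
  obtain ⟨-, h2, h3⟩ := mulTop_ne_top h
  exact ⟨h2, h3⟩

theorem Params.H_inr {M P : ℕ} {𝔐 : Params M P} {T : TimeGrid P} {α : Fin M ⊕ Fin P} {p : Fin P}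
    (h : 𝔐.H T α (Sum.inr p) ≠ ∞) : normDisc (T.freq p) (𝔐.h α (Sum.inr p)) ≠ ∞ ∧
      𝔐.H T α (Sum.inr p) = lip (𝔐.link α) * lip (𝔐.mask α p) *
        normDisc (T.freq p) (𝔐.h α (Sum.inr p)) := by
  obtain ⟨h1, h2, h3⟩ := mulTop_ne_top h
  obtain ⟨-, -, h4⟩ := mulTop_ne_top h1
  exact ⟨h2, h3.trans (by rw [h4])⟩

theorem lintegral_enorm_sub_left (h : ℝ → ℝ) (t : ℝ) : ∫⁻ s, ‖h (t - s)‖ₑ = normL1 h :=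
  lintegral_sub_left_eq_self (fun s => ‖h s‖ₑ) t

theorem tsum_enorm_time_le (T : TimeGrid P) (p : Fin P) (h : ℝ → ℝ) (t : ℝ) :
    ∑' j : ℤ, ‖h (t - T.time p j)‖ₑ ≤ normDisc (T.freq p) h := by
  -- Negating `j` gives the series of `normDisc` at the base point `x = t - θ_p`.
  rw [← (Equiv.neg ℤ).tsum_eq]
  refine le_trans (le_of_eq ?_) (le_iSup _ (t - T.phase p))
  congr 1 with j
  congr 2
  simp only [TimeGrid.time, Equiv.neg_apply]
  push_cast
  ring

/-! ### Bounds for integrals with respect to thinned measures -/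

/-- Both thinnings use the same atoms, so below both graphs the contributions cancel and only the
atoms between the graphs remain. -/
theorem enorm_integral_thin_sub_le {ρ : Measure (ℝ × ℝ)} {l l' : ℝ → ℝ} (hl : Measurable l)
    (hl' : Measurable l') {f : ℝ → ℝ} (hf : Measurable f) (h : ∫⁻ s, ‖f s‖ₑ ∂thin ρ l ≠ ∞)
    (h' : ∫⁻ s, ‖f s‖ₑ ∂thin ρ l' ≠ ∞) :
    ‖∫ s, f s ∂thin ρ l - ∫ s, f s ∂thin ρ l'‖ₑ ≤
      ∫⁻ z, (if min (l z.1) (l' z.1) < z.2 ∧ z.2 ≤ max (l z.1) (l' z.1) then ‖f z.1‖ₑ else 0) ∂ρ := by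
  have key : ∀ k : ℝ → ℝ, Measurable k → ∫⁻ s, ‖f s‖ₑ ∂thin ρ k ≠ ∞ →
      Integrable (fun z : ℝ × ℝ => if z.2 ≤ k z.1 then f z.1 else 0) ρ := by
    intro k hk hfin
    refine ⟨(Measurable.ite (measurableSet_subgraph hk) (hf.comp measurable_fst)
      measurable_const).aestronglyMeasurable, ?_⟩
    rw [lintegral_thin ρ hk hf.enorm] at hfin
    refine lt_of_le_of_lt (le_of_eq (lintegral_congr fun z => ?_)) hfin.lt_top
    by_cases hz : z.2 ≤ k z.1 <;> simp [hz]
  rw [integral_thin ρ hl hf, integral_thin ρ hl' hf, ← integral_sub (key l hl h) (key l' hl' h')]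
  refine (enorm_integral_le_lintegral_enorm _).trans (lintegral_mono fun z => ?_)
  simp only
  rcases le_total (l z.1) (l' z.1) with hle | hle
  · rw [min_eq_left hle, max_eq_right hle]
    by_cases h1 : z.2 ≤ l z.1
    · simp [h1, h1.trans hle]
    · by_cases h2 : z.2 ≤ l' z.1 <;> simp [h1, h2, not_le.1 h1]
  · rw [min_eq_right hle, max_eq_left hle]
    by_cases h1 : z.2 ≤ l' z.1
    · simp [h1, h1.trans hle]
    · by_cases h2 : z.2 ≤ l z.1 <;> simp [h1, h2, not_le.1 h1]

namespace IsDrivingNoise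

variable {M P : ℕ} {T : TimeGrid P} {Ω : Type*} [mΩ : MeasurableSpace Ω] {μ : Measure Ω}
  {N : Fin M → Ω → Set (ℝ × ℝ)} {ξ : Fin P → ℤ → Ω → ℝ}

theorem measurable_lintegral_between (h : IsDrivingNoise T N ξ μ) (m : Fin M) {l l' : ℝ × Ω → ℝ}
    (hl : Measurable l) (hl' : Measurable l') {g : ℝ → ℝ≥0∞} (hg : Measurable g) :
    Measurable fun ω => ∫⁻ z, (if min (l (z.1, ω)) (l' (z.1, ω)) < z.2 ∧
      z.2 ≤ max (l (z.1, ω)) (l' (z.1, ω)) then g z.1 else 0) ∂cnt (N m ω) := by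
  refine measurable_lintegral_of_boxFinite (h.poisson m).measurable (h.boxFinite m)
    (f := fun x : Ω × (ℝ × ℝ) => if min (l (x.2.1, x.1)) (l' (x.2.1, x.1)) < x.2.2 ∧
      x.2.2 ≤ max (l (x.2.1, x.1)) (l' (x.2.1, x.1)) then g x.2.1 else 0) ?_
  refine Measurable.ite ?_ (by fun_prop) measurable_const
  have h1 : Measurable fun x : Ω × (ℝ × ℝ) => l (x.2.1, x.1) := by fun_prop
  have h2 : Measurable fun x : Ω × (ℝ × ℝ) => l' (x.2.1, x.1) := by fun_prop
  have h3 : Measurable fun x : Ω × (ℝ × ℝ) => x.2.2 := by fun_prop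
  exact (measurableSet_lt (h1.min h2) h3).inter (measurableSet_le h3 (h1.max h2))

variable [IsProbabilityMeasure μ]

/-- By Campbell's formula the atoms are replaced by Lebesgue measure; integrating over the mark
first leaves the length of a section of `D`, which is at most `v`. -/
theorem lintegral_predictable_le (h : IsDrivingNoise T N ξ μ) (m : Fin M)
    {D : Set ((ℝ × Ω) × ℝ)} [DecidablePred (· ∈ D)]
    (hD : MeasurableSet[(predictable (filt T N ξ)).prod inferInstance] D)
    {g : ℝ → ℝ≥0∞} (hg : Measurable g) {v : ℝ × Ω → ℝ≥0∞} (hv : Measurable v)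
    (hDv : ∀ s ω, volume {x : ℝ | ((s, ω), x) ∈ D ∧ 0 ≤ x} ≤ v (s, ω)) :
    ∫⁻ ω, ∫⁻ z, (if ((z.1, ω), z.2) ∈ D then g z.1 else 0) ∂cnt (N m ω) ∂μ ≤
      ∫⁻ s, g s * ∫⁻ ω, v (s, ω) ∂μ := by
  have hle := predictable_le h.filt_le
  have hle' : (predictable (filt T N ξ)).prod (inferInstance : MeasurableSpace ℝ) ≤
      (inferInstance : MeasurableSpace ((ℝ × Ω) × ℝ)) :=
    sup_le_sup (MeasurableSpace.comap_mono hle) le_rfl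
  have hgm : Measurable[(predictable (filt T N ξ)).prod inferInstance]
      fun y : (ℝ × Ω) × ℝ => g y.1.1 := by
    have h3 := measurable_predictable_fst (F := filt T N ξ)
    let _ := predictable (filt T N ξ)
    exact hg.comp (h3.comp measurable_fst)
  have hf : Measurable[(predictable (filt T N ξ)).prod inferInstance]
      fun y : (ℝ × Ω) × ℝ => if y ∈ D then g y.1.1 else 0 :=
    Measurable.ite hD hgm measurable_const
  have hf' := hf.mono hle' le_rfl
  have hD' : MeasurableSet D := hle' _ hD
  refine (h.lintegral_predictable m hf).trans_le ?_
  have h1 : ∀ ω, ∫⁻ z in {z : ℝ × ℝ | 0 ≤ z.2}, (if ((z.1, ω), z.2) ∈ D then g z.1 else 0)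
      ∂volume ≤ ∫⁻ s, g s * v (s, ω) := by
    intro ω
    have h0 : MeasurableSet {z : ℝ × ℝ | 0 ≤ z.2} := measurableSet_le measurable_const measurable_snd
    rw [← lintegral_indicator h0, Measure.volume_eq_prod, lintegral_prod]
    · refine lintegral_mono fun s => ?_
      have hm : MeasurableSet {x : ℝ | ((s, ω), x) ∈ D ∧ 0 ≤ x} :=
        (measurable_prodMk_left hD').inter measurableSet_Ici
      refine le_trans (le_of_eq ?_) (mul_le_mul_right (hDv s ω) (g s))
      rw [← lintegral_indicator_const hm]
      refine lintegral_congr fun x => ?_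
      by_cases hx : 0 ≤ x <;> by_cases hx' : ((s, ω), x) ∈ D <;> simp [hx, hx']
    · refine Measurable.aemeasurable (Measurable.indicator ?_ h0)
      exact hf'.comp (f := fun z : ℝ × ℝ => ((z.1, ω), z.2)) (by fun_prop)
  refine (lintegral_mono h1).trans ?_
  rw [lintegral_lintegral_swap]
  · refine lintegral_mono fun s => ?_
    exact (lintegral_const_mul _ (hv.comp measurable_prodMk_left)).le
  · exact Measurable.aemeasurable ((hg.comp measurable_snd).mul (hv.comp measurable_swap))

theorem lintegral_thin_le (h : IsDrivingNoise T N ξ μ) (m : Fin M) {l : ℝ × Ω → ℝ}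
    (hl : Measurable[predictable (filt T N ξ)] l) {g : ℝ → ℝ≥0∞} (hg : Measurable g) {c : ℝ≥0∞}
    (hc : ∀ᵐ s, ∫⁻ ω, ‖l (s, ω)‖ₑ ∂μ ≤ c) :
    ∫⁻ ω, ∫⁻ s, g s ∂thin (cnt (N m ω)) (fun s => l (s, ω)) ∂μ ≤ (∫⁻ s, g s) * c := by
  classical
  let D : Set ((ℝ × Ω) × ℝ) := {y | y.2 ≤ l y.1}
  have hD : MeasurableSet[(predictable (filt T N ξ)).prod inferInstance] D := by
    let _ := predictable (filt T N ξ)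
    exact measurableSet_le measurable_snd (hl.comp measurable_fst)
  have hlm : Measurable l := hl.mono (predictable_le h.filt_le) le_rfl
  have h1 := h.lintegral_predictable_le m hD hg (v := fun x => ‖l x‖ₑ) hlm.enorm (fun s ω => by
    -- Only nonnegative marks count, so the section is `[0, l]`, of length at most `|l|` whatever
    -- the sign of `l`.
    refine (measure_mono (t := Icc 0 (l (s, ω))) fun x hx => ⟨hx.2, hx.1⟩).trans ?_
    rw [Real.volume_Icc, sub_zero]
    exact Real.ofReal_le_enorm _)
  have h2 : ∀ ω, ∫⁻ s, g s ∂thin (cnt (N m ω)) (fun s => l (s, ω)) = _ := fun ω =>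
    lintegral_thin _ (measurable_section_of_predictable hl ω) hg
  simp_rw [h2]
  refine h1.trans ((lintegral_mono_ae (hc.mono fun s hs => mul_le_mul_right hs (g s))).trans ?_)
  rw [lintegral_mul_const _ hg]

/-- The strip between two predictable graphs is predictable and its section has length `|l - l'|`.
The bound `c` is needed only for almost every time, since time is integrated. -/
theorem lintegral_between_le (h : IsDrivingNoise T N ξ μ) (m : Fin M) {l l' : ℝ × Ω → ℝ}
    (hl : Measurable[predictable (filt T N ξ)] l) (hl' : Measurable[predictable (filt T N ξ)] l')
    {g : ℝ → ℝ≥0∞} (hg : Measurable g) {c : ℝ≥0∞}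
    (hc : ∀ᵐ s, ∫⁻ ω, ‖l (s, ω) - l' (s, ω)‖ₑ ∂μ ≤ c) :
    ∫⁻ ω, ∫⁻ z, (if min (l (z.1, ω)) (l' (z.1, ω)) < z.2 ∧ z.2 ≤ max (l (z.1, ω)) (l' (z.1, ω))
      then g z.1 else 0) ∂cnt (N m ω) ∂μ ≤ (∫⁻ s, g s) * c := by
  classical
  let D : Set ((ℝ × Ω) × ℝ) := {y | min (l y.1) (l' y.1) < y.2 ∧ y.2 ≤ max (l y.1) (l' y.1)}
  have hD : MeasurableSet[(predictable (filt T N ξ)).prod inferInstance] D := by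
    let _ := predictable (filt T N ξ)
    exact (measurableSet_lt ((hl.min hl').comp measurable_fst) measurable_snd).inter
      (measurableSet_le measurable_snd ((hl.max hl').comp measurable_fst))
  have hlm : Measurable l := hl.mono (predictable_le h.filt_le) le_rfl
  have hlm' : Measurable l' := hl'.mono (predictable_le h.filt_le) le_rfl
  have h1 := h.lintegral_predictable_le m hD hg (v := fun x => ‖l x - l' x‖ₑ) (hlm.sub hlm').enorm
    (fun s ω => by
      refine (measure_mono (t := Ioc (min (l (s, ω)) (l' (s, ω))) (max (l (s, ω)) (l' (s, ω))))
        fun x hx => hx.1).trans ?_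
      rw [Real.volume_Ioc, max_sub_min_eq_abs', ← Real.enorm_abs]
      exact Real.ofReal_le_enorm _)
  refine h1.trans ((lintegral_mono_ae (hc.mono fun s hs => mul_le_mul_right hs (g s))).trans ?_)
  rw [lintegral_mul_const _ hg]

end IsDrivingNoise

/-! ### Absolute bounds for the drive -/

section Drive

variable {M P : ℕ}

/-- All integrals and series in `driveOf` converge absolutely. -/
def DriveOfConverges (T : TimeGrid P) (𝔐 : Params M P) (ρ : Fin M → Measure ℝ)
    (w : Fin P → ℤ → ℝ) (α : Fin M ⊕ Fin P) (t : ℝ) : Prop :=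
  (∀ m, IntegrableOn (fun s => 𝔐.h α (Sum.inl m) (t - s)) (Iio t) (ρ m)) ∧
    ∀ p, Summable fun j : {j : ℤ // T.time p j < t} =>
      𝔐.h α (Sum.inr p) (t - T.time p j) * 𝔐.mask α p (w p j)

/-- The drive with all terms replaced by their absolute values. -/
noncomputable def absDrive (T : TimeGrid P) (𝔐 : Params M P) (ρ : Fin M → Measure ℝ)
    (w : Fin P → ℤ → ℝ) (α : Fin M ⊕ Fin P) (t : ℝ) : ℝ≥0∞ :=
  (∑ m, ∫⁻ s in Iio t, ‖𝔐.h α (Sum.inl m) (t - s)‖ₑ ∂ρ m) +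
    ∑ p, ∑' j : ℤ, ‖𝔐.h α (Sum.inr p) (t - T.time p j) * 𝔐.mask α p (w p j)‖ₑ

variable (T : TimeGrid P) (𝔐 : Params M P)

theorem measurable_h_sub (α β : Fin M ⊕ Fin P) (t : ℝ) : Measurable fun s => 𝔐.h α β (t - s) :=
  (𝔐.h_measurable α β).comp (measurable_const.sub measurable_id)

/-- Interactions vanish at nonpositive arguments, so the restriction to the past can be dropped here
and in the next two lemmas. -/
theorem setIntegral_Iio_eq (ρ : Measure ℝ) (α β : Fin M ⊕ Fin P) (t : ℝ) :
    ∫ s in Iio t, 𝔐.h α β (t - s) ∂ρ = ∫ s, 𝔐.h α β (t - s) ∂ρ :=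
  setIntegral_eq_integral_of_forall_compl_eq_zero fun _ hs =>
    𝔐.h_eq_zero _ _ _ (sub_nonpos.2 (not_lt.1 hs))

theorem setLIntegral_Iio_eq (ρ : Measure ℝ) (α β : Fin M ⊕ Fin P) (t : ℝ) :
    ∫⁻ s in Iio t, ‖𝔐.h α β (t - s)‖ₑ ∂ρ = ∫⁻ s, ‖𝔐.h α β (t - s)‖ₑ ∂ρ := by
  rw [← lintegral_indicator measurableSet_Iio]
  refine lintegral_congr fun s => ?_
  by_cases hs : s < t
  · simp [hs]
  · simp [hs, 𝔐.h_eq_zero α β _ (sub_nonpos.2 (not_lt.1 hs))]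

theorem tsum_past_eq (w : ℤ → ℝ) (α : Fin M ⊕ Fin P) (p : Fin P) (t : ℝ) :
    ∑' j : {j : ℤ // T.time p j < t}, 𝔐.h α (Sum.inr p) (t - T.time p j) * 𝔐.mask α p (w j) =
      ∑' j : ℤ, 𝔐.h α (Sum.inr p) (t - T.time p j) * 𝔐.mask α p (w j) := by
  refine tsum_subtype_eq_of_support_subset (s := {j : ℤ | T.time p j < t})
    (f := fun j => 𝔐.h α (Sum.inr p) (t - T.time p j) * 𝔐.mask α p (w j)) fun j hj => ?_
  by_contra hlt
  exact hj (by simp [𝔐.h_eq_zero α (Sum.inr p) _ (sub_nonpos.2 (not_lt.1 hlt))])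

variable {T 𝔐} {ρ : Fin M → Measure ℝ} {w : Fin P → ℤ → ℝ} {α : Fin M ⊕ Fin P} {t : ℝ}

theorem absDrive_node_ne_top (h : absDrive T 𝔐 ρ w α t ≠ ∞) (m : Fin M) :
    ∫⁻ s, ‖𝔐.h α (Sum.inl m) (t - s)‖ₑ ∂ρ m ≠ ∞ := by
  rw [← setLIntegral_Iio_eq]
  exact ENNReal.sum_ne_top.1 (ENNReal.add_ne_top.1 h).1 m (Finset.mem_univ m)

theorem absDrive_chain_ne_top (h : absDrive T 𝔐 ρ w α t ≠ ∞) (p : Fin P) :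
    ∑' j : ℤ, ‖𝔐.h α (Sum.inr p) (t - T.time p j) * 𝔐.mask α p (w p j)‖ₑ ≠ ∞ :=
  ENNReal.sum_ne_top.1 (ENNReal.add_ne_top.1 h).2 p (Finset.mem_univ p)

theorem driveOfConverges_of_absDrive_ne_top (h : absDrive T 𝔐 ρ w α t ≠ ∞) :
    DriveOfConverges T 𝔐 ρ w α t := by
  refine ⟨fun m => ⟨(measurable_h_sub 𝔐 α _ t).aestronglyMeasurable, ?_⟩, fun p => ?_⟩
  · exact (setLIntegral_Iio_eq 𝔐 (ρ m) α (Sum.inl m) t ▸ (absDrive_node_ne_top h m)).lt_top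
  · exact (Summable.of_enorm (absDrive_chain_ne_top h p)).subtype _

/-- No convergence is required: a divergent integral or series has the default value zero. -/
theorem enorm_driveOf_le : ‖driveOf T 𝔐 ρ w α t‖ₑ ≤ absDrive T 𝔐 ρ w α t := by
  refine (enorm_add_le _ _).trans (add_le_add ?_ ?_)
  · exact (enorm_sum_le _ _).trans
      (Finset.sum_le_sum fun m _ => enorm_integral_le_lintegral_enorm _)
  · refine (enorm_sum_le _ _).trans (Finset.sum_le_sum fun p _ => ?_)
    rw [tsum_past_eq]
    exact enorm_tsum_le_tsum_enorm

end Drive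

/-! ### Expected bounds -/

section L1

variable {M P : ℕ}

/-- The realization of the driving noise. -/
noncomputable def noiseOf {Ω : Type*} (N : Fin M → Ω → Set (ℝ × ℝ)) (ξ : Fin P → ℤ → Ω → ℝ) (ω : Ω) :
    NoiseSpace M P :=
  (fun m => cnt (N m ω), fun p j => ξ p j ω)

/-- The `L¹` distances between the components of two random trajectories are bounded by `D`, for
almost all times in the case of the intensities. -/
structure L1Near {Ω : Type*} [MeasurableSpace Ω] (μ : Measure Ω) (u u' : Ω → Traj M P)
    (D : Fin M ⊕ Fin P → ℝ≥0∞) : Prop where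
  lam : ∀ m, ∀ᵐ s, ∫⁻ ω, ‖(u ω).1 m s - (u' ω).1 m s‖ₑ ∂μ ≤ D (Sum.inl m)
  W : ∀ p j, ∫⁻ ω, ‖(u ω).2 p j - (u' ω).2 p j‖ₑ ∂μ ≤ D (Sum.inr p)

/-- A bound for the expected absolute drive of a trajectory with `L¹` norms bounded by `D`. -/
noncomputable def driveBound (T : TimeGrid P) (𝔐 : Params M P) (D : Fin M ⊕ Fin P → ℝ≥0∞)
    (α : Fin M ⊕ Fin P) : ℝ≥0∞ :=
  (∑ m, normL1 (𝔐.h α (Sum.inl m)) * D (Sum.inl m)) +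
    ∑ p, normDisc (T.freq p) (𝔐.h α (Sum.inr p)) *
      (‖𝔐.mask α p 0‖ₑ + lip (𝔐.mask α p) * D (Sum.inr p))

theorem driveBound_ne_top {T : TimeGrid P} {𝔐 : Params M P} (hH : ∀ α β, 𝔐.H T α β ≠ ∞)
    {D : Fin M ⊕ Fin P → ℝ≥0∞} (hD : ∀ α, D α ≠ ∞) (α : Fin M ⊕ Fin P) :
    driveBound T 𝔐 D α ≠ ∞ := by
  refine ENNReal.add_ne_top.2 ⟨ENNReal.sum_ne_top.2 fun m _ => ?_, ENNReal.sum_ne_top.2 fun p _ => ?_⟩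
  · exact ENNReal.mul_ne_top (Params.H_inl (hH α (Sum.inl m))).1 (hD _)
  · exact ENNReal.mul_ne_top (Params.H_inr (hH α (Sum.inr p))).1
      (ENNReal.add_ne_top.2 ⟨enorm_ne_top, ENNReal.mul_ne_top ENNReal.coe_ne_top (hD _)⟩)

variable {T : TimeGrid P} {𝔐 : Params M P} {Ω : Type*} [mΩ : MeasurableSpace Ω] {μ : Measure Ω}
  {N : Fin M → Ω → Set (ℝ × ℝ)} {ξ : Fin P → ℤ → Ω → ℝ}
  {u u' : Ω → Traj M P} {D D₁ D₂ : Fin M ⊕ Fin P → ℝ≥0∞}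

theorem measurable_absDrive (h : IsDrivingNoise T N ξ μ) (hu : AdaptedTraj T (filt T N ξ) u)
    (α : Fin M ⊕ Fin P) : Measurable fun z : ℝ × Ω =>
      absDrive T 𝔐 (fun m => thin (cnt (N m z.2)) ((u z.2).1 m)) (u z.2).2 α z.1 := by
  refine Measurable.add (Finset.measurable_sum _ fun m _ => ?_)
    (Finset.measurable_sum _ fun p _ => Measurable.tsum fun j => ?_)
  · exact (measurable_predictable_lintegral_thin (h.adaptedNoise.measurable_restrict m)
      (h.boxFinite m) (hu.lam m) (𝔐.h_measurable α (Sum.inl m)).enorm).mono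
      (predictable_le h.filt_le) le_rfl
  · exact (((𝔐.h_measurable α _).comp (measurable_fst.sub_const _)).mul
      ((𝔐.measurable_mask α p).comp (((hu.W p j).mono (h.filt_le _) le_rfl).comp
        measurable_snd))).enorm

variable [IsProbabilityMeasure μ]

/-- Campbell's formula bounds node terms by `‖h‖₁ D`, and exchanging expectation and series bounds
chain terms through the periodized norm. The result holds at every `t`, although intensities are
controlled only at almost every time. -/
theorem lintegral_absDrive_le (h : IsDrivingNoise T N ξ μ) (hu : AdaptedTraj T (filt T N ξ) u)
    (hD : L1Near μ u (fun _ => 0) D) (α : Fin M ⊕ Fin P) (t : ℝ) :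
    ∫⁻ ω, absDrive T 𝔐 (fun m => thin (cnt (N m ω)) ((u ω).1 m)) (u ω).2 α t ∂μ ≤
      driveBound T 𝔐 D α := by
  have hWm : ∀ p j, Measurable fun ω => (u ω).2 p j := fun p j => (hu.W p j).mono (h.filt_le _) le_rfl
  have hlm : ∀ m, Measurable fun z : Ω × ℝ => (u z.1).1 m z.2 := fun m =>
    ((hu.lam m).mono (predictable_le h.filt_le) le_rfl).comp measurable_swap
  have hchain : ∀ p (j : ℤ), Measurable fun ω =>
      ‖𝔐.h α (Sum.inr p) (t - T.time p j) * 𝔐.mask α p ((u ω).2 p j)‖ₑ := fun p j =>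
    (((𝔐.measurable_mask α p).comp (hWm p j)).const_mul _).enorm
  unfold absDrive
  simp_rw [setLIntegral_Iio_eq]
  rw [lintegral_add_right _ (Finset.measurable_sum _ fun p _ => Measurable.tsum (hchain p)),
    lintegral_finsetSum, lintegral_finsetSum]
  · refine add_le_add (Finset.sum_le_sum fun m _ => ?_) (Finset.sum_le_sum fun p _ => ?_)
    · rw [← lintegral_enorm_sub_left _ t]
      refine h.lintegral_thin_le m (hu.lam m) (measurable_h_sub 𝔐 α _ t).enorm ?_
      simpa using hD.lam m
    · rw [lintegral_tsum fun j => (hchain p j).aemeasurable]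
      have hj : ∀ j : ℤ, ∫⁻ ω, ‖𝔐.h α (Sum.inr p) (t - T.time p j) *
          𝔐.mask α p ((u ω).2 p j)‖ₑ ∂μ ≤ ‖𝔐.h α (Sum.inr p) (t - T.time p j)‖ₑ *
            (‖𝔐.mask α p 0‖ₑ + lip (𝔐.mask α p) * D (Sum.inr p)) := by
        intro j
        simp_rw [enorm_mul]
        rw [lintegral_const_mul _ (by exact ((𝔐.measurable_mask α p).comp (hWm p j)).enorm)]
        refine mul_le_mul_right ?_ _
        -- Masks need not vanish at zero, hence the constant term.
        have hb : ∀ ω, ‖𝔐.mask α p ((u ω).2 p j)‖ₑ ≤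
            ‖𝔐.mask α p 0‖ₑ + lip (𝔐.mask α p) * ‖(u ω).2 p j‖ₑ := by
          intro ω
          have h1 := LipschitzWith.enorm_sub_le_real (𝔐.lipschitzWith_mask α p) ((u ω).2 p j) 0
          rw [sub_zero] at h1
          refine le_trans ?_ (add_le_add_right h1 _)
          refine le_trans (le_of_eq ?_) (enorm_add_le _ _)
          rw [add_sub_cancel]
        refine (lintegral_mono hb).trans ?_
        rw [lintegral_add_left measurable_const, lintegral_const_mul _ (hWm p j).enorm]
        simp only [lintegral_const, measure_univ, mul_one]
        refine add_le_add_right (mul_le_mul_right ?_ _) _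
        simpa using hD.W p j
      refine (ENNReal.tsum_le_tsum hj).trans ?_
      rw [ENNReal.tsum_mul_right]
      exact mul_le_mul_left (tsum_enorm_time_le T p _ t) _
  · exact fun p _ => Measurable.tsum (hchain p)
  · exact fun m _ => measurable_lintegral_thin (h.poisson m).measurable (h.boxFinite m) (hlm m)
      (f := fun x => ‖𝔐.h α (Sum.inl m) (t - x.2)‖ₑ)
      ((measurable_h_sub 𝔐 α _ t).enorm.comp measurable_snd)

theorem ae_absDrive_ne_top (h : IsDrivingNoise T N ξ μ) (hH : ∀ α β, 𝔐.H T α β ≠ ∞)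
    (hu : AdaptedTraj T (filt T N ξ) u) (hD : L1Near μ u (fun _ => 0) D) (hfin : ∀ α, D α ≠ ∞)
    (α : Fin M ⊕ Fin P) (t : ℝ) :
    ∀ᵐ ω ∂μ, absDrive T 𝔐 (fun m => thin (cnt (N m ω)) ((u ω).1 m)) (u ω).2 α t ≠ ∞ := by
  have hm := (measurable_absDrive (𝔐 := 𝔐) h hu α).comp (measurable_prodMk_left (x := t))
  exact (ae_lt_top hm (ne_top_of_le_ne_top (driveBound_ne_top hH hfin α)
    (lintegral_absDrive_le h hu hD α t))).mono fun ω hω => hω.ne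

/-- The finite bounds `D₁` and `D₂` ensure that both drives converge absolutely almost surely, so
that they may be subtracted term by term; only the distance `D` enters the estimate. -/
theorem lintegral_driveOf_sub_le (h : IsDrivingNoise T N ξ μ) (hH : ∀ α β, 𝔐.H T α β ≠ ∞)
    (hu : AdaptedTraj T (filt T N ξ) u) (hu' : AdaptedTraj T (filt T N ξ) u')
    (hD₁ : L1Near μ u (fun _ => 0) D₁) (hfin₁ : ∀ α, D₁ α ≠ ∞)
    (hD₂ : L1Near μ u' (fun _ => 0) D₂) (hfin₂ : ∀ α, D₂ α ≠ ∞)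
    (hD : L1Near μ u u' D) (α : Fin M ⊕ Fin P) (t : ℝ) :
    ∫⁻ ω, ‖driveOf T 𝔐 (fun m => thin (cnt (N m ω)) ((u ω).1 m)) (u ω).2 α t -
        driveOf T 𝔐 (fun m => thin (cnt (N m ω)) ((u' ω).1 m)) (u' ω).2 α t‖ₑ ∂μ ≤
      (∑ m, normL1 (𝔐.h α (Sum.inl m)) * D (Sum.inl m)) +
        ∑ p, normDisc (T.freq p) (𝔐.h α (Sum.inr p)) * (lip (𝔐.mask α p) * D (Sum.inr p)) := by
  have hle := predictable_le h.filt_le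
  have hWm : ∀ p j, Measurable fun ω => ‖(u ω).2 p j - (u' ω).2 p j‖ₑ := fun p j =>
    (((hu.W p j).mono (h.filt_le _) le_rfl).sub ((hu'.W p j).mono (h.filt_le _) le_rfl)).enorm
  have hsum : ∀ p, Measurable fun ω => ∑' j : ℤ, ‖𝔐.h α (Sum.inr p) (t - T.time p j)‖ₑ *
      (lip (𝔐.mask α p) * ‖(u ω).2 p j - (u' ω).2 p j‖ₑ) := fun p =>
    Measurable.tsum fun j => ((hWm p j).const_mul _).const_mul _
  have hpt : ∀ᵐ ω ∂μ, ‖driveOf T 𝔐 (fun m => thin (cnt (N m ω)) ((u ω).1 m)) (u ω).2 α t -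
        driveOf T 𝔐 (fun m => thin (cnt (N m ω)) ((u' ω).1 m)) (u' ω).2 α t‖ₑ ≤
      (∑ m, ∫⁻ z, (if min ((u ω).1 m z.1) ((u' ω).1 m z.1) < z.2 ∧
          z.2 ≤ max ((u ω).1 m z.1) ((u' ω).1 m z.1) then ‖𝔐.h α (Sum.inl m) (t - z.1)‖ₑ else 0)
          ∂cnt (N m ω)) +
        ∑ p, ∑' j : ℤ, ‖𝔐.h α (Sum.inr p) (t - T.time p j)‖ₑ *
          (lip (𝔐.mask α p) * ‖(u ω).2 p j - (u' ω).2 p j‖ₑ) := by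
    filter_upwards [ae_absDrive_ne_top h hH hu hD₁ hfin₁ α t,
      ae_absDrive_ne_top h hH hu' hD₂ hfin₂ α t] with ω h1 h2
    unfold driveOf
    rw [add_sub_add_comm, ← Finset.sum_sub_distrib, ← Finset.sum_sub_distrib]
    refine (enorm_add_le _ _).trans (add_le_add ?_ ?_)
    · refine (enorm_sum_le _ _).trans (Finset.sum_le_sum fun m _ => ?_)
      rw [setIntegral_Iio_eq, setIntegral_Iio_eq]
      exact enorm_integral_thin_sub_le (measurable_section_of_predictable (hu.lam m) ω)
        (measurable_section_of_predictable (hu'.lam m) ω) (measurable_h_sub 𝔐 α _ t)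
        (absDrive_node_ne_top h1 m) (absDrive_node_ne_top h2 m)
    · refine (enorm_sum_le _ _).trans (Finset.sum_le_sum fun p _ => ?_)
      rw [tsum_past_eq, tsum_past_eq, ← (Summable.of_enorm (absDrive_chain_ne_top h1 p)).tsum_sub
        (Summable.of_enorm (absDrive_chain_ne_top h2 p))]
      refine enorm_tsum_le_tsum_enorm.trans (ENNReal.tsum_le_tsum fun j => ?_)
      rw [← mul_sub, enorm_mul]
      exact mul_le_mul_right
        (LipschitzWith.enorm_sub_le_real (𝔐.lipschitzWith_mask α p) _ _) _
  refine (lintegral_mono_ae hpt).trans ?_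
  rw [lintegral_add_right _ (Finset.measurable_sum _ fun p _ => hsum p),
    lintegral_finsetSum, lintegral_finsetSum]
  · refine add_le_add (Finset.sum_le_sum fun m _ => ?_) (Finset.sum_le_sum fun p _ => ?_)
    · rw [← lintegral_enorm_sub_left _ t]
      exact h.lintegral_between_le m (hu.lam m) (hu'.lam m) (measurable_h_sub 𝔐 α _ t).enorm
        (hD.lam m)
    · rw [lintegral_tsum fun j => (((hWm p j).const_mul _).const_mul _).aemeasurable]
      have hj : ∀ j : ℤ, ∫⁻ ω, ‖𝔐.h α (Sum.inr p) (t - T.time p j)‖ₑ *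
          (lip (𝔐.mask α p) * ‖(u ω).2 p j - (u' ω).2 p j‖ₑ) ∂μ ≤
          ‖𝔐.h α (Sum.inr p) (t - T.time p j)‖ₑ * (lip (𝔐.mask α p) * D (Sum.inr p)) := by
        intro j
        rw [lintegral_const_mul _ ((hWm p j).const_mul _), lintegral_const_mul _ (hWm p j)]
        exact mul_le_mul_right (mul_le_mul_right (hD.W p j) _) _
      refine (ENNReal.tsum_le_tsum hj).trans ?_
      rw [ENNReal.tsum_mul_right]
      exact mul_le_mul_left (tsum_enorm_time_le T p _ t) _
  · exact fun p _ => hsum p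
  · exact fun m _ => h.measurable_lintegral_between m ((hu.lam m).mono hle le_rfl)
      ((hu'.lam m).mono hle le_rfl) (measurable_h_sub 𝔐 α _ t).enorm

/-- The contraction estimate for the HAR equations. -/
theorem lintegral_link_sub_le (h : IsDrivingNoise T N ξ μ) (hH : ∀ α β, 𝔐.H T α β ≠ ∞)
    (hu : AdaptedTraj T (filt T N ξ) u) (hu' : AdaptedTraj T (filt T N ξ) u')
    (hD₁ : L1Near μ u (fun _ => 0) D₁) (hfin₁ : ∀ α, D₁ α ≠ ∞)
    (hD₂ : L1Near μ u' (fun _ => 0) D₂) (hfin₂ : ∀ α, D₂ α ≠ ∞)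
    (hD : L1Near μ u u' D) (α : Fin M ⊕ Fin P) (t c : ℝ) :
    ∫⁻ ω, ‖𝔐.link α
          (c + driveOf T 𝔐 (fun m => thin (cnt (N m ω)) ((u ω).1 m)) (u ω).2 α t) -
        𝔐.link α
          (c + driveOf T 𝔐 (fun m => thin (cnt (N m ω)) ((u' ω).1 m)) (u' ω).2 α t)‖ₑ ∂μ ≤
      (𝔐.H T).mulVec D α := by
  have h1 := lintegral_driveOf_sub_le h hH hu hu' hD₁ hfin₁ hD₂ hfin₂ hD α t
  refine (lintegral_mono fun ω =>
    LipschitzWith.enorm_sub_le_real (𝔐.lipschitzWith_link α) _ _).trans ?_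
  simp_rw [add_sub_add_left_eq_sub]
  rw [lintegral_const_mul' _ _ ENNReal.coe_ne_top]
  refine (mul_le_mul_right h1 _).trans (le_of_eq ?_)
  rw [Matrix.mulVec, dotProduct, Fintype.sum_sum_type, mul_add, Finset.mul_sum, Finset.mul_sum]
  congr 1
  · refine Finset.sum_congr rfl fun m _ => ?_
    rw [(Params.H_inl (hH α (Sum.inl m))).2, mul_assoc]
  · refine Finset.sum_congr rfl fun p _ => ?_
    rw [(Params.H_inr (hH α (Sum.inr p))).2]
    ring

/-- The `L¹` distances between the components of two random trajectories are bounded by `D`. -/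
structure L1Close {Ω : Type*} [MeasurableSpace Ω] (μ : Measure Ω) (u u' : Ω → Traj M P)
    (D : Fin M ⊕ Fin P → ℝ≥0∞) : Prop where
  lam : ∀ m s, ∫⁻ ω, ‖(u ω).1 m s - (u' ω).1 m s‖ₑ ∂μ ≤ D (Sum.inl m)
  W : ∀ p j, ∫⁻ ω, ‖(u ω).2 p j - (u' ω).2 p j‖ₑ ∂μ ≤ D (Sum.inr p)

theorem L1Close.near {Ω : Type*} [MeasurableSpace Ω] {μ : Measure Ω} {u u' : Ω → Traj M P}
    {D : Fin M ⊕ Fin P → ℝ≥0∞} (h : L1Close μ u u' D) : L1Near μ u u' D :=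
  ⟨fun m => Filter.Eventually.of_forall (h.lam m), h.W⟩

/-- One step upgrades a bound at almost every time to a bound at every time, because intensities
enter the drive only through integrals over time. -/
theorem L1Near.step (h : IsDrivingNoise T N ξ μ) (hH : ∀ α β, 𝔐.H T α β ≠ ∞)
    (hu : AdaptedTraj T (filt T N ξ) u) (hu' : AdaptedTraj T (filt T N ξ) u')
    (hD₁ : L1Near μ u (fun _ => 0) D₁) (hfin₁ : ∀ α, D₁ α ≠ ∞)
    (hD₂ : L1Near μ u' (fun _ => 0) D₂) (hfin₂ : ∀ α, D₂ α ≠ ∞) (hD : L1Near μ u u' D) :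
    L1Close μ (fun ω => step T 𝔐 (noiseOf N ξ ω) (u ω)) (fun ω => step T 𝔐 (noiseOf N ξ ω) (u' ω))
      ((𝔐.H T).mulVec D) where
  lam m s := lintegral_link_sub_le h hH hu hu' hD₁ hfin₁ hD₂ hfin₂ hD (Sum.inl m) s (𝔐.base m)
  W p j := by
    -- Chains have base rate zero, and the drift cancels in the difference.
    have h1 := lintegral_link_sub_le h hH hu hu' hD₁ hfin₁ hD₂ hfin₂ hD (Sum.inr p)
      (T.time p j) 0
    refine le_trans (le_of_eq (lintegral_congr fun ω => ?_)) h1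
    simp only [HAR.step, noiseOf, add_sub_add_left_eq_sub, zero_add]

end L1

open Filter Topology

/-! ### Limits of sequences with summable increments in `L¹` -/

/-- Summable L¹ increments are almost surely absolutely summable. The sequence is then Cauchy,
`limUnder` is its true limit, and the remainder is bounded by the tail of the increments. -/
theorem lintegral_limUnder_sub_le {Ω : Type*} [MeasurableSpace Ω] {μ : Measure Ω} {f : ℕ → Ω → ℝ}
    (hf : ∀ n, Measurable (f n)) {d : ℕ → ℝ≥0∞}
    (hd : ∀ n, ∫⁻ ω, ‖f (n + 1) ω - f n ω‖ₑ ∂μ ≤ d n) (hsum : ∑' n, d n ≠ ∞) (n : ℕ) :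
    ∫⁻ ω, ‖limUnder atTop (fun k => f k ω) - f n ω‖ₑ ∂μ ≤ ∑' k, d (n + k) := by
  have hm : ∀ k, Measurable fun ω => ‖f (k + 1) ω - f k ω‖ₑ := fun k =>
    ((hf (k + 1)).sub (hf k)).enorm
  have hfin : ∀ᵐ ω ∂μ, ∑' k, ‖f (k + 1) ω - f k ω‖ₑ < ∞ := by
    refine ae_lt_top (Measurable.tsum hm) (ne_top_of_le_ne_top hsum ?_)
    rw [lintegral_tsum fun k => (hm k).aemeasurable]
    exact ENNReal.tsum_le_tsum hd
  have hle : ∀ᵐ ω ∂μ, ‖limUnder atTop (fun k => f k ω) - f n ω‖ₑ ≤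
      ∑' k, ‖f (n + k + 1) ω - f (n + k) ω‖ₑ := by
    filter_upwards [hfin] with ω hω
    have he : ∀ k, edist (f k ω) (f k.succ ω) ≤ ‖f (k + 1) ω - f k ω‖ₑ := fun k => by
      rw [edist_comm, edist_eq_enorm_sub]
    have hc := (cauchySeq_of_edist_le_of_tsum_ne_top _ he hω.ne).tendsto_limUnder
    have := edist_le_tsum_of_edist_le_of_tendsto _ he hc n
    rwa [edist_comm, edist_eq_enorm_sub] at this
  refine (lintegral_mono_ae hle).trans ?_
  rw [lintegral_tsum fun k => (hm _).aemeasurable]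
  exact ENNReal.tsum_le_tsum fun k => hd (n + k)

/-! ### Distances between trajectories, uniqueness and convergence of the Picard scheme -/

section Solutions

variable {M P : ℕ} {T : TimeGrid P} {𝔐 : Params M P} {Ω : Type*} [mΩ : MeasurableSpace Ω]
  {μ : Measure Ω} {N : Fin M → Ω → Set (ℝ × ℝ)} {ξ : Fin P → ℤ → Ω → ℝ}
  {u u' u'' : Ω → Traj M P} {D D' D₁ D₂ : Fin M ⊕ Fin P → ℝ≥0∞}

theorem AdaptedTraj.measurable_lam (h : IsDrivingNoise T N ξ μ) (hu : AdaptedTraj T (filt T N ξ) u)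
    (m : Fin M) : Measurable fun z : Ω × ℝ => (u z.1).1 m z.2 :=
  ((hu.lam m).mono (predictable_le h.filt_le) le_rfl).comp measurable_swap

theorem AdaptedTraj.measurable_W (h : IsDrivingNoise T N ξ μ) (hu : AdaptedTraj T (filt T N ξ) u)
    (p : Fin P) (j : ℤ) : Measurable fun ω => (u ω).2 p j :=
  (hu.W p j).mono (h.filt_le _) le_rfl

theorem AdaptedTraj.measurable_lam_apply (h : IsDrivingNoise T N ξ μ)
    (hu : AdaptedTraj T (filt T N ξ) u) (m : Fin M) (s : ℝ) : Measurable fun ω => (u ω).1 m s :=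
  (hu.measurable_lam h m).comp measurable_prodMk_right

theorem lintegral_enorm_sub_le_add {f g k : Ω → ℝ} (hf : Measurable f) (hg : Measurable g) :
    ∫⁻ ω, ‖f ω - k ω‖ₑ ∂μ ≤ ∫⁻ ω, ‖f ω - g ω‖ₑ ∂μ + ∫⁻ ω, ‖g ω - k ω‖ₑ ∂μ := by
  rw [← lintegral_add_left (f := fun ω => ‖f ω - g ω‖ₑ) (hf.sub hg).enorm]
  refine lintegral_mono fun ω => ?_
  rw [← sub_add_sub_cancel (f ω) (g ω) (k ω)]
  exact enorm_add_le _ _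

theorem L1Near.symm (h : L1Near μ u u' D) : L1Near μ u' u D where
  lam m := (h.lam m).mono fun s hs => by simpa only [enorm_sub_rev] using hs
  W p j := by simpa only [enorm_sub_rev] using h.W p j

theorem L1Close.symm (h : L1Close μ u u' D) : L1Close μ u' u D where
  lam m s := by simpa only [enorm_sub_rev] using h.lam m s
  W p j := by simpa only [enorm_sub_rev] using h.W p j

theorem L1Near.trans (h : IsDrivingNoise T N ξ μ) (hu : AdaptedTraj T (filt T N ξ) u)
    (hu' : AdaptedTraj T (filt T N ξ) u') (h1 : L1Near μ u u' D) (h2 : L1Near μ u' u'' D') :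
    L1Near μ u u'' (D + D') where
  lam m := by
    filter_upwards [h1.lam m, h2.lam m] with s hs1 hs2
    exact (lintegral_enorm_sub_le_add (hu.measurable_lam_apply h m s)
      (hu'.measurable_lam_apply h m s)).trans (add_le_add hs1 hs2)
  W p j := (lintegral_enorm_sub_le_add (hu.measurable_W h p j) (hu'.measurable_W h p j)).trans
    (add_le_add (h1.W p j) (h2.W p j))

theorem L1Close.trans (h : IsDrivingNoise T N ξ μ) (hu : AdaptedTraj T (filt T N ξ) u)
    (hu' : AdaptedTraj T (filt T N ξ) u') (h1 : L1Close μ u u' D) (h2 : L1Close μ u' u'' D') :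
    L1Close μ u u'' (D + D') where
  lam m s := (lintegral_enorm_sub_le_add (hu.measurable_lam_apply h m s)
    (hu'.measurable_lam_apply h m s)).trans (add_le_add (h1.lam m s) (h2.lam m s))
  W p j := (lintegral_enorm_sub_le_add (hu.measurable_W h p j) (hu'.measurable_W h p j)).trans
    (add_le_add (h1.W p j) (h2.W p j))

/-- The random trajectory `u` is a fixed point of the HAR map, almost surely and for almost all
times in the case of the intensities. -/
structure Solves (T : TimeGrid P) (𝔐 : Params M P) (μ : Measure Ω) (η : Ω → NoiseSpace M P)
    (u : Ω → Traj M P) : Prop where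
  lam : ∀ m, ∀ᵐ s, ∀ᵐ ω ∂μ, (u ω).1 m s = (step T 𝔐 (η ω) (u ω)).1 m s
  W : ∀ p j, ∀ᵐ ω ∂μ, (u ω).2 p j = (step T 𝔐 (η ω) (u ω)).2 p j

theorem adaptedNoise_noiseOf (h : IsDrivingNoise T N ξ μ) :
    AdaptedNoise T (filt T N ξ) (noiseOf N ξ) := h.adaptedNoise

theorem ae_eq_of_lintegral_enorm_sub_le_zero {f g : Ω → ℝ} (hf : Measurable f) (hg : Measurable g)
    (h : ∫⁻ ω, ‖f ω - g ω‖ₑ ∂μ ≤ 0) : ∀ᵐ ω ∂μ, f ω = g ω := by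
  have := (lintegral_eq_zero_iff (hf.sub hg).enorm).1 (nonpos_iff_eq_zero.1 h)
  filter_upwards [this] with ω hω
  exact sub_eq_zero.1 (enorm_eq_zero.1 hω)

/-- A bound for the `L¹` norms of the first Picard iterate. -/
noncomputable def firstBound (T : TimeGrid P) (𝔐 : Params M P) (μ : Measure Ω)
    (ξ : Fin P → ℤ → Ω → ℝ) (α : Fin M ⊕ Fin P) : ℝ≥0∞ :=
  Sum.elim (fun m => ‖𝔐.link (Sum.inl m) (𝔐.base m)‖ₑ)
    (fun _ => ⨆ p, ⨆ j, ∫⁻ ω, ‖ξ p j ω‖ₑ ∂μ) α + lip (𝔐.link α) * driveBound T 𝔐 0 α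

theorem firstBound_ne_top (hH : ∀ α β, 𝔐.H T α β ≠ ∞) (hξ : FiMe ξ μ) (α : Fin M ⊕ Fin P) :
    firstBound T 𝔐 μ ξ α ≠ ∞ := by
  refine ENNReal.add_ne_top.2 ⟨?_, ENNReal.mul_ne_top ENNReal.coe_ne_top
    (driveBound_ne_top hH (fun _ => by simp) α)⟩
  rcases α with m | p
  · exact enorm_ne_top
  · exact LT.lt.ne hξ

/-- A bound for the `L¹` distance between the `n`-th Picard iterate and the limit. -/
noncomputable def tailBound (T : TimeGrid P) (𝔐 : Params M P) (μ : Measure Ω)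
    (ξ : Fin P → ℤ → Ω → ℝ) (n : ℕ) (α : Fin M ⊕ Fin P) : ℝ≥0∞ :=
  ∑' k, ((𝔐.H T).mulVec^[n + k] (firstBound T 𝔐 μ ξ)) α

theorem tailBound_zero_ne_top (hspec : 𝔐.Spec T) (hξ : FiMe ξ μ) (α : Fin M ⊕ Fin P) :
    tailBound T 𝔐 μ ξ 0 α ≠ ∞ := by
  simpa [tailBound] using tsum_iterate_mulVec_ne_top _ hspec.1 hspec.2 _
    (firstBound_ne_top hspec.1 hξ) α

theorem tendsto_tailBound (hspec : 𝔐.Spec T) (hξ : FiMe ξ μ) (α : Fin M ⊕ Fin P) :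
    Tendsto (fun n => tailBound T 𝔐 μ ξ n α) atTop (𝓝 0) := by
  have := ENNReal.tendsto_sum_nat_add (fun k => ((𝔐.H T).mulVec^[k] (firstBound T 𝔐 μ ξ)) α)
    (tsum_iterate_mulVec_ne_top _ hspec.1 hspec.2 _ (firstBound_ne_top hspec.1 hξ) α)
  simpa only [tailBound, add_comm] using this

variable [IsProbabilityMeasure μ]

/-- Each solution is its own image under `step`, so the contraction estimate applies to the pair
itself. -/
theorem Solves.l1Near_mulVec (h : IsDrivingNoise T N ξ μ) (hH : ∀ α β, 𝔐.H T α β ≠ ∞)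
    (hu : AdaptedTraj T (filt T N ξ) u) (hu' : AdaptedTraj T (filt T N ξ) u')
    (hs : Solves T 𝔐 μ (noiseOf N ξ) u) (hs' : Solves T 𝔐 μ (noiseOf N ξ) u')
    (hD₁ : L1Near μ u (fun _ => 0) D₁) (hfin₁ : ∀ α, D₁ α ≠ ∞)
    (hD₂ : L1Near μ u' (fun _ => 0) D₂) (hfin₂ : ∀ α, D₂ α ≠ ∞) (hD : L1Near μ u u' D) :
    L1Near μ u u' ((𝔐.H T).mulVec D) := by
  have hstep := L1Near.step h hH hu hu' hD₁ hfin₁ hD₂ hfin₂ hD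
  refine ⟨fun m => ?_, fun p j => ?_⟩
  · filter_upwards [hs.lam m, hs'.lam m] with s h1 h2
    refine le_trans (le_of_eq (lintegral_congr_ae ?_)) (hstep.lam m s)
    filter_upwards [h1, h2] with ω h3 h4
    rw [h3, h4]
  · refine le_trans (le_of_eq (lintegral_congr_ae ?_)) (hstep.W p j)
    filter_upwards [hs.W p j, hs'.W p j] with ω h3 h4
    rw [h3, h4]

theorem Solves.l1Near_zero (h : IsDrivingNoise T N ξ μ) (hspec : 𝔐.Spec T)
    (hu : AdaptedTraj T (filt T N ξ) u) (hu' : AdaptedTraj T (filt T N ξ) u')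
    (hs : Solves T 𝔐 μ (noiseOf N ξ) u) (hs' : Solves T 𝔐 μ (noiseOf N ξ) u')
    (hD₁ : L1Near μ u (fun _ => 0) D₁) (hfin₁ : ∀ α, D₁ α ≠ ∞)
    (hD₂ : L1Near μ u' (fun _ => 0) D₂) (hfin₂ : ∀ α, D₂ α ≠ ∞) :
    L1Near μ u u' 0 := by
  have hzero : AdaptedTraj T (filt T N ξ) fun _ : Ω => (0 : Traj M P) :=
    ⟨fun m => measurable_const, fun p j => measurable_const⟩
  have hk : ∀ k : ℕ, L1Near μ u u' ((𝔐.H T).mulVec^[k] (D₁ + D₂)) := by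
    intro k
    induction k with
    -- The starting bound is the triangle inequality through the zero trajectory.
    | zero => exact hD₁.trans h hu hzero hD₂.symm
    | succ k ih =>
      rw [Function.iterate_succ_apply']
      exact hs.l1Near_mulVec h hspec.1 hu hu' hs' hD₁ hfin₁ hD₂ hfin₂ ih
  have hlim : ∀ α, Tendsto (fun k => ((𝔐.H T).mulVec^[k] (D₁ + D₂)) α) atTop (𝓝 0) := fun α =>
    ENNReal.tendsto_atTop_zero_of_tsum_ne_top (tsum_iterate_mulVec_ne_top _ hspec.1 hspec.2 _
      (fun β => ENNReal.add_ne_top.2 ⟨hfin₁ β, hfin₂ β⟩) α)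
  refine ⟨fun m => ?_, fun p j => ge_of_tendsto' (hlim _) fun k => (hk k).W p j⟩
  -- The exceptional times depend on `k`, but a countable union of null sets is null.
  filter_upwards [ae_all_iff.2 fun k => (hk k).lam m] with s hs
  exact ge_of_tendsto' (hlim _) hs

/-! ### Existence -/

theorem lintegral_link_le (h : IsDrivingNoise T N ξ μ) (hu : AdaptedTraj T (filt T N ξ) u)
    (hD : L1Near μ u (fun _ => 0) D) (α : Fin M ⊕ Fin P) (t c : ℝ) :
    ∫⁻ ω, ‖𝔐.link α (c + driveOf T 𝔐 (fun m => thin (cnt (N m ω)) ((u ω).1 m)) (u ω).2 α t)‖ₑ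
      ∂μ ≤ ‖𝔐.link α c‖ₑ + lip (𝔐.link α) * driveBound T 𝔐 D α := by
  have hb : ∀ x, ‖𝔐.link α (c + x)‖ₑ ≤ ‖𝔐.link α c‖ₑ + lip (𝔐.link α) * ‖x‖ₑ := by
    intro x
    have h1 := LipschitzWith.enorm_sub_le_real (𝔐.lipschitzWith_link α) (c + x) c
    rw [add_sub_cancel_left] at h1
    refine le_trans ?_ (add_le_add_right h1 _)
    refine le_trans (le_of_eq ?_) (enorm_add_le _ _)
    rw [add_sub_cancel]
  refine (lintegral_mono fun ω => (hb _).trans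
    (add_le_add_right (mul_le_mul_right enorm_driveOf_le _) _)).trans ?_
  rw [lintegral_add_left measurable_const, lintegral_const_mul' _ _ ENNReal.coe_ne_top]
  simp only [lintegral_const, measure_univ, mul_one]
  exact add_le_add_right (mul_le_mul_right (lintegral_absDrive_le h hu hD α t) _) _

theorem l1Close_first (h : IsDrivingNoise T N ξ μ) :
    L1Close μ (fun ω => iter T 𝔐 (noiseOf N ξ ω) 1) (fun _ => 0) (firstBound T 𝔐 μ ξ) := by
  have hzero : AdaptedTraj T (filt T N ξ) fun _ : Ω => (0 : Traj M P) :=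
    ⟨fun m => measurable_const, fun p j => measurable_const⟩
  have hnear : L1Near μ (fun _ : Ω => (0 : Traj M P)) (fun _ => 0) 0 :=
    ⟨fun m => by simp, fun p j => by simp⟩
  refine ⟨fun m s => ?_, fun p j => ?_⟩
  · refine le_trans (le_of_eq (lintegral_congr fun ω => ?_))
      (lintegral_link_le h hzero hnear (Sum.inl m) s (𝔐.base m))
    simp only [Prod.fst_zero, Pi.zero_apply, sub_zero]
    rfl
  · have h1 := lintegral_link_le (𝔐 := 𝔐) h hzero hnear (Sum.inr p) (T.time p j) 0
    -- As `Φ^p(0) = 0`, only the drift and the drive contribute.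
    rw [𝔐.link_chain_zero, enorm_zero, zero_add] at h1
    simp only [zero_add] at h1
    have hξ : ∫⁻ ω, ‖ξ p j ω‖ₑ ∂μ ≤ ⨆ p, ⨆ j, ∫⁻ ω, ‖ξ p j ω‖ₑ ∂μ :=
      le_iSup₂ (f := fun p j => ∫⁻ ω, ‖ξ p j ω‖ₑ ∂μ) p j
    refine le_trans ?_ (add_le_add hξ h1)
    rw [← lintegral_add_left (h.drift_measurable p j).enorm]
    refine lintegral_mono fun ω => ?_
    simp only [Prod.snd_zero, Pi.zero_apply, sub_zero]
    exact enorm_add_le _ _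

/-- The finite bound, which may depend on `n`, is carried along because the contraction estimate
requires both trajectories to be bounded in L¹. -/
theorem l1Close_iter (h : IsDrivingNoise T N ξ μ) (hH : ∀ α β, 𝔐.H T α β ≠ ∞) (hξ : FiMe ξ μ)
    (n : ℕ) :
    (∃ D, (∀ α, D α ≠ ∞) ∧ L1Close μ (fun ω => iter T 𝔐 (noiseOf N ξ ω) n) (fun _ => 0) D) ∧
    L1Close μ (fun ω => iter T 𝔐 (noiseOf N ξ ω) (n + 1)) (fun ω => iter T 𝔐 (noiseOf N ξ ω) n)
      ((𝔐.H T).mulVec^[n] (firstBound T 𝔐 μ ξ)) := by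
  have hη := adaptedNoise_noiseOf h
  have hfin : ∀ k α, ((𝔐.H T).mulVec^[k] (firstBound T 𝔐 μ ξ)) α ≠ ∞ := by
    intro k
    induction k with
    | zero => exact firstBound_ne_top hH hξ
    | succ k ih =>
      intro α
      rw [Function.iterate_succ_apply']
      exact ENNReal.sum_ne_top (s := Finset.univ).2 fun β _ => ENNReal.mul_ne_top (hH α β) (ih β)
  induction n with
  | zero => exact ⟨⟨0, fun _ => by simp, fun m s => by simp [iter], fun p j => by simp [iter]⟩,
      l1Close_first h⟩
  | succ n ih =>
    obtain ⟨⟨D, hDfin, hD⟩, hn⟩ := ih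
    have hD' := hn.trans h (hη.iter 𝔐 (n + 1)) (hη.iter 𝔐 n) hD
    have hDfin' : ∀ α, ((𝔐.H T).mulVec^[n] (firstBound T 𝔐 μ ξ) + D) α ≠ ∞ := fun α =>
      ENNReal.add_ne_top.2 ⟨hfin n α, hDfin α⟩
    refine ⟨⟨_, hDfin', hD'⟩, ?_⟩
    have := L1Near.step h hH (hη.iter 𝔐 (n + 1)) (hη.iter 𝔐 n) hD'.near hDfin' hD.near hDfin
      hn.near
    rw [Function.iterate_succ_apply']
    simpa only [iter_succ] using this

theorem l1Close_iterLim (h : IsDrivingNoise T N ξ μ) (hspec : 𝔐.Spec T) (hξ : FiMe ξ μ) (n : ℕ) :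
    L1Close μ (fun ω => iterLim T 𝔐 (noiseOf N ξ ω)) (fun ω => iter T 𝔐 (noiseOf N ξ ω) n)
      (tailBound T 𝔐 μ ξ n) where
  lam m s := lintegral_limUnder_sub_le
    (fun k => ((adaptedNoise_noiseOf h).iter 𝔐 k).measurable_lam_apply h m s)
    (fun k => (l1Close_iter h hspec.1 hξ k).2.lam m s)
    (tsum_iterate_mulVec_ne_top _ hspec.1 hspec.2 _ (firstBound_ne_top hspec.1 hξ) _) n
  W p j := lintegral_limUnder_sub_le
    (fun k => ((adaptedNoise_noiseOf h).iter 𝔐 k).measurable_W h p j)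
    (fun k => (l1Close_iter h hspec.1 hξ k).2.W p j)
    (tsum_iterate_mulVec_ne_top _ hspec.1 hspec.2 _ (firstBound_ne_top hspec.1 hξ) _) n

theorem l1Close_iterLim_zero (h : IsDrivingNoise T N ξ μ) (hspec : 𝔐.Spec T) (hξ : FiMe ξ μ) :
    L1Close μ (fun ω => iterLim T 𝔐 (noiseOf N ξ ω)) (fun _ => 0) (tailBound T 𝔐 μ ξ 0) :=
  l1Close_iterLim h hspec hξ 0

/-- Inserting the iterate `n + 1`, which is the image of the iterate `n`, bounds the distance by the
tail at `n + 1` plus `H` times the tail at `n`; both tend to zero. -/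
theorem l1Close_iterLim_step (h : IsDrivingNoise T N ξ μ) (hspec : 𝔐.Spec T) (hξ : FiMe ξ μ) :
    L1Close μ (fun ω => iterLim T 𝔐 (noiseOf N ξ ω))
      (fun ω => step T 𝔐 (noiseOf N ξ ω) (iterLim T 𝔐 (noiseOf N ξ ω))) 0 := by
  have hη := adaptedNoise_noiseOf h
  have hlim := hη.iterLim 𝔐
  have hn : ∀ n, L1Close μ (fun ω => iterLim T 𝔐 (noiseOf N ξ ω))
      (fun ω => step T 𝔐 (noiseOf N ξ ω) (iterLim T 𝔐 (noiseOf N ξ ω)))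
      (tailBound T 𝔐 μ ξ (n + 1) + (𝔐.H T).mulVec (tailBound T 𝔐 μ ξ n)) := by
    intro n
    obtain ⟨⟨D, hDfin, hD⟩, -⟩ := l1Close_iter h hspec.1 hξ n
    refine (l1Close_iterLim h hspec hξ (n + 1)).trans h hlim (hη.iter 𝔐 (n + 1)) ?_
    simp only [iter_succ]
    exact L1Near.step h hspec.1 (hη.iter 𝔐 n) hlim hD.near hDfin
      (l1Close_iterLim_zero h hspec hξ).near (tailBound_zero_ne_top hspec hξ)
      (l1Close_iterLim h hspec hξ n).symm.near
  have ht : ∀ α, Tendsto (fun n => (tailBound T 𝔐 μ ξ (n + 1) +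
      (𝔐.H T).mulVec (tailBound T 𝔐 μ ξ n)) α) atTop (𝓝 0) := by
    intro α
    have h1 := (tendsto_tailBound hspec hξ α).comp (tendsto_add_atTop_nat 1)
    have h2 : Tendsto (fun n => (𝔐.H T).mulVec (tailBound T 𝔐 μ ξ n) α) atTop
        (𝓝 (∑ β, 𝔐.H T α β * 0)) :=
      tendsto_finsetSum _ fun β _ => ENNReal.Tendsto.const_mul (tendsto_tailBound hspec hξ β)
        (Or.inr (hspec.1 α β))
    simpa using h1.add h2
  exact ⟨fun m s => ge_of_tendsto' (ht _) fun n => (hn n).lam m s,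
    fun p j => ge_of_tendsto' (ht _) fun n => (hn n).W p j⟩

theorem iterLim_lam_eq (h : IsDrivingNoise T N ξ μ) (hspec : 𝔐.Spec T) (hξ : FiMe ξ μ) (m : Fin M)
    (s : ℝ) : ∀ᵐ ω ∂μ, (iterLim T 𝔐 (noiseOf N ξ ω)).1 m s =
      (step T 𝔐 (noiseOf N ξ ω) (iterLim T 𝔐 (noiseOf N ξ ω))).1 m s :=
  have hη := adaptedNoise_noiseOf h
  ae_eq_of_lintegral_enorm_sub_le_zero ((hη.iterLim 𝔐).measurable_lam_apply h m s)
    (((hη.iterLim 𝔐).step 𝔐 hη).measurable_lam_apply h m s)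
    ((l1Close_iterLim_step h hspec hξ).lam m s)

theorem iterLim_W_eq (h : IsDrivingNoise T N ξ μ) (hspec : 𝔐.Spec T) (hξ : FiMe ξ μ) (p : Fin P)
    (j : ℤ) : ∀ᵐ ω ∂μ, (iterLim T 𝔐 (noiseOf N ξ ω)).2 p j =
      (step T 𝔐 (noiseOf N ξ ω) (iterLim T 𝔐 (noiseOf N ξ ω))).2 p j :=
  have hη := adaptedNoise_noiseOf h
  ae_eq_of_lintegral_enorm_sub_le_zero ((hη.iterLim 𝔐).measurable_W h p j)
    (((hη.iterLim 𝔐).step 𝔐 hη).measurable_W h p j)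
    ((l1Close_iterLim_step h hspec hξ).W p j)

end Solutions

/-! ### Invariance of the law of the noise under the time shift -/

theorem measurePreserving_shiftPlane : MeasurePreserving shiftPlane
    (volume.restrict {z : ℝ × ℝ | 0 ≤ z.2}) (volume.restrict {z : ℝ × ℝ | 0 ≤ z.2}) := by
  have h : MeasurePreserving shiftPlane (volume : Measure (ℝ × ℝ)) volume :=
    (measurePreserving_sub_right volume (1 : ℝ)).prod (MeasurePreserving.id volume)
  exact h.restrict_preimage_emb shiftPlane.measurableEmbedding {z : ℝ × ℝ | 0 ≤ z.2}

theorem cnt_image_equiv {α : Type*} [MeasurableSpace α] [MeasurableSingletonClass α] (e : α ≃ᵐ α)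
    (A : Set α) : cnt (e '' A) = (cnt A).map e := by
  ext B hB
  rw [Measure.map_apply e.measurable hB, cnt, cnt, Measure.restrict_apply hB,
    Measure.restrict_apply (e.measurable hB),
    ← Measure.count_injective_image e.injective (e ⁻¹' B ∩ A), image_preimage_inter]

theorem IsPoissonRandomMeasure.shift {Ω : Type*} [MeasurableSpace Ω] {μ : Measure Ω}
    {N : Ω → Set (ℝ × ℝ)}
    (h : IsPoissonRandomMeasure N (volume.restrict {z : ℝ × ℝ | 0 ≤ z.2}) μ) :
    IsPoissonRandomMeasure (fun ω => shiftPlane '' N ω)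
      (volume.restrict {z : ℝ × ℝ | 0 ≤ z.2}) μ := by
  have hB : ∀ B, MeasurableSet B → ∀ ω, cnt (shiftPlane '' N ω) B = cnt (N ω) (shiftPlane ⁻¹' B) :=
    fun B hB ω => by rw [cnt_image_equiv, Measure.map_apply shiftPlane.measurable hB]
  refine ⟨fun ω K hK => ?_, ?_, fun B hBm hν => ?_, fun n B hBm hd => ?_⟩
  · have hc : Continuous shiftPlane.symm := by
      change Continuous fun z : ℝ × ℝ => (z.1 + 1, z.2)
      fun_prop
    have := (h.locallyFinite ω _ (hK.image hc)).image shiftPlane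
    refine this.subset ?_
    rintro _ ⟨⟨z, hz, rfl⟩, hzK⟩
    exact ⟨z, ⟨hz, shiftPlane z, hzK, shiftPlane.symm_apply_apply z⟩, rfl⟩
  · simp_rw [cnt_image_equiv]
    exact (Measure.measurable_map _ shiftPlane.measurable).comp h.measurable
  · simp_rw [hB B hBm]
    have hp := measurePreserving_shiftPlane.measure_preimage hBm.nullMeasurableSet
    rw [← hp]
    exact h.law _ (shiftPlane.measurable hBm) (by rwa [hp])
  · simp_rw [fun i => hB (B i) (hBm i)]
    exact h.indep n _ (fun i => shiftPlane.measurable (hBm i))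
      fun i j hij => (hd hij).preimage _

section NoiseLaw

variable {M P : ℕ} {T : TimeGrid P} {Ω : Type*} [mΩ : MeasurableSpace Ω] {μ : Measure Ω}
  {N : Fin M → Ω → Set (ℝ × ℝ)} {ξ : Fin P → ℤ → Ω → ℝ}

theorem comap_pi_eq_iSup {Ω ι : Type*} {E : ι → Type*} [∀ i, MeasurableSpace (E i)]
    (f : ∀ i, Ω → E i) : MeasurableSpace.comap (fun ω i => f i ω) MeasurableSpace.pi =
      ⨆ i, MeasurableSpace.comap (f i) inferInstance := by
  simp_rw [MeasurableSpace.pi, MeasurableSpace.comap_iSup, MeasurableSpace.comap_comp]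
  rfl

theorem IsDrivingNoise.iIndepFun_cnt (h : IsDrivingNoise T N ξ μ) :
    iIndepFun (fun m ω => cnt (N m ω)) μ :=
  h.indep.precomp Sum.inl_injective

theorem IsDrivingNoise.iIndepFun_drift (h : IsDrivingNoise T N ξ μ) :
    iIndepFun (fun (q : Fin P × ℤ) ω => ξ q.1 q.2 ω) μ :=
  h.indep.precomp Sum.inr_injective

theorem IsDrivingNoise.indepFun_cnt_drift (h : IsDrivingNoise T N ξ μ) :
    IndepFun (fun ω m => cnt (N m ω)) (fun ω (q : Fin P × ℤ) => ξ q.1 q.2 ω) μ := by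
  have h1 := indep_iSup_of_disjoint h.family_le h.indep
    (isCompl_range_inl_range_inr (α := Fin M) (β := Fin P × ℤ)).disjoint
  simp_rw [iSup_range] at h1
  rw [IndepFun_iff_Indep, comap_pi_eq_iSup, comap_pi_eq_iSup]
  exact h1

theorem measurable_noiseOf (h : IsDrivingNoise T N ξ μ) : Measurable (noiseOf N ξ) :=
  (measurable_pi_lambda _ fun m => (h.poisson m).measurable).prodMk
    (measurable_pi_lambda _ fun p => measurable_pi_lambda _ fun j => h.drift_measurable p j)

theorem measurable_shiftNoise : Measurable (shiftNoise T : NoiseSpace M P → NoiseSpace M P) := by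
  have hs : Measurable fun z : ℝ × ℝ => (z.1 - 1, z.2) := by fun_prop
  refine (measurable_pi_lambda _ fun m => ?_).prodMk
    (measurable_pi_lambda _ fun p => measurable_pi_lambda _ fun j => by fun_prop)
  exact (Measure.measurable_map _ hs).comp ((measurable_pi_apply m).comp measurable_fst)

/-- Each shifted Poisson measure is again Poisson with the same intensity, hence has the same law,
and the drifts are periodic in law. Independence, preserved because the index shift is injective,
extends this to the joint law. -/
theorem identDistrib_noiseOf [IsProbabilityMeasure μ] (h : IsDrivingNoise T N ξ μ) :
    IdentDistrib (noiseOf N ξ) (fun ω => shiftNoise T (noiseOf N ξ ω)) μ μ := by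
  have hs : ∀ m ω, cnt (shiftPlane '' N m ω) = (cnt (N m ω)).map shiftPlane := fun m ω =>
    cnt_image_equiv _ _
  have hmap : Measurable fun ρ : Measure (ℝ × ℝ) => ρ.map shiftPlane :=
    Measure.measurable_map _ shiftPlane.measurable
  have h1 : IdentDistrib (fun ω m => cnt (N m ω)) (fun ω m => (cnt (N m ω)).map shiftPlane) μ μ := by
    refine IdentDistrib.pi (X := fun m ω => cnt (N m ω))
      (Y := fun m ω => (cnt (N m ω)).map shiftPlane) (fun m => ?_) h.iIndepFun_cnt
      (h.iIndepFun_cnt.comp (fun _ ρ => ρ.map shiftPlane) fun _ => hmap)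
    simp_rw [← hs]
    exact (h.poisson m).identDistrib (h.poisson m).shift box measurableSet_box box_mono iUnion_box
      fun n => ne_top_of_le_ne_top (isCompact_box n).measure_lt_top.ne (Measure.restrict_apply_le _ _)
  have h2 : IdentDistrib (fun ω (q : Fin P × ℤ) => ξ q.1 q.2 ω)
      (fun ω (q : Fin P × ℤ) => ξ q.1 (q.2 + (T.freq q.1 : ℤ)) ω) μ μ := by
    refine IdentDistrib.pi (X := fun (q : Fin P × ℤ) ω => ξ q.1 q.2 ω)
      (Y := fun (q : Fin P × ℤ) ω => ξ q.1 (q.2 + (T.freq q.1 : ℤ)) ω)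
      (fun q => by simpa using h.drift_periodic q.1 q.2 1) h.iIndepFun_drift ?_
    refine h.iIndepFun_drift.precomp (g := fun q : Fin P × ℤ => (q.1, q.2 + (T.freq q.1 : ℤ))) ?_
    rintro ⟨p, j⟩ ⟨p', j'⟩ hpq
    simp only [Prod.mk.injEq] at hpq
    obtain ⟨rfl, hj⟩ := hpq
    simpa using hj
  have h3 := h.indepFun_cnt_drift.comp
    (φ := fun (ρ : Fin M → Measure (ℝ × ℝ)) m => (ρ m).map shiftPlane)
    (ψ := fun (x : Fin P × ℤ → ℝ) (q : Fin P × ℤ) => x (q.1, q.2 + (T.freq q.1 : ℤ)))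
    (measurable_pi_lambda _ fun m => hmap.comp (measurable_pi_apply m))
    (measurable_pi_lambda _ fun q => measurable_pi_apply _)
  have h4 := h1.prodMk h2 h.indepFun_cnt_drift h3
  have hcurry : Measurable fun y : (Fin M → Measure (ℝ × ℝ)) × (Fin P × ℤ → ℝ) =>
      ((y.1, fun p j => y.2 (p, j)) : NoiseSpace M P) := by
    refine measurable_fst.prodMk (measurable_pi_lambda _ fun p => measurable_pi_lambda _ fun j => ?_)
    fun_prop
  exact h4.comp hcurry

/-! ### The solution as a function of the noise -/

/-- The realizations of the noise with locally finite point measures. -/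
def GoodNoise (M P : ℕ) : Set (NoiseSpace M P) := {η | ∀ m, BoxFinite (η.1 m)}

theorem IsDrivingNoise.noiseOf_mem (h : IsDrivingNoise T N ξ μ) (ω : Ω) :
    noiseOf N ξ ω ∈ GoodNoise M P := fun m => h.boxFinite m ω

theorem shiftNoise_mem {η : NoiseSpace M P} (h : η ∈ GoodNoise M P) :
    shiftNoise T η ∈ GoodNoise M P := by
  intro m n
  have hs : Measurable fun z : ℝ × ℝ => (z.1 - 1, z.2) := by fun_prop
  change (η.1 m).map (fun z : ℝ × ℝ => (z.1 - 1, z.2)) (box n) ≠ ∞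
  rw [Measure.map_apply hs (measurableSet_box n)]
  refine ne_top_of_le_ne_top (h m (n + 1)) (measure_mono ?_)
  rintro z ⟨⟨h1, h2⟩, h3, h4⟩
  simp only at h1 h2 h3 h4
  refine ⟨⟨?_, ?_⟩, ?_, ?_⟩ <;> push_cast <;> linarith

/-- For a constant family of σ-algebras adaptedness is plain measurability, so the results on
adapted trajectories show that the solution is a measurable function of the noise. -/
theorem adaptedNoise_goodNoise (T : TimeGrid P) : AdaptedNoise T
    (fun _ => (inferInstance : MeasurableSpace (GoodNoise M P))) fun η => η.1 where
  mono := fun _ _ _ => le_rfl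
  boxFinite m η := η.2 m
  measurable_restrict m t := (measurable_restrict_measure (measurableSet_past t)).comp
    ((measurable_pi_apply m).comp (measurable_fst.comp measurable_subtype_coe))
  measurable_drift p j := (measurable_pi_apply j).comp
    ((measurable_pi_apply p).comp (measurable_snd.comp measurable_subtype_coe))

/-- The intensities, point measures and chains of the limit of the Picard iterates. -/
noncomputable def solutionPath (T : TimeGrid P) (𝔐 : Params M P) (η : NoiseSpace M P) :
    (Fin M → ℝ → ℝ) × (Fin M → Measure ℝ) × (Fin P → ℤ → ℝ) :=
  ((iterLim T 𝔐 η).1, fun m => thin (η.1 m) ((iterLim T 𝔐 η).1 m), (iterLim T 𝔐 η).2)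

theorem AdaptedTraj.measurable_path {A : Type*} [mA : MeasurableSpace A]
    {u : A → Traj M P} (hu : AdaptedTraj T (fun _ => mA) u) {ρ : A → Fin M → Measure (ℝ × ℝ)}
    (hρ : Measurable ρ) (hb : ∀ m a, BoxFinite (ρ a m)) :
    Measurable fun a => ((u a).1, (fun m => thin (ρ a m) ((u a).1 m)), (u a).2) := by
  have hlam : ∀ m, Measurable fun z : A × ℝ => (u z.1).1 m z.2 := fun m =>
    ((hu.lam m).mono (predictable_le (mΩ := mA) fun _ => le_refl mA) le_rfl).comp measurable_swap
  refine Measurable.prodMk (measurable_pi_lambda _ fun m => measurable_pi_lambda _ fun t =>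
    (hlam m).comp measurable_prodMk_right) (Measurable.prodMk (measurable_pi_lambda _ fun m => ?_)
    (measurable_pi_lambda _ fun p => measurable_pi_lambda _ fun j => hu.W p j))
  exact measurable_thin ((measurable_pi_apply m).comp hρ) (hb m) (hlam m)

theorem measurable_solutionPath (T : TimeGrid P) (𝔐 : Params M P) :
    Measurable fun η : GoodNoise M P => solutionPath T 𝔐 η.1 :=
  ((adaptedNoise_goodNoise T).iterLim 𝔐).measurable_path
    (ρ := fun η : GoodNoise M P => η.1.1)
    (measurable_fst.comp measurable_subtype_coe) fun m η => η.2 m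

/-- The measurable sets of `s` are traces of measurable sets of `γ`, so `s` itself need not be
measurable. -/
theorem identDistrib_codRestrict {α β γ : Type*} [MeasurableSpace α] [MeasurableSpace β]
    [MeasurableSpace γ] {μ : Measure α} {ν : Measure β} {f : α → γ} {g : β → γ} {s : Set γ}
    (hf : Measurable f) (hg : Measurable g) (h : IdentDistrib f g μ ν) (hfs : ∀ a, f a ∈ s)
    (hgs : ∀ b, g b ∈ s) :
    IdentDistrib (fun a => (⟨f a, hfs a⟩ : s)) (fun b => (⟨g b, hgs b⟩ : s)) μ ν where
  aemeasurable_fst := (hf.subtype_mk).aemeasurable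
  aemeasurable_snd := (hg.subtype_mk).aemeasurable
  map_eq := by
    ext t ht
    obtain ⟨t', ht', rfl⟩ := ht
    rw [Measure.map_apply hf.subtype_mk (measurable_subtype_coe ht'),
      Measure.map_apply hg.subtype_mk (measurable_subtype_coe ht')]
    have := congrArg (fun ρ => ρ t') h.map_eq
    simp only [Measure.map_apply hf ht', Measure.map_apply hg ht'] at this
    exact this

theorem identDistrib_solutionPath [IsProbabilityMeasure μ] (h : IsDrivingNoise T N ξ μ)
    (𝔐 : Params M P) : IdentDistrib (fun ω => solutionPath T 𝔐 (noiseOf N ξ ω))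
      (fun ω => solutionPath T 𝔐 (shiftNoise T (noiseOf N ξ ω))) μ μ :=
  (identDistrib_codRestrict (measurable_noiseOf h) (measurable_shiftNoise.comp
    (measurable_noiseOf h)) (identDistrib_noiseOf h) h.noiseOf_mem
    (fun ω => shiftNoise_mem (h.noiseOf_mem ω))).comp
      (measurable_solutionPath T 𝔐)

end NoiseLaw

/-! ### Projections of point sets in the plane -/

/-- The times of the points of `A` that lie below the graph of `l`. -/
def timesBelow (A : Set (ℝ × ℝ)) (l : ℝ → ℝ) : Set ℝ := {s | ∃ x, (s, x) ∈ A ∧ x ≤ l s}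

theorem timesBelow_inter (A : Set (ℝ × ℝ)) (l : ℝ → ℝ) (C : Set ℝ) :
    timesBelow A l ∩ C = Prod.fst '' {z ∈ A | z.1 ∈ C ∧ z.2 ≤ l z.1} := by
  ext s
  constructor
  · rintro ⟨⟨x, hx, hl⟩, hC⟩
    exact ⟨(s, x), ⟨hx, hC, hl⟩, rfl⟩
  · rintro ⟨⟨s, x⟩, ⟨hx, hC, hl⟩, rfl⟩
    exact ⟨⟨x, hx, hl⟩, hC⟩

theorem encard_timesBelow_inter {A : Set (ℝ × ℝ)} (hA : InjOn Prod.fst A) (l : ℝ → ℝ)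
    (C : Set ℝ) : (timesBelow A l ∩ C).encard = {z ∈ A | z.1 ∈ C ∧ z.2 ≤ l z.1}.encard := by
  rw [timesBelow_inter]
  exact (hA.mono (sep_subset _ _)).encard_image

/-- Testing the counts on singletons determines the set. -/
theorem eq_timesBelow {A : Set (ℝ × ℝ)} (hA : InjOn Prod.fst A) {l : ℝ → ℝ} {S : Set ℝ}
    (h : ∀ C : Set ℝ, (S ∩ C).encard = {z ∈ A | z.1 ∈ C ∧ z.2 ≤ l z.1}.encard) :
    S = timesBelow A l := by
  ext s
  have hmem : ∀ B : Set ℝ, s ∈ B ↔ (B ∩ {s}).encard ≠ 0 := fun B => by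
    rw [encard_ne_zero, inter_singleton_nonempty]
  rw [hmem, hmem, h, encard_timesBelow_inter hA]

/-- Distinct atoms have distinct times, so projecting loses no points; countability makes the sets
measurable, so that their counting measure is their cardinality. -/
theorem cnt_timesBelow {A : Set (ℝ × ℝ)} (hc : A.Countable) (hA : InjOn Prod.fst A)
    (l : ℝ → ℝ) : cnt (timesBelow A l) = thin (cnt A) l := by
  have himage : ∀ C, timesBelow A l ∩ C = Prod.fst '' {z ∈ A | z.1 ∈ C ∧ z.2 ≤ l z.1} :=
    timesBelow_inter A l
  ext C hC
  have h1 : (timesBelow A l ∩ C).Countable :=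
    himage C ▸ ((hc.mono (sep_subset _ _)).image _)
  have h2 : {z | z.1 ∈ C ∧ z.2 ≤ l z.1} ∩ A = {z ∈ A | z.1 ∈ C ∧ z.2 ≤ l z.1} := inter_comm _ _
  rw [thin_apply _ l hC, cnt, cnt, Measure.restrict_apply hC,
    Measure.restrict_apply' hc.measurableSet, h2, inter_comm, Measure.count_apply h1.measurableSet,
    Measure.count_apply (hc.mono (sep_subset _ _)).measurableSet, encard_timesBelow_inter hA]

theorem forall_mem_of_ae_cnt {α : Type*} [MeasurableSpace α] [MeasurableSingletonClass α]
    {A : Set α} {p : α → Prop} (h : ∀ᵐ z ∂cnt A, p z) : ∀ z ∈ A, p z := by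
  intro z hz
  by_contra hp
  have h0 : cnt A {z} = 0 := measure_mono_null (by simpa using hp) (ae_iff.1 h)
  rw [cnt, Measure.restrict_apply (measurableSet_singleton z), inter_eq_left.2 (by simpa using hz),
    Measure.count_singleton] at h0
  exact one_ne_zero h0

theorem ae_prod_of_ae_ae {Ω : Type*} [MeasurableSpace Ω] {μ : Measure Ω} [SFinite μ]
    {p : Ω × ℝ → Prop} (hp : MeasurableSet {z | p z}) (h : ∀ᵐ t, ∀ᵐ ω ∂μ, p (ω, t)) :
    ∀ᵐ z ∂μ.prod volume, p z :=
  (Measure.ae_prod_mem_iff_ae_ae_mem hp).2 ((Measure.ae_ae_comm hp).2 h)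

/-! ### The stationary HAR process and its uniqueness -/

section Solution

variable {M P : ℕ} {T : TimeGrid P} {𝔐 : Params M P} {Ω : Type*} [mΩ : MeasurableSpace Ω]
  {μ : Measure Ω} {N : Fin M → Ω → Set (ℝ × ℝ)} {ξ : Fin P → ℤ → Ω → ℝ}

theorem IsDrivingNoise.injOn_fst (h : IsDrivingNoise T N ξ μ) (m : Fin M) (ω : Ω) :
    InjOn Prod.fst (N m ω) := fun z hz z' hz' hzz' => (h.distinct ω m m z hz z' hz' hzz').2

theorem IsDrivingNoise.countable (h : IsDrivingNoise T N ξ μ) (m : Fin M) (ω : Ω) :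
    (N m ω).Countable := by
  rw [← inter_univ (N m ω), ← iUnion_box, inter_iUnion]
  exact countable_iUnion fun n =>
    ((h.poisson m).locallyFinite ω _ (isCompact_box n)).countable

theorem IsDrivingNoise.cnt_timesBelow (h : IsDrivingNoise T N ξ μ) (m : Fin M) (ω : Ω)
    (l : ℝ → ℝ) : cnt (timesBelow (N m ω) l) = thin (cnt (N m ω)) l :=
  HAR.cnt_timesBelow (h.countable m ω) (h.injOn_fst m ω) l

/-- The process with the intensities and chains given by the limit of the Picard iterates. -/
noncomputable def solution (T : TimeGrid P) (𝔐 : Params M P) (N : Fin M → Ω → Set (ℝ × ℝ))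
    (ξ : Fin P → ℤ → Ω → ℝ) : HARTriple M P Ω where
  lam m t ω := (iterLim T 𝔐 (noiseOf N ξ ω)).1 m t
  S m ω := timesBelow (N m ω) ((iterLim T 𝔐 (noiseOf N ξ ω)).1 m)
  W p j ω := (iterLim T 𝔐 (noiseOf N ξ ω)).2 p j

/-- The intensities and chains of a process. -/
def HARTriple.traj (X : HARTriple M P Ω) (ω : Ω) : Traj M P :=
  (fun m t => X.lam m t ω, fun p j => X.W p j ω)

theorem L1Bounded.exists_l1Near {X : HARTriple M P Ω} (hX : L1Bounded μ X) :
    ∃ D : Fin M ⊕ Fin P → ℝ≥0∞, (∀ α, D α ≠ ∞) ∧ L1Near μ X.traj (fun _ => 0) D := by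
  refine ⟨Sum.elim (fun _ => ⨆ m, ⨆ t, ∫⁻ ω, ‖X.lam m t ω‖ₑ ∂μ)
    fun _ => ⨆ p, ⨆ j, ∫⁻ ω, ‖X.W p j ω‖ₑ ∂μ, ?_, fun m => Filter.Eventually.of_forall fun s => ?_,
    fun p j => ?_⟩
  · rintro (m | p)
    exacts [hX.1.ne, hX.2.ne]
  · simpa [HARTriple.traj] using le_iSup₂ (f := fun m t => ∫⁻ ω, ‖X.lam m t ω‖ₑ ∂μ) m s
  · simpa [HARTriple.traj] using le_iSup₂ (f := fun p j => ∫⁻ ω, ‖X.W p j ω‖ₑ ∂μ) p j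

theorem IsHAR.adaptedTraj {X : HARTriple M P Ω} (hX : IsHAR T 𝔐 μ N ξ X) :
    AdaptedTraj T (filt T N ξ) X.traj := ⟨hX.lam_predictable, hX.W_adapted⟩

theorem IsHAR.ae_eq_timesBelow (h : IsDrivingNoise T N ξ μ) {X : HARTriple M P Ω}
    (hX : IsHAR T 𝔐 μ N ξ X) :
    ∀ᵐ ω ∂μ, ∀ m, X.S m ω = timesBelow (N m ω) ((X.traj ω).1 m) :=
  hX.S_eq.mono fun ω hω m => eq_timesBelow (h.injOn_fst m ω) (hω m)

variable [IsProbabilityMeasure μ]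

theorem AdaptedTraj.ae_prod_lam_eq (h : IsDrivingNoise T N ξ μ) {u u' : Ω → Traj M P}
    (hu : AdaptedTraj T (filt T N ξ) u) (hu' : AdaptedTraj T (filt T N ξ) u') {m : Fin M}
    (heq : ∀ᵐ t, ∀ᵐ ω ∂μ, (u ω).1 m t = (u' ω).1 m t) :
    ∀ᵐ z : Ω × ℝ ∂μ.prod volume, (u z.1).1 m z.2 = (u' z.1).1 m z.2 :=
  ae_prod_of_ae_ae (measurableSet_eq_fun (hu.measurable_lam h m) (hu'.measurable_lam h m)) heq

theorem ae_prod_absDrive_ne_top (h : IsDrivingNoise T N ξ μ) (hH : ∀ α β, 𝔐.H T α β ≠ ∞)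
    {u : Ω → Traj M P} (hu : AdaptedTraj T (filt T N ξ) u) {D : Fin M ⊕ Fin P → ℝ≥0∞}
    (hD : L1Near μ u (fun _ => 0) D) (hfin : ∀ α, D α ≠ ∞) (α : Fin M ⊕ Fin P) :
    ∀ᵐ z : Ω × ℝ ∂μ.prod volume,
      absDrive T 𝔐 (fun m => thin (cnt (N m z.1)) ((u z.1).1 m)) (u z.1).2 α z.2 ≠ ∞ :=
  ae_prod_of_ae_ae (((measurable_absDrive (𝔐 := 𝔐) h hu α).comp measurable_swap)
    (measurableSet_singleton ∞).compl)
    (Filter.Eventually.of_forall (ae_absDrive_ne_top h hH hu hD hfin α))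

theorem IsHAR.solves (h : IsDrivingNoise T N ξ μ) {X : HARTriple M P Ω}
    (hX : IsHAR T 𝔐 μ N ξ X) : Solves T 𝔐 μ (noiseOf N ξ) X.traj := by
  have hS := hX.ae_eq_timesBelow h
  have hdrive : ∀ᵐ ω ∂μ, ∀ α t, drive T 𝔐 X α t ω =
      driveOf T 𝔐 (fun m => thin (cnt (N m ω)) ((X.traj ω).1 m)) (X.traj ω).2 α t := by
    filter_upwards [hS] with ω hω α t
    simp_rw [← h.cnt_timesBelow, ← hω]
    rfl
  refine ⟨fun m => ?_, fun p j => ?_⟩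
  · have h1 := Measure.ae_ae_of_ae_prod
      (Measure.measurePreserving_swap.quasiMeasurePreserving.ae (hX.lam_eq m))
    filter_upwards [h1] with s hs
    filter_upwards [hs, hdrive] with ω h2 h3
    refine h2.2.trans ?_
    rw [Prod.snd_swap, Prod.fst_swap, h3]
    rfl
  · filter_upwards [hX.W_eq, hdrive] with ω h2 h3
    refine (h2 p j).2.trans ?_
    rw [h3]
    rfl

theorem isHAR_solution (h : IsDrivingNoise T N ξ μ) (hspec : 𝔐.Spec T) (hξ : FiMe ξ μ) :
    IsHAR T 𝔐 μ N ξ (solution T 𝔐 N ξ) := by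
  have hη := adaptedNoise_noiseOf h
  have hlim := hη.iterLim 𝔐
  have hcnt : ∀ m ω, cnt ((solution T 𝔐 N ξ).S m ω) =
      thin (cnt (N m ω)) ((iterLim T 𝔐 (noiseOf N ξ ω)).1 m) := fun m ω => h.cnt_timesBelow m ω _
  have hfin : ∀ α t, ∀ᵐ ω ∂μ, absDrive T 𝔐 (fun m => cnt ((solution T 𝔐 N ξ).S m ω))
      (iterLim T 𝔐 (noiseOf N ξ ω)).2 α t ≠ ∞ := by
    simp_rw [hcnt]
    exact fun α t => ae_absDrive_ne_top h hspec.1 hlim (l1Close_iterLim_zero h hspec hξ).near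
      (tailBound_zero_ne_top hspec hξ) α t
  have hdrive : ∀ α t ω, drive T 𝔐 (solution T 𝔐 N ξ) α t ω =
      driveOf T 𝔐 (fun m => thin (cnt (N m ω)) ((iterLim T 𝔐 (noiseOf N ξ ω)).1 m))
        (iterLim T 𝔐 (noiseOf N ξ ω)).2 α t := by
    intro α t ω
    simp_rw [← hcnt]
    rfl
  have hconv : ∀ α t ω, absDrive T 𝔐 (fun m => cnt ((solution T 𝔐 N ξ).S m ω))
      (iterLim T 𝔐 (noiseOf N ξ ω)).2 α t ≠ ∞ → DriveConverges T 𝔐 (solution T 𝔐 N ξ) α t ω :=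
    fun α t ω h => driveOfConverges_of_absDrive_ne_top h
  refine ⟨hlim.lam, fun m t => ?_, hlim.W, fun m => ?_, ?_, ?_⟩
  · simp_rw [cnt_inter _ measurableSet_Iic, hcnt]
    exact measurable_thin_restrict_Iic hη.mono (hη.measurable_restrict m) (hη.boxFinite m)
      (hlim.lam m) t
  · have h1 : ∀ᵐ z : Ω × ℝ ∂μ.prod volume, absDrive T 𝔐
        (fun m => cnt ((solution T 𝔐 N ξ).S m z.1)) (iterLim T 𝔐 (noiseOf N ξ z.1)).2
        (Sum.inl m) z.2 ≠ ∞ := by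
      simp_rw [hcnt]
      exact ae_prod_absDrive_ne_top h hspec.1 hlim (l1Close_iterLim_zero h hspec hξ).near
        (tailBound_zero_ne_top hspec hξ) (Sum.inl m)
    have h2 := hlim.ae_prod_lam_eq h (hlim.step 𝔐 hη) (Filter.Eventually.of_forall
      (iterLim_lam_eq h hspec hξ m))
    filter_upwards [h1, h2] with z h3 h4
    exact ⟨hconv _ _ _ h3, by rw [hdrive]; exact h4⟩
  · exact Filter.Eventually.of_forall fun ω m C => encard_timesBelow_inter (h.injOn_fst m ω) _ C
  · rw [ae_all_iff]
    intro p
    rw [ae_all_iff]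
    intro j
    filter_upwards [hfin (Sum.inr p) (T.time p j), iterLim_W_eq h hspec hξ p j] with ω h3 h4
    exact ⟨hconv _ _ _ h3, by rw [hdrive]; exact h4⟩

theorem l1Bounded_solution (h : IsDrivingNoise T N ξ μ) (hspec : 𝔐.Spec T) (hξ : FiMe ξ μ) :
    L1Bounded μ (solution T 𝔐 N ξ) := by
  have hD := l1Close_iterLim_zero h hspec hξ
  have hfin : ∑ α, tailBound T 𝔐 μ ξ 0 α < ∞ :=
    (ENNReal.sum_ne_top.2 fun α _ => tailBound_zero_ne_top hspec hξ α).lt_top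
  have hle : ∀ α, tailBound T 𝔐 μ ξ 0 α ≤ ∑ α, tailBound T 𝔐 μ ξ 0 α := fun α =>
    Finset.single_le_sum (fun _ _ => zero_le) (Finset.mem_univ α)
  refine ⟨(iSup₂_le fun m t => ?_).trans_lt hfin, (iSup₂_le fun p j => ?_).trans_lt hfin⟩
  · exact le_trans (by simpa [solution] using hD.lam m t) (hle (Sum.inl m))
  · exact le_trans (by simpa [solution] using hD.W p j) (hle (Sum.inr p))

/-- The process seen from time one is the same measurable function applied to the shifted noise,
which has the same law as the noise. -/
theorem isOneStationary_solution (h : IsDrivingNoise T N ξ μ) (𝔐 : Params M P) :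
    IsOneStationary T μ (solution T 𝔐 N ξ) := by
  have hcnt : ∀ m ω, cnt ((solution T 𝔐 N ξ).S m ω) =
      thin (cnt (N m ω)) ((iterLim T 𝔐 (noiseOf N ξ ω)).1 m) := fun m ω => h.cnt_timesBelow m ω _
  have h1 : (solution T 𝔐 N ξ).path = fun ω => solutionPath T 𝔐 (noiseOf N ξ ω) := by
    funext ω
    simp only [HARTriple.path, hcnt]
    rfl
  have himage : ∀ S : Set ℝ, {s | s + 1 ∈ S} = MeasurableEquiv.subRight (1 : ℝ) '' S := by
    intro S
    ext s
    constructor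
    · exact fun hs => ⟨s + 1, hs, add_sub_cancel_right s 1⟩
    · rintro ⟨x, hx, rfl⟩
      change x - 1 + 1 ∈ S
      rwa [sub_add_cancel]
  have h2 : ((solution T 𝔐 N ξ).shift T).path =
      fun ω => solutionPath T 𝔐 (shiftNoise T (noiseOf N ξ ω)) := by
    funext ω
    simp only [HARTriple.path, HARTriple.shift, himage, cnt_image_equiv, hcnt, solutionPath,
      iterLim_shift]
    refine Prod.ext rfl (Prod.ext ?_ rfl)
    funext m
    exact (thin_shift _ _).symm
  unfold IsOneStationary
  rw [h1, h2]
  exact identDistrib_solutionPath h 𝔐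

theorem IsHAR.isModification (h : IsDrivingNoise T N ξ μ) (hspec : 𝔐.Spec T)
    {X Y : HARTriple M P Ω} (hX : IsHAR T 𝔐 μ N ξ X) (hX' : L1Bounded μ X)
    (hY : IsHAR T 𝔐 μ N ξ Y) (hY' : L1Bounded μ Y) : IsModification μ X Y := by
  obtain ⟨D₁, hfin₁, hD₁⟩ := hX'.exists_l1Near
  obtain ⟨D₂, hfin₂, hD₂⟩ := hY'.exists_l1Near
  have hu := hX.adaptedTraj
  have hu' := hY.adaptedTraj
  have hnear := Solves.l1Near_zero h hspec hu hu' (hX.solves h) (hY.solves h) hD₁ hfin₁ hD₂ hfin₂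
  refine ⟨fun m => ?_, ?_, ?_⟩
  · refine hu.ae_prod_lam_eq h hu' ?_
    filter_upwards [hnear.lam m] with s hs
    exact ae_eq_of_lintegral_enorm_sub_le_zero (hu.measurable_lam_apply h m s)
      (hu'.measurable_lam_apply h m s) hs
  -- A time belonging to exactly one of the two point sets carries an atom between the two graphs.
  · have hbetween : ∀ᵐ ω ∂μ, ∀ m, ∀ z ∈ N m ω,
        ¬(min ((X.traj ω).1 m z.1) ((Y.traj ω).1 m z.1) < z.2 ∧
          z.2 ≤ max ((X.traj ω).1 m z.1) ((Y.traj ω).1 m z.1)) := by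
      rw [ae_all_iff]
      intro m
      have hle := predictable_le h.filt_le
      -- With weight one the bound is `(∫ 1) * 0`, which is zero in `[0, ∞]` although the integral
      -- is infinite.
      have h1 := h.lintegral_between_le m (hu.lam m) (hu'.lam m) (g := fun _ => 1)
        measurable_const (hnear.lam m)
      rw [Pi.zero_apply, mul_zero, nonpos_iff_eq_zero,
        lintegral_eq_zero_iff (h.measurable_lintegral_between m ((hu.lam m).mono hle le_rfl)
          ((hu'.lam m).mono hle le_rfl) measurable_const)] at h1
      filter_upwards [h1] with ω hω
      have hl := measurable_section_of_predictable (hu.lam m) ω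
      have hl' := measurable_section_of_predictable (hu'.lam m) ω
      have hset : MeasurableSet {z : ℝ × ℝ |
          min ((X.traj ω).1 m z.1) ((Y.traj ω).1 m z.1) < z.2 ∧
          z.2 ≤ max ((X.traj ω).1 m z.1) ((Y.traj ω).1 m z.1)} :=
        (measurableSet_lt ((hl.comp measurable_fst).min (hl'.comp measurable_fst))
          measurable_snd).inter (measurableSet_le measurable_snd
            ((hl.comp measurable_fst).max (hl'.comp measurable_fst)))
      have h2 := (lintegral_eq_zero_iff (Measurable.ite hset measurable_const
        measurable_const)).1 hω
      exact forall_mem_of_ae_cnt (h2.mono fun z hz hlt => by simp [hlt] at hz)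
    filter_upwards [hX.ae_eq_timesBelow h, hY.ae_eq_timesBelow h, hbetween] with ω h1 h2 h3 m
    rw [h1 m, h2 m]
    ext s
    refine exists_congr fun x => and_congr_right fun hx => ?_
    have h4 := h3 m (s, x) hx
    rw [not_and, not_le, min_lt_iff, max_lt_iff] at h4
    constructor
    · exact fun hle => not_lt.1 fun hlt => (h4 (Or.inr hlt)).1.not_ge hle
    · exact fun hle => not_lt.1 fun hlt => (h4 (Or.inl hlt)).2.not_ge hle
  · rw [ae_all_iff]
    intro p
    rw [ae_all_iff]
    intro j
    exact ae_eq_of_lintegral_enorm_sub_le_zero (hu.measurable_W h p j) (hu'.measurable_W h p j)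
      (hnear.W p j)

end Solution

end HAR

theorem theorem3p9 {M P : ℕ} (T : HAR.TimeGrid P) (𝔐 : HAR.Params M P)
    {Ω : Type*} [MeasurableSpace Ω] (μ : Measure Ω) [IsProbabilityMeasure μ]
    (N : Fin M → Ω → Set (ℝ × ℝ)) (ξ : Fin P → ℤ → Ω → ℝ)
    (hnoise : HAR.IsDrivingNoise T N ξ μ)
    (hspec : 𝔐.Spec T) (hfime : HAR.FiMe ξ μ) :
    ∃ X : HAR.HARTriple M P Ω,
      HAR.IsHAR T 𝔐 μ N ξ X ∧ HAR.L1Bounded μ X ∧ HAR.IsOneStationary T μ X ∧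
        ∀ Y : HAR.HARTriple M P Ω, HAR.IsHAR T 𝔐 μ N ξ Y → HAR.L1Bounded μ Y →
          HAR.IsModification μ X Y := by
  exact ⟨HAR.solution T 𝔐 N ξ, HAR.isHAR_solution hnoise hspec hfime,
    HAR.l1Bounded_solution hnoise hspec hfime, HAR.isOneStationary_solution hnoise 𝔐,
    fun _ hY hY' => (HAR.isHAR_solution hnoise hspec hfime).isModification hnoise hspec
      (HAR.l1Bounded_solution hnoise hspec hfime) hY hY'⟩
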